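/- **Setting.** Let $n\ge 0$, $r_1,\dots,r_n\ge 1$, $r_\infty\ge 1$ be integers. The parameters are distinct points $X_1,\dots,X_n\in\mathbb C$, irregular times $t_{X_s,k}$ ($1\le k\le r_s-1$) with $t_{X_s,r_s-1}\neq 0$ if $r_s\ge2$, irregular times $t_{\infty,k}$ ($1\le k\le r_\infty-1$) with $t_{\infty,r_\infty-1}=1$ if $r_\infty\ge 2$ and $t_{\infty,r_\infty-2}=0$ if $r_\infty\ge 3$, and constant monodromies $t_{X_s,0}$, $t_{\infty,0}$. Any chosen set of the parameters $X_s$, $t_{X_s,k}$ ($1\le k\le r_s-1$), $t_{\infty,k}$ ($1\le k\le r_\infty-3$) varies in a connected open set $D$ of its coordinate space, and the other parameters are held fixed (for example $X_1=0$ if $r_\infty=2$; $X_1=0$, $X_2=1$ if $r_\infty=1$, $n\ge 2$; $X_1=0$, $t_{X_1,r_1-1}=1$ if $r_\infty=n=1$). For a vector $\alpha$ of components $\alpha_{X_s},\alpha_{X_s,k},\alpha_{\infty,k}$ (zero for the fixed parameters) let $\delta^{(\alpha)}$ be the corresponding directional derivative, and $\delta_{t}$ the partial derivative in a varying time $t$.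 "Constant" means constant on $D$. Let $\tilde L(\lambda)=\sum_{k=1}^{r_\infty-1}\tilde L^{[\infty,k]}\lambda^{k-1}+\sum_{s=1}^n\sum_{k=0}^{r_s-1}\tilde L^{[X_s,k]}(\lambda-X_s)^{-k-1}$ be a family of matrices, with coefficients in $\mathfrak{sl}_2(\mathbb C)$ holomorphic on $D$, such that, with $\sigma_3=\mathrm{diag}(1,-1)$: * (times) near $X_s$ there is a holomorphic invertible $G_s$ with $G_s\tilde LG_s^{-1}=Y_s\sigma_3+O(1)$, $Y_s=\sum_{k=0}^{r_s-1}t_{X_s,k}(\lambda-X_s)^{-k-1}$; near $\infty$ there is a holomorphic invertible $G_\infty$ with $G_\infty(\infty)=I$ and $G_\infty\tilde LG_\infty^{-1}=Y_\infty\sigma_3+O(\lambda^{-2})$, $Y_\infty=-\sum_{k=0}^{r_\infty-1}t_{\infty,k}\lambda^{k-1}$; * (normalization) $\tilde L^{[\infty,r_\infty-1]}=-t_{\infty,r_\infty-1}\sigma_3$ if $r_\infty\ge 2$, $\sum_s\tilde L^{[X_s,0]}=-t_{\infty,0}\sigma_3$ if $r_\infty=1$; and $\omega\ne0$ on $D$,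 where the $\lambda^{r_\infty-3}$ coefficient of $\tilde L_{1,2}$ at $\infty$ is denoted $\omega$. Write $\tilde L_{1,2}(\lambda)=\sum_{s=1}^n\sum_{k=1}^{r_s}\frac{Q_{X_s,k}}{(\lambda-X_s)^k}+\sum_{k=0}^{r_\infty-4}Q_{\infty,k}\lambda^k+\omega\,\delta_{r_\infty\ge3}\lambda^{r_\infty-3}$. Thus $\omega=\sum_sQ_{X_s,1}$ if $r_\infty=2$, and $\sum_sQ_{X_s,1}=0$, $\omega=\sum_{s:\,r_s\ge2}Q_{X_s,2}+\sum_sX_sQ_{X_s,1}$ if $r_\infty=1$. Let $\tilde A_\alpha(\lambda)$ be the auxiliary matrix of the isomonodromic deformation ($\partial_\alpha\tilde\Psi=\tilde A_\alpha\tilde\Psi$, where $\partial_\lambda\tilde\Psi=\tilde L\tilde\Psi$): the rational matrix with poles at the $X_s$ of order at most $r_s$ and a polynomial part of degree at most $r_\infty-1$ such that $\tilde A_\alpha=a_s\,G_s^{-1}\sigma_3G_s+O(1)$ at $X_s$, with $a_s=-\sum_{k=1}^{r_s-1}\frac{\alpha_{X_s,k}}{k}(\lambda-X_s)^{-k}-\alpha_{X_s}Y_s$,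 and $\tilde A_\alpha=a_\infty\,G_\infty^{-1}\sigma_3G_\infty+(\text{constant diagonal matrix})+O(\lambda^{-1})$ at $\infty$, with $a_\infty=-\sum_{k=1}^{r_\infty-3}\frac{\alpha_{\infty,k}}{k}\lambda^k$. The Darboux coordinates on which $\tilde L$ may depend are held fixed, so that $\delta^{(\alpha)}$ acts on the explicit dependence on the parameters. For a list $c_0,c_1,\dots$ let $T_m(c_0,\dots,c_{m-1})$ be the $m\times m$ lower-triangular Toeplitz matrix with entries $c_{i-j}$ ($i\ge j$). **Theorem.** There are lower-triangular matrices $F^{(X)}=(f^{(m)}_{i,j})_{1\le i,j\le m}$ for each $m\ge 1$, with $f^{(m)}_{i,j}$ depending only on $t_{m-(i-j)},\dots,t_{m}$ and on a root $t_m^{1/m}$, and $F^{(\infty)}=(f^{(\infty)}_{i,j})_{1\le i,j\le r_\infty-2}$ for each $r_\infty\ge 3$, with $f^{(\infty)}_{i,j}$ depending only on $t_{\infty,r_\infty-1-(i-j)},\dots,t_{\infty,r_\infty-3}$, all independent of the family $\tilde L$, such that for $m=r-1$ and $t_m\ne0$ $$f^{(m)}_{j,j}=t_{m}^{\frac{r-j}{r-1}}\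 (1\le j\le r-1),\qquad f^{(m)}_{j+1,j}=\tfrac{r-j-1}{r-2}\,t_{m}^{\frac{1-j}{r-1}}\,t_{m-1}\ (1\le j\le r-2),\qquad f^{(m)}_{j,1}=t_{r-j}\ (1\le j\le r-1),$$ $$f^{(\infty)}_{j,j}=1,\quad f^{(\infty)}_{j+1,j}=0,\quad f^{(\infty)}_{k+2,k}=\tfrac{r_\infty-3-k}{r_\infty-3}t_{\infty,r_\infty-3}\ (1\le k\le r_\infty-4),\quad f^{(\infty)}_{k+3,k}=\tfrac{r_\infty-4-k}{r_\infty-4}t_{\infty,r_\infty-4}\ (1\le k\le r_\infty-5),$$ and such that for every family as above the following holds. **(A)** The condition $\delta^{(\alpha)}[\tilde L_{1,2}(\lambda)]=\partial_\lambda[\tilde A_\alpha(\lambda)]_{1,2}$, for all $\alpha$, all points of $D$ and all $\lambda\notin\{X_1,\dots,X_n\}$, is equivalent to the conjunction of: 1. for every $s$, $Q_{X_s,1}$ is constant; 2. for every $s$ with $r_s\ge2$, the functions $Q_{X_s,2},\dots,Q_{X_s,r_s}$ depend on no varying parameter other than $t_{X_s,1},\dots,t_{X_s,r_s-1}$, and,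 with $m=r_s-1$ and $\Delta=\mathrm{diag}(\frac1{m},\frac1{m-1},\dots,\frac11)$, $$T_m(t_{X_s,m},\dots,t_{X_s,1})\,\Delta\,\Big(\delta_{t_{X_s,m+1-j}}[Q_{X_s,r_s+1-i}]\Big)_{1\le i,j\le m}=T_m(Q_{X_s,r_s},\dots,Q_{X_s,2})\,\Delta$$ (only those columns $j$ for which $t_{X_s,m+1-j}$ varies); 3. if $r_\infty\ge2$, $\omega$ is constant; if $r_\infty\ge4$, $Q_{\infty,r_\infty-4}=\omega u$ with $u$ constant; if $r_\infty\ge5$, the functions $Q_{\infty,0},\dots,Q_{\infty,r_\infty-5}$ depend on no varying parameter other than $t_{\infty,2},\dots,t_{\infty,r_\infty-3}$, and, with $p=r_\infty-4$, $$T_p(1,0,t_{\infty,r_\infty-3},\dots,t_{\infty,4})\,\mathrm{diag}\big(\tfrac1{r_\infty-4},\dots,\tfrac11\big)\Big(\delta_{t_{\infty,r_\infty-2-j}}[Q_{\infty,r_\infty-4-i}]\Big)_{1\le i,j\le p}=T_p(\omega,Q_{\infty,r_\infty-4},\dots,Q_{\infty,2})\,\mathrm{diag}\big(\tfrac1{r_\infty-3},\dots,\tfrac12\big)$$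 (only those columns $j$ for which $t_{\infty,r_\infty-2-j}$ varies). **(B)** Given a holomorphic branch on $D$ of $t_{X_s,r_s-1}^{1/(r_s-1)}$ for each $s$ with $r_s\ge2$, the same condition is equivalent to the existence of constants $u_{X_s,k}$ ($1\le k\le r_s$) and $u_{\infty,k}$ ($0\le k\le r_\infty-4$) such that, with $F^{(X_s)}$ the matrix $F^{(X)}$ for $m=r_s-1$ evaluated at the $t_{X_s,k}$ and at this branch: * $Q_{X_s,1}=u_{X_s,1}$ and $(Q_{X_s,r_s},\dots,Q_{X_s,2})^t=F^{(X_s)}(u_{X_s,r_s},\dots,u_{X_s,2})^t$ for every $s$; * if $r_\infty\ge2$, $\omega$ is constant; if $r_\infty\ge4$, $(\omega,Q_{\infty,r_\infty-4},\dots,Q_{\infty,0})^t=\omega\,F^{(\infty)}(1,u_{\infty,r_\infty-4},\dots,u_{\infty,0})^t$; * if $r_\infty=2$, $\omega=\sum_{s}u_{X_s,1}$; * if $r_\infty=1$, $\sum_su_{X_s,1}=0$ and $\omega=\sum_sX_su_{X_s,1}+\sum_s\sum_{j=1}^{r_s-1}f^{(X_s)}_{r_s-1,j}\,u_{X_s,r_s+1-j}$.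 -/

import Mathlib

open Matrix Filter Topology Asymptotics Bornology

noncomputable section

namespace GeometricLax

/-- Pole structure of a rational connection on the Riemann sphere: `n` finite poles of orders
`r s ≥ 1` and a pole at infinity of order `rInf ≥ 1`. -/
structure PoleType where
  n : ℕ
  r : Fin n → ℕ
  rInf : ℕ
  r_pos : ∀ s, 1 ≤ r s
  rInf_pos : 1 ≤ rInf

/-- Names of the parameters: the position `X_s`, the time `t_{X_s,k}` and the time `t_{∞,k}`.
The index `k = 0` is the monodromy, the indices `1 ≤ k ≤ r - 1` are the irregular times. -/
inductive Param (n : ℕ) : Type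
  | pos (s : Fin n) : Param n
  | time (s : Fin n) (k : ℕ) : Param n
  | timeInf (k : ℕ) : Param n
  deriving DecidableEq

/-- The choice of the deformation parameters. The parameters in `vary` are the coordinates of the
deformation space; all the others keep the value given by `base`. Only positions and irregular
times may vary (never a monodromy), and the two leading irregular times at infinity have the
values `t_{∞,r_∞-1} = 1` (when `r_∞ ≥ 2`) and `t_{∞,r_∞-2} = 0` (when `r_∞ ≥ 3`). Further
normalizations that use up the Moebius freedom (such as `X_1 = 0`, or `X_1 = 0` and `X_2 = 1`,
or `X_1 = 0` and `t_{X_1,r_1-1} = 1`) are obtained by leaving those parameters out of `vary`. -/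
structure Deformation (S : PoleType) where
  vary : Finset (Param S.n)
  base : Param S.n → ℂ
  time_mem : ∀ s k, Param.time s k ∈ vary → 1 ≤ k ∧ k ≤ S.r s - 1
  timeInf_mem : ∀ k, Param.timeInf k ∈ vary → 1 ≤ k ∧ k ≤ S.rInf - 3
  base_lead : 2 ≤ S.rInf → base (Param.timeInf (S.rInf - 1)) = 1
  base_sublead : 3 ≤ S.rInf → base (Param.timeInf (S.rInf - 2)) = 0

/-- The space of deformation parameters. -/
abbrev Deformation.Space {S : PoleType} (P : Deformation S) : Type := P.vary → ℂ

/-- Values of all parameters at a point of the deformation space. -/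
def Deformation.value {S : PoleType} (P : Deformation S) (x : P.Space) (p : Param S.n) : ℂ :=
  if h : p ∈ P.vary then x ⟨p, h⟩ else P.base p

/-- All components of a deformation direction; they vanish for the parameters held fixed. -/
def Deformation.dir {S : PoleType} (P : Deformation S) (α : P.Space) (p : Param S.n) : ℂ :=
  if h : p ∈ P.vary then α ⟨p, h⟩ else 0

/-- The position `X_s`. -/
def Deformation.X {S : PoleType} (P : Deformation S) (x : P.Space) (s : Fin S.n) : ℂ :=
  P.value x (Param.pos s)

/-- The time `t_{X_s,k}`. -/
def Deformation.t {S : PoleType} (P : Deformation S) (x : P.Space) (s : Fin S.n) (k : ℕ) : ℂ :=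
  P.value x (Param.time s k)

/-- The time `t_{∞,k}`. -/
def Deformation.tInf {S : PoleType} (P : Deformation S) (x : P.Space) (k : ℕ) : ℂ :=
  P.value x (Param.timeInf k)

/-- The partial derivative along a varying parameter. -/
def Deformation.pd {S : PoleType} (P : Deformation S) (f : P.Space → ℂ) (x : P.Space)
    (p : P.vary) : ℂ :=
  fderiv ℂ f x (Pi.single p 1)

/-- Admissible parameters: the poles are distinct and the leading irregular time at each finite
pole of order at least `2` does not vanish (distinct eigenvalues of the leading coefficient). -/
def Deformation.Admissible {S : PoleType} (P : Deformation S) (x : P.Space) : Prop :=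
  Function.Injective (P.X x) ∧ ∀ s, 2 ≤ S.r s → P.t x s (S.r s - 1) ≠ 0

/-- Coefficients of a rational `2 × 2` matrix function: `inf k` is the coefficient of `z^(k-1)`
and `fin s k` is the coefficient of `(z - X_s)^(-(k+1))`. -/
structure Coeffs (n : ℕ) where
  inf : ℕ → Matrix (Fin 2) (Fin 2) ℂ
  fin : Fin n → ℕ → Matrix (Fin 2) (Fin 2) ℂ

/-- The rational matrix function with poles of order at most `r s` at `X s` and polynomial part of
degree less than `N`. -/
def Coeffs.eval {n : ℕ} (C : Coeffs n) (r : Fin n → ℕ) (N : ℕ) (X : Fin n → ℂ) (z : ℂ) :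
    Matrix (Fin 2) (Fin 2) ℂ :=
  ∑ k ∈ Finset.Icc 1 N, z ^ (k - 1) • C.inf k +
    ∑ s, ∑ k ∈ Finset.range (r s), ((z - X s) ^ (k + 1))⁻¹ • C.fin s k

/-- The matrix `diag (1, -1)`. -/
def sigma3 : Matrix (Fin 2) (Fin 2) ℂ := Matrix.diagonal ![1, -1]

/-- The Lax matrix with coefficients `C` over the point `x`. -/
def lax {S : PoleType} (P : Deformation S) (x : P.Space) (C : Coeffs S.n) (z : ℂ) :
    Matrix (Fin 2) (Fin 2) ℂ :=
  C.eval S.r (S.rInf - 1) (P.X x) z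

/-- The auxiliary matrix with coefficients `C` over the point `x`: its poles are dominated by those
of the Lax matrix, except that a constant term is always allowed. -/
def aux {S : PoleType} (P : Deformation S) (x : P.Space) (C : Coeffs S.n) (z : ℂ) :
    Matrix (Fin 2) (Fin 2) ℂ :=
  C.eval S.r S.rInf (P.X x) z

/-- The singular part at `X_s` of the diagonalized connection, with irregular times
`t_{X_s,k}`, `1 ≤ k ≤ r_s - 1`, and monodromy `t_{X_s,0}`; the diagonal form is `Y • diag (1, -1)`.
-/
def Y {S : PoleType} (P : Deformation S) (x : P.Space) (s : Fin S.n) (z : ℂ) : ℂ :=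
  ∑ k ∈ Finset.range (S.r s), P.t x s k * ((z - P.X x s) ^ (k + 1))⁻¹

/-- The singular part at infinity of the diagonalized connection. -/
def YInf {S : PoleType} (P : Deformation S) (x : P.Space) (z : ℂ) : ℂ :=
  -∑ k ∈ Finset.range S.rInf, P.tInf x k * z ^ ((k : ℤ) - 1)

/-- The singular part at `X_s` of the derivative, in the direction `α`, of the exponent
`-∑ t_{X_s,k} / (k (z - X_s)^k) + t_{X_s,0} log (z - X_s)` (a primitive of `Y`) of the formal
solution at `X_s`. -/
def a {S : PoleType} (P : Deformation S) (x α : P.Space) (s : Fin S.n) (z : ℂ) : ℂ :=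
  -∑ k ∈ Finset.Icc 1 (S.r s - 1),
      P.dir α (Param.time s k) / (k : ℂ) * ((z - P.X x s) ^ k)⁻¹
    - P.dir α (Param.pos s) * Y P x s z

/-- The derivative, in the direction `α`, of the exponent `-∑ t_{∞,k} z^k / k - t_{∞,0} log z` of
the formal solution at infinity. -/
def aInf {S : PoleType} (P : Deformation S) (α : P.Space) (z : ℂ) : ℂ :=
  -∑ k ∈ Finset.Icc 1 (S.rInf - 3), P.dir α (Param.timeInf k) / (k : ℂ) * z ^ k

/-- `G` is a holomorphic gauge at `X_s` that brings the Lax matrix to its diagonal normal form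
(the term `(∂_z G) G⁻¹` is regular, and so is part of the remainder). -/
def IsGauge {S : PoleType} (P : Deformation S) (x : P.Space) (C : Coeffs S.n) (s : Fin S.n)
    (G : ℂ → Matrix (Fin 2) (Fin 2) ℂ) : Prop :=
  (∀ i j, AnalyticAt ℂ (fun z => G z i j) (P.X x s)) ∧ (G (P.X x s)).det ≠ 0 ∧
    ∀ i j, (fun z => (G z * lax P x C z * (G z)⁻¹ - Y P x s z • sigma3) i j)
      =O[𝓝[≠] (P.X x s)] (fun _ => (1 : ℂ))

/-- `G`, a function of the local coordinate `1 / z`, is a holomorphic gauge at infinity that brings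
the Lax matrix to its diagonal normal form. As the leading term of the Lax matrix is already
diagonal, `G` is normalized to be the identity at infinity. The term `(∂_z G) G⁻¹` is `O(z⁻²)`. -/
def IsGaugeInf {S : PoleType} (P : Deformation S) (x : P.Space) (C : Coeffs S.n)
    (G : ℂ → Matrix (Fin 2) (Fin 2) ℂ) : Prop :=
  (∀ i j, AnalyticAt ℂ (fun w => G w i j) 0) ∧ G 0 = 1 ∧
    ∀ i j, (fun z => (G z⁻¹ * lax P x C z * (G z⁻¹)⁻¹ - YInf P x z • sigma3) i j)
      =O[cobounded ℂ] (fun z => (z ^ 2)⁻¹)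

/-- The coordinate `Q_{X_s,k}`, `1 ≤ k ≤ r_s`: the coefficient of `(z - X_s)^(-k)` in the entry
`(1,2)` of the Lax matrix. -/
def Q {n : ℕ} (C : Coeffs n) (s : Fin n) (k : ℕ) : ℂ := C.fin s (k - 1) 0 1

/-- The coefficient of `z^k` in the entry `(1,2)` of the Lax matrix, `0 ≤ k ≤ r_∞ - 3`. It is the
coordinate `Q_{∞,k}` for `k ≤ r_∞ - 4` and the normalization coefficient `ω` for `k = r_∞ - 3`. -/
def QInf {n : ℕ} (C : Coeffs n) (k : ℕ) : ℂ := C.inf (k + 1) 0 1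

/-- The normalization coefficient `ω`: the entry `(1,2)` of the Lax matrix is
`ω z^(r_∞-3) + O(z^(r_∞-4))` at infinity. -/
def omega {S : PoleType} (P : Deformation S) (x : P.Space) (C : Coeffs S.n) : ℂ :=
  if S.rInf = 1 then
    ∑ s, ((if 2 ≤ S.r s then Q C s 2 else 0) + P.X x s * Q C s 1)
  else if S.rInf = 2 then ∑ s, Q C s 1
  else QInf C (S.rInf - 3)

/-- The coefficients `C` are those of a Lax matrix in `sl_2`, normalized at infinity, whose
irregular times and monodromies are the ones given by the point `x`. -/
structure IsLax {S : PoleType} (P : Deformation S) (x : P.Space) (C : Coeffs S.n) : Prop where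
  trace_inf : ∀ k ∈ Finset.Icc 1 (S.rInf - 1), (C.inf k).trace = 0
  trace_fin : ∀ s, ∀ k < S.r s, (C.fin s k).trace = 0
  /-- leading coefficient at infinity -/
  lead : 2 ≤ S.rInf → C.inf (S.rInf - 1) = -(P.tInf x (S.rInf - 1)) • sigma3
  /-- leading coefficient at infinity when `r_∞ = 1` -/
  lead_one : S.rInf = 1 → ∑ s, C.fin s 0 = -(P.tInf x 0) • sigma3
  omega_ne : omega P x C ≠ 0
  gauge : ∀ s, ∃ G, IsGauge P x C s G
  gauge_inf : ∃ G, IsGaugeInf P x C G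

/-- `A` is the auxiliary matrix, in the direction `α`, of the isomonodromic deformation through the
Lax matrix with coefficients `C`, that is, the matrix with `∂_α Ψ = A Ψ` for the wave matrix `Ψ`,
`∂_z Ψ = L Ψ`. As `Ψ = (holomorphic) * exp (diagonal exponent) * (constant)` at every pole, this
is the rational matrix whose singular part at each pole is that of `G⁻¹ (∂_α exponent) G`, with `G`
a diagonalizing gauge. At infinity the only freedom compatible with the normalization of the Lax
matrix is a constant diagonal term. -/
def IsAux {S : PoleType} (P : Deformation S) (x α : P.Space) (C A : Coeffs S.n) : Prop :=
  (∀ s, ∃ G, IsGauge P x C s G ∧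
    ∀ i j, (fun z => (aux P x A z - a P x α s z • ((G z)⁻¹ * sigma3 * G z)) i j)
      =O[𝓝[≠] (P.X x s)] (fun _ => (1 : ℂ))) ∧
  ∃ G, IsGaugeInf P x C G ∧ ∃ c : Fin 2 → ℂ,
    ∀ i j, (fun z => (aux P x A z - aInf P α z • ((G z⁻¹)⁻¹ * sigma3 * G z⁻¹)
        - Matrix.diagonal c) i j)
      =O[cobounded ℂ] (fun z => z⁻¹)

/-- Holomorphic family of normalized Lax matrices over `D`. -/
structure IsLaxFamily {S : PoleType} (P : Deformation S) (D : Set P.Space)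
    (L : P.Space → Coeffs S.n) : Prop where
  lax : ∀ x ∈ D, IsLax P x (L x)
  holo_inf : ∀ k ∈ Finset.Icc 1 (S.rInf - 1), ∀ i j,
    DifferentiableOn ℂ (fun x => (L x).inf k i j) D
  holo_fin : ∀ s, ∀ k < S.r s, ∀ i j, DifferentiableOn ℂ (fun x => (L x).fin s k i j) D

/-- The entry `(1,2)` of the isospectral condition `δ_α L = ∂_z A_α`, in all directions `α`. -/
def Isospectral12 {S : PoleType} (P : Deformation S) (D : Set P.Space)
    (L : P.Space → Coeffs S.n) (A : P.Space → P.Space → Coeffs S.n) : Prop :=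
  ∀ x ∈ D, ∀ α : P.Space, ∀ z : ℂ, (∀ s, z ≠ P.X x s) →
    fderiv ℂ (fun y => lax P y (L y) z 0 1) x α = deriv (fun w => aux P x (A α x) w 0 1) z

/-- Lower-triangular Toeplitz matrix with `c d` on the `d`-th subdiagonal. -/
def toeplitz (m : ℕ) (c : ℕ → ℂ) : Matrix (Fin m) (Fin m) ℂ :=
  Matrix.of fun i j => if j ≤ i then c ((i : ℕ) - (j : ℕ)) else 0

/-- `diag (1/N, 1/(N-1), …, 1/(N-m+1))`. -/
def invDiagonal (m N : ℕ) : Matrix (Fin m) (Fin m) ℂ :=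
  Matrix.diagonal fun i => 1 / ((N - (i : ℕ) : ℕ) : ℂ)

/-- The differential system at `X_s`, of size `m = r_s - 1`. Its `j`-th column (`j = 0, …, m-1`) is
the equation for the derivative along `t_{X_s,m-j}`, when this time varies:
`T · diag(1/m, …, 1) · ∂(Q_{X_s,r_s}, …, Q_{X_s,2})ᵗ` is the `j`-th column of
`(Toeplitz matrix of Q_{X_s,r_s}, …, Q_{X_s,2}) · diag(1/m, …, 1)`, with `T` the Toeplitz matrix of
`t_{X_s,m}, …, t_{X_s,1}`. The `Q_{X_s,k}`, `k ≥ 2`, depend on no other parameter. -/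
def FiniteSystem {S : PoleType} (P : Deformation S) (D : Set P.Space)
    (L : P.Space → Coeffs S.n) (s : Fin S.n) : Prop :=
  ∀ x ∈ D,
    (∀ (j : Fin (S.r s - 1)) (h : Param.time s (S.r s - 1 - j) ∈ P.vary),
      (toeplitz (S.r s - 1) (fun d => P.t x s (S.r s - 1 - d)) *
          invDiagonal (S.r s - 1) (S.r s - 1)) *ᵥ
        (fun i => P.pd (fun y => Q (L y) s (S.r s - i)) x ⟨Param.time s (S.r s - 1 - j), h⟩) =
      fun i => (toeplitz (S.r s - 1) (fun d => Q (L x) s (S.r s - d)) *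
          invDiagonal (S.r s - 1) (S.r s - 1)) i j) ∧
    ∀ p : P.vary, (∀ k, p.1 ≠ Param.time s k) → ∀ i : Fin (S.r s - 1),
      P.pd (fun y => Q (L y) s (S.r s - i)) x p = 0

/-- The differential system at infinity, of size `r_∞ - 4` (void if `r_∞ ≤ 4`). Its `j`-th column
(`j = 0, …, r_∞ - 5`) is the equation for the derivative of `(Q_{∞,r_∞-5}, …, Q_{∞,0})` along
`t_{∞,r_∞-3-j}`, when this time varies. The matrices are the Toeplitz matrix of
`t_{∞,r_∞-1} = 1, t_{∞,r_∞-2} = 0, t_{∞,r_∞-3}, …, t_{∞,4}`, the one of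
`ω, Q_{∞,r_∞-4}, …, Q_{∞,2}`, and the diagonal matrices `diag(1/(r_∞-4), …, 1)` and
`diag(1/(r_∞-3), …, 1/2)`. The coordinates depend on no other parameter. -/
def InfiniteSystem {S : PoleType} (P : Deformation S) (D : Set P.Space)
    (L : P.Space → Coeffs S.n) : Prop :=
  ∀ x ∈ D,
    (∀ (j : Fin (S.rInf - 4)) (h : Param.timeInf (S.rInf - 3 - j) ∈ P.vary),
      (toeplitz (S.rInf - 4) (fun d => P.tInf x (S.rInf - 1 - d)) *
          invDiagonal (S.rInf - 4) (S.rInf - 4)) *ᵥ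
        (fun i => P.pd (fun y => QInf (L y) (S.rInf - 5 - i)) x
          ⟨Param.timeInf (S.rInf - 3 - j), h⟩) =
      fun i => (toeplitz (S.rInf - 4) (fun d => QInf (L x) (S.rInf - 3 - d)) *
          invDiagonal (S.rInf - 4) (S.rInf - 3)) i j) ∧
    ∀ p : P.vary, (∀ k, 2 ≤ k → p.1 ≠ Param.timeInf k) → ∀ i : Fin (S.rInf - 4),
      P.pd (fun y => QInf (L y) (S.rInf - 5 - i)) x p = 0

/-- `ρ s` is a holomorphic branch over `D` of the root `(t_{X_s,r_s-1})^(1/(r_s-1))`, for each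
pole with `r_s ≥ 2`. -/
def IsRootBranch {S : PoleType} (P : Deformation S) (D : Set P.Space)
    (ρ : Fin S.n → P.Space → ℂ) : Prop :=
  ∀ s, 2 ≤ S.r s → DifferentiableOn ℂ (ρ s) D ∧
    ∀ x ∈ D, ρ s x ^ (S.r s - 1) = P.t x s (S.r s - 1)

/-- Conditions on the matrices `F^{(X_s)}`. The matrix `f m ρ t` of size `m = r_s - 1` is a function
of the times `t 1, …, t m` and of a root `ρ` with `ρ ^ m = t m`, so that a power
`(t_m)^(k/m)` is `ρ ^ k`. Rows and columns are counted from `0`. -/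
structure IsFiniteCoeff (f : (m : ℕ) → ℂ → (ℕ → ℂ) → Matrix (Fin m) (Fin m) ℂ) : Prop where
  lower : ∀ m ρ t (i j : Fin m), i < j → f m ρ t i j = 0
  /-- the `(i, j)` entry depends on `t_{m-(i-j)}, …, t_m` only -/
  depends : ∀ m ρ t t' (i j : Fin m), j ≤ i →
    (∀ k, m - ((i : ℕ) - (j : ℕ)) ≤ k → k ≤ m → t k = t' k) → f m ρ t i j = f m ρ t' i j
  diag : ∀ m ρ t (j : Fin m), ρ ≠ 0 → ρ ^ m = t m → f m ρ t j j = ρ ^ (m - (j : ℕ))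
  subdiag : ∀ m ρ t (i j : Fin m), ρ ≠ 0 → ρ ^ m = t m → (i : ℕ) = (j : ℕ) + 1 →
    f m ρ t i j = ((m : ℂ) - (j : ℕ) - 1) / ((m : ℂ) - 1) * ρ ^ (-((j : ℕ) : ℤ)) * t (m - 1)
  first : ∀ m ρ t (i j : Fin m), ρ ≠ 0 → ρ ^ m = t m → (j : ℕ) = 0 → f m ρ t i j = t (m - (i : ℕ))

/-- Conditions on the matrix `F^{(∞)}`, as a function of `R = r_∞` and of the times at infinity.
Rows and columns are counted from `0`. -/
structure IsInfiniteCoeff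
    (f : (R : ℕ) → (ℕ → ℂ) → Matrix (Fin (R - 2)) (Fin (R - 2)) ℂ) : Prop where
  lower : ∀ R t (i j : Fin (R - 2)), i < j → f R t i j = 0
  /-- the `(i, j)` entry depends on `t_{∞,R-1-(i-j)}, …, t_{∞,R-3}` only -/
  depends : ∀ R t t' (i j : Fin (R - 2)), j ≤ i →
    (∀ k, R - 1 - ((i : ℕ) - (j : ℕ)) ≤ k → k ≤ R - 3 → t k = t' k) → f R t i j = f R t' i j
  diag : ∀ R t (j : Fin (R - 2)), f R t j j = 1
  subdiag : ∀ R t (i j : Fin (R - 2)), (i : ℕ) = (j : ℕ) + 1 → f R t i j = 0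
  subdiag2 : ∀ R t (i j : Fin (R - 2)), (i : ℕ) = (j : ℕ) + 2 →
    f R t i j = ((R : ℂ) - 4 - (j : ℕ)) / ((R : ℂ) - 3) * t (R - 3)
  subdiag3 : ∀ R t (i j : Fin (R - 2)), (i : ℕ) = (j : ℕ) + 3 →
    f R t i j = ((R : ℂ) - 5 - (j : ℕ)) / ((R : ℂ) - 4) * t (R - 4)

end GeometricLax

end

open GeometricLax

noncomputable section

namespace GeometricLax

/-! The argument is local at each pole. Let S be the exponent of the formal solution there (a
primitive of the diagonal singular part) and g the entry (1,2) of G⁻¹σ₃G. The singular part of the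
Lax entry is that of S'·g, and the singular part of the auxiliary entry is that of (δS)·g.
Eliminating the unknown g turns the condition, to the relevant order, into δL₁₂ = ∂((δS/S') L₁₂). If
L₁₂ = ∂F, apart from the residue, this says that δF = (δS/S') F': F varies only through S. Hence F
is a polynomial with constant coefficients in a fractional power S^(1/e), and these coefficients are
the constants u. The residue is constant because a derivative has no residue, and the displacement
of a pole is absorbed by the term -α_X·Y of δS.

In a local coordinate ζ, S is ζ^(-e) τ(ζ) up to a constant factor and up to terms that do not matter
(`tauSeq`). The local condition becomes the congruence `VarSystem` modulo ζ^N. At a finite pole N =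
e = r - 1. At infinity e = r_∞ - 1 but N = r_∞ - 2, because G(∞) = I makes g vanish at infinity. The
reductions are `finite_pole_iff` and `infinite_pole_iff`; partial fractions
(`isospectral12_iff_coeff`) make the poles independent of each other, giving
`isospectral12_iff_systems`.

For (A), the congruence is linear in the direction, so it may be tested on coordinate directions. A
single time changes a single coefficient of τ, which produces the Toeplitz equations
(`finiteSystem_iff`, `infiniteSystem_iff`).

For (B), the columns of a fundamental matrix come from the functions (ζ^(-e) τ)^((N-j)/e). A power W
= τ^a satisfies τW' = aτ'W in ζ and τ δW = a δτ W in the parameters (`powCoeff_ode`,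
`powCoeff_variation`); together these give the congruence (`column_system`). The resulting matrix
`powEntry` is triangular with nonvanishing diagonal, so variation of constants shows that every
solution has constant coefficients in these columns (`varSystem_iff_exists_const`). Its entries are
the matrices F. -/

/-! ### Powers of a power series and their dependence on parameters. -/

/-- Coefficients of the power `τ ^ a` of a power series `τ` with invertible constant term, with
prescribed constant term `w`. -/
def powCoeff (a w : ℂ) (τ : ℕ → ℂ) : ℕ → ℂ
  | 0 => w
  | n + 1 => (∑ k : Fin (n + 1), (a * ((k : ℕ) + 1) - ((n - k : ℕ) : ℂ)) * τ (k + 1) *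
      powCoeff a w τ (n - k)) / ((n + 1) * τ 0)

lemma powCoeff_zero (a w : ℂ) (τ : ℕ → ℂ) : powCoeff a w τ 0 = w := by
  rw [powCoeff]

lemma powCoeff_succ (a w : ℂ) (τ : ℕ → ℂ) (n : ℕ) :
    powCoeff a w τ (n + 1) = (∑ k ∈ Finset.range (n + 1),
      (a * (k + 1) - ((n - k : ℕ) : ℂ)) * τ (k + 1) * powCoeff a w τ (n - k)) /
        ((n + 1) * τ 0) := by
  rw [powCoeff, ← Fin.sum_univ_eq_sum_range
    (fun k => (a * (k + 1) - ((n - k : ℕ) : ℂ)) * τ (k + 1) * powCoeff a w τ (n - k))]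

lemma powCoeff_congr (a w : ℂ) {τ τ' : ℕ → ℂ} (n : ℕ) (h : ∀ i ≤ n, τ i = τ' i) :
    powCoeff a w τ n = powCoeff a w τ' n := by
  induction n using Nat.strong_induction_on with
  | _ n ih =>
    cases n with
    | zero => simp [powCoeff_zero]
    | succ n =>
      rw [powCoeff_succ, powCoeff_succ, h 0 (by omega)]
      congr 1
      refine Finset.sum_congr rfl fun k hk => ?_
      rw [Finset.mem_range] at hk
      rw [h (k + 1) (by omega), ih (n - k) (by omega) (fun i hi => h i (by omega))]

open PowerSeries in
/-- The differential equation satisfied by a power of a power series. -/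
lemma powCoeff_ode (a w : ℂ) {τ : ℕ → ℂ} (h : τ 0 ≠ 0) :
    PowerSeries.mk τ * derivative ℂ (PowerSeries.mk (powCoeff a w τ)) =
      C a * (derivative ℂ (PowerSeries.mk τ) * PowerSeries.mk (powCoeff a w τ)) := by
  ext n
  rw [coeff_C_mul, coeff_mul, coeff_mul,
    Finset.Nat.sum_antidiagonal_eq_sum_range_succ_mk,
    Finset.Nat.sum_antidiagonal_eq_sum_range_succ_mk, Finset.sum_range_succ', Finset.mul_sum]
  -- The recursion is the coefficient of degree n of the equation, solved for the only term
  -- containing the coefficient n + 1 of the power.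
  have key : τ 0 * (powCoeff a w τ (n + 1) * (n + 1)) = ∑ k ∈ Finset.range (n + 1),
      (a * (k + 1) - ((n - k : ℕ) : ℂ)) * τ (k + 1) * powCoeff a w τ (n - k) := by
    rw [powCoeff_succ]
    have : (n : ℂ) + 1 ≠ 0 := by exact_mod_cast n.succ_ne_zero
    field_simp
  simp only [coeff_derivative, coeff_mk, Nat.sub_zero, key]
  rw [Finset.sum_range_succ _ n, Finset.sum_range_succ _ n, ← add_assoc, ← Finset.sum_add_distrib]
  congr 1
  · refine Finset.sum_congr rfl fun k hk => ?_
    rw [Finset.mem_range] at hk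
    have h1 : n - (k + 1) + 1 = n - k := by omega
    have h2 : ((n - (k + 1) : ℕ) : ℂ) + 1 = ((n - k : ℕ) : ℂ) := by
      rw [← h1]; push_cast; ring
    rw [h1, h2]; ring
  · simp; ring

-- In degree n the left side contributes (n + 1) τ₀ E_{n+1} plus multiples of earlier coefficients
-- of E, and the right side only earlier coefficients. Thus E is determined by its constant term.
open PowerSeries in
lemma eq_zero_of_ode {τ E : PowerSeries ℂ} (c : ℂ) (hτ : constantCoeff τ ≠ 0)
    (hE : constantCoeff E = 0) (h : τ * derivative ℂ E = C c * (derivative ℂ τ * E)) :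
    E = 0 := by
  ext n
  induction n using Nat.strong_induction_on with
  | _ n ih =>
    cases n with
    | zero => simpa using hE
    | succ n =>
      have h1 := congrArg (coeff n) h
      rw [coeff_C_mul, coeff_mul, coeff_mul] at h1
      have h2 : ∑ p ∈ Finset.HasAntidiagonal.antidiagonal n, coeff p.1 (derivative ℂ τ) * coeff p.2 E = 0 := by
        refine Finset.sum_eq_zero fun p hp => ?_
        rw [Finset.HasAntidiagonal.mem_antidiagonal] at hp
        rw [ih p.2 (by omega)]; simp
      rw [h2, mul_zero, Finset.sum_eq_single (0, n)] at h1
      · rw [coeff_derivative] at h1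
        have : (n : ℂ) + 1 ≠ 0 := by exact_mod_cast n.succ_ne_zero
        simpa [this, hτ] using h1
      · rintro ⟨p, q⟩ hp hne
        rw [Finset.HasAntidiagonal.mem_antidiagonal] at hp
        have : q ≠ n := by rintro rfl; apply hne; simp at hp; simp [hp]
        simp only at hp
        rw [coeff_derivative, ih (q + 1) (by omega)]; simp
      · simp

lemma differentiableAt_powCoeff {E : Type*} [NormedAddCommGroup E] [NormedSpace ℂ E]
    (a : ℂ) {w : E → ℂ} {τ : ℕ → E → ℂ} {x : E} (hw : DifferentiableAt ℂ w x)
    (hτ : ∀ i, DifferentiableAt ℂ (τ i) x) (h0 : τ 0 x ≠ 0) (n : ℕ) :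
    DifferentiableAt ℂ (fun y => powCoeff a (w y) (fun i => τ i y) n) x := by
  induction n using Nat.strong_induction_on with
  | _ n ih =>
    cases n with
    | zero => simpa only [powCoeff_zero] using hw
    | succ n =>
      simp only [powCoeff_succ]
      have hne : ((n : ℂ) + 1) * τ 0 x ≠ 0 :=
        mul_ne_zero (by exact_mod_cast n.succ_ne_zero) h0
      have hd : DifferentiableAt ℂ (fun y => ((n : ℂ) + 1) * τ 0 y) x := (hτ 0).const_mul _
      simp only [div_eq_mul_inv]
      refine (DifferentiableAt.fun_sum fun k hk => ?_).mul (hd.inv hne)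
      exact ((hτ _).const_mul _).mul (ih _ (by omega))

open PowerSeries in
lemma hasDerivAt_coeff_mul {f g : ℕ → ℂ → ℂ} {f' g' : ℕ → ℂ} {s : ℂ}
    (hf : ∀ n, HasDerivAt (f n) (f' n) s) (hg : ∀ n, HasDerivAt (g n) (g' n) s) (n : ℕ) :
    HasDerivAt (fun y => coeff n (PowerSeries.mk (fun i => f i y) * PowerSeries.mk (fun i => g i y)))
      (coeff n (PowerSeries.mk f' * PowerSeries.mk (fun i => g i s) + PowerSeries.mk (fun i => f i s) * PowerSeries.mk g')) s := by
  simp only [map_add, coeff_mul, coeff_mk, ← Finset.sum_add_distrib]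
  exact HasDerivAt.fun_sum fun p _ => (hf p.1).mul (hg p.2)

open PowerSeries in
lemma derivative_mk (f : ℕ → ℂ) :
    derivative ℂ (PowerSeries.mk f) = PowerSeries.mk (fun n => f (n + 1) * (n + 1)) := by
  ext n; simp [coeff_derivative]

open PowerSeries in
/-- The derivative with respect to a parameter of a power of a power series. -/
lemma powCoeff_variation {a : ℂ} {τ : ℕ → ℂ → ℂ} {w : ℂ → ℂ} {τ' W' : ℕ → ℂ} {s : ℂ}
    (hτ : ∀ n, HasDerivAt (τ n) (τ' n) s)
    (hW : ∀ n, HasDerivAt (fun y => powCoeff a (w y) (fun i => τ i y) n) (W' n) s)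
    (h0 : τ 0 s ≠ 0) (hinit : τ 0 s * W' 0 = a * τ' 0 * w s) :
    PowerSeries.mk (fun i => τ i s) * PowerSeries.mk W' =
      C a * (PowerSeries.mk τ' * PowerSeries.mk (powCoeff a (w s) (fun i => τ i s))) := by
  set t := PowerSeries.mk (fun i => τ i s) with ht
  set W := PowerSeries.mk (powCoeff a (w s) (fun i => τ i s)) with hWdef
  have hode : t * derivative ℂ W = C a * (derivative ℂ t * W) := powCoeff_ode a (w s) h0
  -- The equation in ζ holds for all nearby parameters; this is its derivative in the parameter.
  have hlin : PowerSeries.mk τ' * derivative ℂ W + t * derivative ℂ (PowerSeries.mk W') =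
      C a * (derivative ℂ (PowerSeries.mk τ') * W + derivative ℂ t * PowerSeries.mk W') := by
    ext n
    have e1 := hasDerivAt_coeff_mul hτ (fun n => (hW (n + 1)).mul_const ((n : ℂ) + 1)) n
    have e2 := (hasDerivAt_coeff_mul (fun n => (hτ (n + 1)).mul_const ((n : ℂ) + 1)) hW
      n).const_mul a
    have ev : (fun y => coeff n (PowerSeries.mk (fun i => τ i y) *
        PowerSeries.mk (fun i => powCoeff a (w y) (fun i => τ i y) (i + 1) * ((i : ℂ) + 1)))) =ᶠ[𝓝 s]
        fun y => a * coeff n (PowerSeries.mk (fun i => τ (i + 1) y * ((i : ℂ) + 1)) *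
          PowerSeries.mk (fun i => powCoeff a (w y) (fun i => τ i y) i)) := by
      filter_upwards [(hτ 0).continuousAt.eventually_ne h0] with y hy
      have := congrArg (coeff n) (powCoeff_ode a (w y) (τ := fun i => τ i y) hy)
      rwa [coeff_C_mul, derivative_mk, derivative_mk] at this
    have := e1.unique (e2.congr_of_eventuallyEq ev)
    rw [coeff_C_mul, ht, hWdef, derivative_mk, derivative_mk, derivative_mk, derivative_mk]
    exact this
  -- The defect E satisfies t E' = (1 + a) t' E, and `hinit` says that its constant term vanishes.
  have hE : t * PowerSeries.mk W' - C a * (PowerSeries.mk τ' * W) = 0 := by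
    refine eq_zero_of_ode (τ := t) (1 + a) (by simpa [ht] using h0) ?_ ?_
    · simp only [ht, hWdef, map_sub, map_mul, constantCoeff_mk, constantCoeff_C, powCoeff_zero,
        hinit]
      ring
    · simp only [map_sub, Derivation.leibniz, smul_eq_mul, map_add, map_one,
        derivative_C]
      linear_combination t * hlin - (1 + C a) * PowerSeries.mk τ' * hode
  exact sub_eq_zero.1 hE

/-! ### The linear system and its fundamental matrix. -/

/-- Entries of the matrix that expresses the coefficients of
`ζ^(-N) * ∑ j, v j / (N - j) * ζ^j * τ^((N - j) / e)`, up to the factors `N - i`, in terms of the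
constants `v j`. Here `ρ ^ (N - j)` is the constant term of `τ^((N - j) / e)`. -/
def powEntry (N e : ℕ) (ρ : ℂ) (τ : ℕ → ℂ) (i j : ℕ) : ℂ :=
  if j ≤ i then ((N : ℂ) - i) / ((N : ℂ) - j) *
    powCoeff (((N : ℂ) - j) / e) (ρ ^ (N - j)) τ (i - j) else 0

/-- The power series `τ - ζ τ' / e`. -/
def theta (e : ℕ) (τ : ℕ → ℂ) : PowerSeries ℂ := PowerSeries.mk fun i => (1 - (i : ℂ) / e) * τ i

open PowerSeries in
lemma theta_eq (e : ℕ) (τ : ℕ → ℂ) : theta e τ =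
    PowerSeries.mk τ - C ((e : ℂ)⁻¹) * (X * derivative ℂ (PowerSeries.mk τ)) := by
  ext n
  cases n with
  | zero => simp [theta]
  | succ n => simp [theta, coeff_succ_X_mul, coeff_derivative]; ring

open PowerSeries in
/-- The linear system for the variation `dq` of `q`, modulo `ζ^K`. -/
def VarSystem (K N e : ℕ) (τ dτ q dq : ℕ → ℂ) : Prop :=
  X ^ K ∣ theta e τ * PowerSeries.mk (fun i => dq i / ((N : ℂ) - i)) -
    C ((e : ℂ)⁻¹) * PowerSeries.mk dτ * PowerSeries.mk q

lemma sub_natCast_ne_zero {N i : ℕ} (h : i < N) : (N : ℂ) - i ≠ 0 := by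
  rw [sub_ne_zero]; exact_mod_cast h.ne'

open PowerSeries in
lemma VarSystem.mono {K K' N e : ℕ} {τ dτ q dq : ℕ → ℂ} (h : VarSystem K N e τ dτ q dq)
    (hK : K' ≤ K) : VarSystem K' N e τ dτ q dq :=
  (pow_dvd_pow X hK).trans h

open PowerSeries in
lemma VarSystem.congr {K N e : ℕ} {τ dτ q dq q₂ dq₂ : ℕ → ℂ} (h : VarSystem K N e τ dτ q dq)
    (hq : ∀ i < K, q i = q₂ i) (hdq : ∀ i < K, dq i = dq₂ i) :
    VarSystem K N e τ dτ q₂ dq₂ := by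
  have h1 : (X : PowerSeries ℂ) ^ K ∣ PowerSeries.mk q₂ - PowerSeries.mk q :=
    X_pow_dvd_iff.2 fun i hi => by simp [hq i hi]
  have h2 : (X : PowerSeries ℂ) ^ K ∣ PowerSeries.mk (fun i => dq₂ i / ((N : ℂ) - i)) -
      PowerSeries.mk (fun i => dq i / ((N : ℂ) - i)) :=
    X_pow_dvd_iff.2 fun i hi => by simp [hdq i hi]
  have h3 := ((dvd_add h (h2.mul_left (theta e τ))).sub
    (h1.mul_left (C ((e : ℂ)⁻¹) * PowerSeries.mk dτ)))
  unfold VarSystem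
  convert h3 using 1
  ring

open PowerSeries in
lemma X_pow_dvd_of_mul {K : ℕ} {A B : PowerSeries ℂ} (hA : constantCoeff A ≠ 0)
    (h : X ^ K ∣ A * B) : X ^ K ∣ B := by
  have : IsUnit A := isUnit_iff_constantCoeff.2 hA.isUnit
  exact this.dvd_mul_left.1 h

-- The constant term of `theta e τ` is τ₀, so this series is a unit and determines dq_i / (N - i)
-- modulo ζ^K. The bound K ≤ N keeps N - i nonzero.
open PowerSeries in
lemma VarSystem.unique {K N e : ℕ} {τ dτ q dq dq₂ : ℕ → ℂ} (h0 : τ 0 ≠ 0) (hK : K ≤ N)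
    (h : VarSystem K N e τ dτ q dq) (h₂ : VarSystem K N e τ dτ q dq₂) {i : ℕ} (hi : i < K) :
    dq i = dq₂ i := by
  have h3 := dvd_sub h h₂
  rw [sub_sub_sub_cancel_right, ← mul_sub] at h3
  have h4 := X_pow_dvd_iff.1 (X_pow_dvd_of_mul (by simpa [theta] using h0) h3) i hi
  have := sub_natCast_ne_zero (hi.trans_le hK)
  simpa [sub_eq_zero, div_left_inj' this] using h4

-- This is the chain rule for one fractional power. After multiplication by t, both t·W' and t·dW
-- become multiples of W with the same exponent (N - j)/e. The operator N - ζ∂ applied to ζ^j W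
-- yields the matching q.
open PowerSeries in
lemma column_system {N e j : ℕ} (he : e ≠ 0) {t dt W dW : PowerSeries ℂ} (ht : t ≠ 0)
    (hW : t * derivative ℂ W = C (((N : ℂ) - j) / e) * (derivative ℂ t * W))
    (hdW : t * dW = C (((N : ℂ) - j) / e) * (dt * W)) :
    (t - C ((e : ℂ)⁻¹) * (X * derivative ℂ t)) * (X ^ j * dW) =
      C ((e : ℂ)⁻¹) * dt *
        (C (N : ℂ) * (X ^ j * W) - X * derivative ℂ (X ^ j * W)) := by
  have hX : (X : PowerSeries ℂ) * derivative ℂ (X ^ j) = C (j : ℂ) * X ^ j := by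
    cases j with
    | zero => simp
    | succ j =>
      simp only [derivative_pow, derivative_X]
      simp [pow_succ]; ring
  have hc : C (((N : ℂ) - j) / e) = C ((e : ℂ)⁻¹) * (C (N : ℂ) - C (j : ℂ)) := by
    rw [← map_sub, ← map_mul]; congr 1; ring
  have hee : C ((e : ℂ)⁻¹) * C (e : ℂ) = (1 : PowerSeries ℂ) := by
    rw [← map_mul, inv_mul_cancel₀ (by exact_mod_cast he), map_one]
  refine mul_left_cancel₀ ht ?_
  simp only [Derivation.leibniz, smul_eq_mul]
  rw [hc] at hW hdW
  linear_combination (t - C ((e : ℂ)⁻¹) * (X * derivative ℂ t)) * X ^ j * hdW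
    + C ((e : ℂ)⁻¹) * dt * (X * X ^ j * hW) + C ((e : ℂ)⁻¹) * dt * t * W * hX

-- By linearity this is a sum of instances of `column_system`. Truncation at K < N is allowed
-- because the induction in `varSystem_iff_exists_const` adds one column at a time.
open PowerSeries in
lemma varSystem_of_entries {K N e : ℕ} (he : e ≠ 0) (hK : K ≤ N) {τ : ℕ → ℂ → ℂ} {ρ : ℂ → ℂ}
    {τ' : ℕ → ℂ} {ρ' : ℂ} {F' : ℕ → ℕ → ℂ} {s : ℂ}
    (hτ : ∀ n, HasDerivAt (τ n) (τ' n) s) (hρ : HasDerivAt ρ ρ' s)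
    (hF : ∀ i < K, ∀ j < K,
      HasDerivAt (fun y => powEntry N e (ρ y) (fun n => τ n y) i j) (F' i j) s)
    (h0 : ρ s ≠ 0) (hτ0 : ∀ᶠ y in 𝓝 s, τ 0 y = ρ y ^ e) (c : ℕ → ℂ) :
    VarSystem K N e (fun n => τ n s) τ'
      (fun i => ∑ j ∈ Finset.range K, powEntry N e (ρ s) (fun n => τ n s) i j * c j)
      (fun i => ∑ j ∈ Finset.range K, F' i j * c j) := by
  have hs0 : τ 0 s ≠ 0 := by rw [hτ0.self_of_nhds]; exact pow_ne_zero _ h0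
  have hd : ∀ j n : ℕ, DifferentiableAt ℂ
      (fun y => powCoeff (((N : ℂ) - j) / e) (ρ y ^ (N - j)) (fun i => τ i y) n) s := fun j n =>
    differentiableAt_powCoeff _ (hρ.differentiableAt.fun_pow _) (fun i => (hτ i).differentiableAt)
      hs0 n
  set W : ℕ → PowerSeries ℂ := fun j =>
    PowerSeries.mk (powCoeff (((N : ℂ) - j) / e) (ρ s ^ (N - j)) (fun i => τ i s)) with hW
  set W' : ℕ → ℕ → ℂ := fun j n =>
    deriv (fun y => powCoeff (((N : ℂ) - j) / e) (ρ y ^ (N - j)) (fun i => τ i y) n) s with hW'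
  have hode : ∀ j, PowerSeries.mk (fun i => τ i s) * derivative ℂ (W j) =
      C (((N : ℂ) - j) / e) * (derivative ℂ (PowerSeries.mk (fun i => τ i s)) * W j) :=
    fun j => powCoeff_ode _ _ hs0
  have hvar : ∀ j < K, PowerSeries.mk (fun i => τ i s) * PowerSeries.mk (W' j) =
      C (((N : ℂ) - j) / e) * (PowerSeries.mk τ' * W j) := by
    intro j hj
    refine powCoeff_variation (a := ((N : ℂ) - j) / e) (τ := τ) (w := fun y => ρ y ^ (N - j))
      (W' := W' j) hτ (fun n => (hd j n).hasDerivAt) hs0 ?_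
    -- The constant terms of the power and of τ are ρ^(N-j) and ρ^e, so their logarithmic
    -- derivatives have ratio (N - j)/e, as the initial condition requires.
    have e1 : W' j 0 = ((N - j : ℕ) : ℂ) * ρ s ^ (N - j - 1) * ρ' := by
      simp only [hW', powCoeff_zero]; exact (hρ.fun_pow _).deriv
    have e2 : τ' 0 = (e : ℂ) * ρ s ^ (e - 1) * ρ' :=
      (hτ 0).unique ((hρ.fun_pow e).congr_of_eventuallyEq hτ0)
    rw [e1, e2, hτ0.self_of_nhds, Nat.cast_sub (by omega)]
    obtain ⟨d, hdd⟩ : ∃ d, N - j = d + 1 := ⟨N - j - 1, by omega⟩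
    obtain ⟨f, rfl⟩ := Nat.exists_eq_succ_of_ne_zero he
    rw [hdd]
    have : ((f.succ : ℕ) : ℂ) ≠ 0 := by exact_mod_cast he
    simp only [Nat.succ_eq_add_one, Nat.add_sub_cancel] at this ⊢
    field_simp
    ring
  set t := PowerSeries.mk (fun i => τ i s) with ht
  have htne : t ≠ 0 := by
    intro h; apply hs0; simpa [ht] using congrArg (constantCoeff (R := ℂ)) h
  have hsum : theta e (fun n => τ n s) *
      (∑ j ∈ Finset.range K, C (c j / ((N : ℂ) - j)) * (X ^ j * PowerSeries.mk (W' j))) =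
      C ((e : ℂ)⁻¹) * PowerSeries.mk τ' * (∑ j ∈ Finset.range K, C (c j / ((N : ℂ) - j)) *
        (C (N : ℂ) * (X ^ j * W j) - X * derivative ℂ (X ^ j * W j))) := by
    rw [Finset.mul_sum, Finset.mul_sum, theta_eq]
    refine Finset.sum_congr rfl fun j hj => ?_
    have := column_system he htne (hode j) (hvar j (Finset.mem_range.1 hj))
    linear_combination C (c j / ((N : ℂ) - j)) * this
  have hq : (X : PowerSeries ℂ) ^ K ∣ PowerSeries.mk
        (fun i => ∑ j ∈ Finset.range K, powEntry N e (ρ s) (fun n => τ n s) i j * c j) -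
      ∑ j ∈ Finset.range K, C (c j / ((N : ℂ) - j)) *
        (C (N : ℂ) * (X ^ j * W j) - X * derivative ℂ (X ^ j * W j)) := by
    refine X_pow_dvd_iff.2 fun i hi => ?_
    rw [map_sub, map_sum, coeff_mk, sub_eq_zero]
    refine Finset.sum_congr rfl fun j hj => ?_
    -- ζ∂ multiplies the coefficient i by i; this is the source of the factor N - i in `powEntry`.
    have hXd : coeff i (X * derivative ℂ (X ^ j * W j)) =
        (i : ℂ) * coeff i (X ^ j * W j) := by
      cases i with
      | zero => simp
      | succ i => rw [coeff_succ_X_mul, coeff_derivative]; push_cast; ring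
    rw [coeff_C_mul, map_sub, hXd, coeff_C_mul, coeff_X_pow_mul', powEntry]
    split_ifs
    · rw [hW, coeff_mk]; ring
    · simp
  have hdq : (X : PowerSeries ℂ) ^ K ∣ PowerSeries.mk
        (fun i => (∑ j ∈ Finset.range K, F' i j * c j) / ((N : ℂ) - i)) -
      ∑ j ∈ Finset.range K, C (c j / ((N : ℂ) - j)) * (X ^ j * PowerSeries.mk (W' j)) := by
    refine X_pow_dvd_iff.2 fun i hi => ?_
    rw [map_sub, map_sum, coeff_mk, sub_eq_zero, Finset.sum_div]
    refine Finset.sum_congr rfl fun j hj => ?_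
    have hF' : F' i j = if j ≤ i then ((N : ℂ) - i) / ((N : ℂ) - j) * W' j (i - j) else 0 := by
      refine (hF i hi j (Finset.mem_range.1 hj)).unique ?_
      by_cases hji : j ≤ i
      · simp only [powEntry, if_pos hji]
        exact (hd j (i - j)).hasDerivAt.const_mul _
      · simp only [powEntry, if_neg hji]
        exact hasDerivAt_const _ _
    rw [coeff_C_mul, coeff_X_pow_mul', hF', coeff_mk]
    have := sub_natCast_ne_zero (hi.trans_le hK)
    split_ifs
    · field_simp
    · simp
  have h3 := (hdq.mul_left (theta e (fun n => τ n s))).sub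
    (hq.mul_left (C ((e : ℂ)⁻¹) * PowerSeries.mk τ'))
  unfold VarSystem
  convert h3 using 1
  rw [mul_sub, mul_sub, hsum]; ring

lemma differentiableAt_powEntry {E : Type*} [NormedAddCommGroup E] [NormedSpace ℂ E]
    (N e i j : ℕ) {ρ : E → ℂ} {τ : ℕ → E → ℂ} {x : E} (hρ : DifferentiableAt ℂ ρ x)
    (hτ : ∀ n, DifferentiableAt ℂ (τ n) x) (h0 : τ 0 x ≠ 0) :
    DifferentiableAt ℂ (fun y => powEntry N e (ρ y) (fun n => τ n y) i j) x := by
  by_cases hji : j ≤ i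
  · simp only [powEntry, if_pos hji]
    exact (differentiableAt_powCoeff _ (hρ.fun_pow _) hτ h0 _).const_mul _
  · simp only [powEntry, if_neg hji]
    exact differentiableAt_const _

lemma powEntry_self_ne_zero {N e i : ℕ} (hi : i < N) {ρ : ℂ} (hρ : ρ ≠ 0) (τ : ℕ → ℂ) :
    powEntry N e ρ τ i i ≠ 0 := by
  rw [powEntry, if_pos le_rfl, Nat.sub_self, powCoeff_zero, div_self (sub_natCast_ne_zero hi),
    one_mul]
  exact pow_ne_zero _ hρ

lemma hasDerivAt_line {E : Type*} [NormedAddCommGroup E] [NormedSpace ℂ E] {f : E → ℂ} {x : E}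
    (h : DifferentiableAt ℂ f x) (α : E) :
    HasDerivAt (fun s : ℂ => f (x + s • α)) (fderiv ℂ f x α) 0 :=
  h.hasFDerivAt.hasLineDerivAt α

/-- A vector function `q` solves the linear system in all directions if and only if it is a
combination with constant coefficients of the columns of the fundamental matrix `powEntry`. -/
lemma varSystem_iff_exists_const {E : Type*} [NormedAddCommGroup E] [NormedSpace ℂ E] {D : Set E}
    (hD : IsOpen D) (hpre : IsPreconnected D) {N e : ℕ} (he : e ≠ 0)
    {τ q : ℕ → E → ℂ} {ρ : E → ℂ} (hτ : ∀ n, DifferentiableOn ℂ (τ n) D)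
    (hρ : DifferentiableOn ℂ ρ D) (hq : ∀ i < N, DifferentiableOn ℂ (q i) D)
    (hρ0 : ∀ x ∈ D, ρ x ≠ 0) (hτρ : ∀ x ∈ D, τ 0 x = ρ x ^ e) :
    (∀ x ∈ D, ∀ α, VarSystem N N e (fun n => τ n x) (fun n => fderiv ℂ (τ n) x α)
      (fun i => q i x) (fun i => fderiv ℂ (q i) x α)) ↔
    ∃ v : ℕ → ℂ, ∀ x ∈ D, ∀ i < N, q i x =
      ∑ j ∈ Finset.range N, powEntry N e (ρ x) (fun n => τ n x) i j * v j := by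
  have hτ0 : ∀ x ∈ D, τ 0 x ≠ 0 := fun x hx => by
    rw [hτρ x hx]; exact pow_ne_zero _ (hρ0 x hx)
  have dat : ∀ {f : E → ℂ}, DifferentiableOn ℂ f D → ∀ x ∈ D, DifferentiableAt ℂ f x :=
    fun h x hx => h.differentiableAt (hD.mem_nhds hx)
  have dF : ∀ x ∈ D, ∀ i j, DifferentiableAt ℂ
      (fun y => powEntry N e (ρ y) (fun n => τ n y) i j) x := fun x hx i j =>
    differentiableAt_powEntry _ _ _ _ (dat hρ x hx) (fun n => dat (hτ n) x hx) (hτ0 x hx)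
  have key : ∀ K ≤ N, ∀ x ∈ D, ∀ α, ∀ c : ℕ → ℂ,
      VarSystem K N e (fun n => τ n x) (fun n => fderiv ℂ (τ n) x α)
        (fun i => ∑ j ∈ Finset.range K, powEntry N e (ρ x) (fun n => τ n x) i j * c j)
        (fun i => ∑ j ∈ Finset.range K,
          fderiv ℂ (fun y => powEntry N e (ρ y) (fun n => τ n y) i j) x α * c j) := by
    intro K hK x hx α c
    have hev : ∀ᶠ s : ℂ in 𝓝 0, x + s • α ∈ D := by
      have : ContinuousAt (fun s : ℂ => x + s • α) 0 := by fun_prop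
      exact this.eventually_mem (hD.mem_nhds (by simpa using hx))
    have := varSystem_of_entries (K := K) (N := N) (e := e) he hK
      (τ := fun n s => τ n (x + s • α)) (ρ := fun s => ρ (x + s • α)) (s := 0)
      (fun n => hasDerivAt_line (dat (hτ n) x hx) α) (hasDerivAt_line (dat hρ x hx) α)
      (fun i _ j _ => hasDerivAt_line (dF x hx i j) α)
      (by simpa using hρ0 x hx) (hev.mono fun s hs => hτρ _ hs) c
    simpa using this
  constructor
  · intro hsys
    -- The matrix is lower triangular, so the constants can be found row by row.
    suffices H : ∀ K ≤ N, ∃ v : ℕ → ℂ, ∀ x ∈ D, ∀ i < K, q i x =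
        ∑ j ∈ Finset.range K, powEntry N e (ρ x) (fun n => τ n x) i j * v j from H N le_rfl
    intro K
    induction K with
    | zero => exact fun _ => ⟨0, fun _ _ i hi => absurd hi (Nat.not_lt_zero _)⟩
    | succ K ih =>
      intro hK
      obtain ⟨v, hv⟩ := ih (by omega)
      set F : E → ℕ → ℂ := fun x j => powEntry N e (ρ x) (fun n => τ n x) K j with hFdef
      have hFK : ∀ x ∈ D, F x K ≠ 0 := fun x hx => powEntry_self_ne_zero (by omega) (hρ0 x hx) _
      -- Variation of constants: row K is solved for its last coefficient, a function c whose
      -- derivative will be shown to vanish.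
      set c : E → ℂ := fun x => (q K x - ∑ j ∈ Finset.range K, F x j * v j) / F x K with hc
      have hqK : ∀ x ∈ D, q K x = ∑ j ∈ Finset.range K, F x j * v j + F x K * c x := by
        intro x hx
        rw [hc]; simp only; rw [mul_div_cancel₀ _ (hFK x hx)]; ring
      have hcd : DifferentiableOn ℂ c D := by
        intro x hx
        refine DifferentiableAt.differentiableWithinAt ?_
        simp only [hc, div_eq_mul_inv]
        exact ((dat (hq K (by omega)) x hx).sub (DifferentiableAt.fun_sum fun j _ =>
          (dF x hx K j).mul_const _)).mul ((dF x hx K K).inv (hFK x hx))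
      have hc0 : D.EqOn (fderiv ℂ c) 0 := by
        intro x hx
        ext α
        have hev : ∀ᶠ s : ℂ in 𝓝 0, x + s • α ∈ D := by
          have : ContinuousAt (fun s : ℂ => x + s • α) 0 := by fun_prop
          exact this.eventually_mem (hD.mem_nhds (by simpa using hx))
        -- Freezing c at its value at x gives a combination that agrees with q at x up to row K and
        -- solves the system there. By uniqueness its derivative is that of q. The product rule for
        -- q has the one extra term F_KK·dc, which is therefore zero.
        set v' : ℕ → ℂ := Function.update v K (c x) with hv'
        have hv'lt : ∀ j < K, v' j = v j := fun j hj => by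
          rw [hv', Function.update_of_ne (by omega)]
        have hv'K : v' K = c x := by simp [hv']
        have h1 := (hsys x hx α).mono hK
        have h2 := (key (K + 1) hK x hx α v').congr (q₂ := fun i => q i x)
          (dq₂ := fun i => ∑ j ∈ Finset.range (K + 1),
            fderiv ℂ (fun y => powEntry N e (ρ y) (fun n => τ n y) i j) x α * v' j) ?_
          (fun _ _ => rfl)
        · have h3 := VarSystem.unique (hτ0 x hx) hK h1 h2 (Nat.lt_succ_self K)
          have h4 : HasDerivAt (fun s : ℂ => q K (x + s • α))
              (∑ j ∈ Finset.range K, fderiv ℂ (fun y => F y j) x α * v j +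
                (fderiv ℂ (fun y => F y K) x α * c x + F x K * fderiv ℂ c x α)) 0 := by
            refine HasDerivAt.congr_of_eventuallyEq ?_ (hev.mono fun s hs => hqK _ hs)
            refine HasDerivAt.add (HasDerivAt.fun_sum fun j _ =>
              (hasDerivAt_line (dF x hx K j) α).mul_const _) ?_
            have := (hasDerivAt_line (dF x hx K K) α).fun_mul
              (hasDerivAt_line (dat hcd x hx) α)
            simp only [zero_smul, add_zero] at this
            exact this
          have h5 := (hasDerivAt_line (dat (hq K (by omega)) x hx) α).unique h4
          rw [h3, Finset.sum_range_succ, hv'K, Finset.sum_congr rfl fun j hj => by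
            rw [hv'lt j (Finset.mem_range.1 hj)], ← add_assoc, left_eq_add] at h5
          simpa [hFK x hx] using h5
        · intro i hi
          rw [Finset.sum_range_succ, hv'K, Finset.sum_congr rfl fun j hj => by
            rw [hv'lt j (Finset.mem_range.1 hj)]]
          rcases Nat.lt_succ_iff_lt_or_eq.1 hi with hi | rfl
          · rw [hv x hx i hi, powEntry, if_neg (by omega)]; simp
          · exact (hqK x hx).symm
      obtain ⟨a, ha⟩ : ∃ a, ∀ x ∈ D, c x = a := by
        rcases D.eq_empty_or_nonempty with rfl | ⟨x₀, hx₀⟩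
        · exact ⟨0, by simp⟩
        · exact ⟨c x₀, fun x hx =>
            hD.is_const_of_fderiv_eq_zero hpre hcd hc0 hx hx₀⟩
      refine ⟨Function.update v K a, fun x hx i hi => ?_⟩
      rw [Finset.sum_range_succ, Function.update_self, Finset.sum_congr rfl fun j hj => by
        rw [Function.update_of_ne (by have := Finset.mem_range.1 hj; omega)]]
      rcases Nat.lt_succ_iff_lt_or_eq.1 hi with hi | rfl
      · rw [hv x hx i hi, powEntry, if_neg (by omega)]; simp
      · rw [hqK x hx, ha x hx]
  · rintro ⟨v, hv⟩ x hx α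
    refine (key N le_rfl x hx α v).congr (fun i hi => (hv x hx i hi).symm) fun i hi => ?_
    have hev : q i =ᶠ[𝓝 x] fun y =>
        ∑ j ∈ Finset.range N, powEntry N e (ρ y) (fun n => τ n y) i j * v j := by
      filter_upwards [hD.mem_nhds hx] with y hy using hv y hy i hi
    rw [hev.fderiv_eq, fderiv_fun_sum fun j _ => (dF x hx i j).mul_const _]
    simp only [_root_.sum_apply]
    refine Finset.sum_congr rfl fun j _ => ?_
    rw [fderiv_mul_const (dF x hx i j)]
    simp [mul_comm]

/-! ### From growth estimates to congruences of power series. -/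

/-- Factors are split off one at a time: if p = X^r g is O(ζ^(r+1)), then g is O(ζ), so g vanishes
at the origin by continuity. -/
lemma X_pow_dvd_of_isBigO {p : Polynomial ℂ} {r : ℕ}
    (h : (fun ζ => p.eval ζ) =O[𝓝[≠] 0] fun ζ => ζ ^ r) : Polynomial.X ^ r ∣ p := by
  induction r with
  | zero => simp
  | succ r ih =>
    obtain ⟨g, rfl⟩ := ih (h.trans (by
      refine IsBigO.of_bound 1 ?_
      filter_upwards [nhdsWithin_le_nhds (Metric.ball_mem_nhds (0 : ℂ) one_pos)] with ζ hζ
      rw [one_mul, norm_pow, norm_pow]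
      exact pow_le_pow_of_le_one (norm_nonneg _) (mem_ball_zero_iff.1 hζ).le (Nat.le_succ r)))
    rw [pow_succ]
    refine mul_dvd_mul_left _ (Polynomial.X_dvd_iff.2 ?_)
    have h1 : (fun ζ => g.eval ζ) =O[𝓝[≠] 0] fun ζ : ℂ => ζ := by
      have h2 := h.mul (isBigO_refl (fun ζ : ℂ => (ζ ^ r)⁻¹) (𝓝[≠] 0))
      refine (h2.congr' ?_ ?_) <;> filter_upwards [self_mem_nhdsWithin] with ζ hζ
      · simp only [Polynomial.eval_mul, Polynomial.eval_pow, Polynomial.eval_X]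
        field_simp [show ζ ≠ 0 from hζ]
      · have : ζ ≠ 0 := hζ
        field_simp
        ring
    have h3 : Tendsto (fun ζ => g.eval ζ) (𝓝[≠] 0) (𝓝 0) :=
      h1.trans_tendsto (tendsto_id.mono_left nhdsWithin_le_nhds)
    have h4 : Tendsto (fun ζ => g.eval ζ) (𝓝[≠] 0) (𝓝 (g.eval 0)) :=
      (g.continuous.tendsto 0).mono_left nhdsWithin_le_nhds
    rw [Polynomial.coeff_zero_eq_eval_zero]
    exact tendsto_nhds_unique h4 h3

open PowerSeries in
lemma eval_trunc (n : ℕ) (f : ℕ → ℂ) (ζ : ℂ) :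
    (trunc n (PowerSeries.mk f)).eval ζ = ∑ i ∈ Finset.range n, f i * ζ ^ i := by
  rw [← Polynomial.eval₂_id, eval₂_trunc_eq_sum_range]
  simp

open PowerSeries in
lemma X_pow_dvd_sub_trunc {r n : ℕ} (h : r ≤ n) (P : PowerSeries ℂ) :
    X ^ r ∣ P - (trunc n P : PowerSeries ℂ) := by
  refine X_pow_dvd_iff.2 fun m hm => ?_
  rw [map_sub, Polynomial.coeff_coe, coeff_trunc, if_pos (hm.trans_le h), sub_self]

/-- `H` is the Taylor series of `h` at the origin. -/
def IsTaylor (h : ℂ → ℂ) (H : PowerSeries ℂ) : Prop :=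
  ∀ r, (fun ζ => h ζ - (PowerSeries.trunc r H).eval ζ) =O[𝓝 0] fun ζ => ζ ^ r

lemma exists_isTaylor {h : ℂ → ℂ} {x : ℂ} (hh : AnalyticAt ℂ h x) :
    ∃ H : PowerSeries ℂ, IsTaylor (fun ζ => h (x + ζ)) H ∧
      PowerSeries.constantCoeff H = h x := by
  obtain ⟨p, hp⟩ := hh
  refine ⟨PowerSeries.mk p.coeff, fun r => ?_, ?_⟩
  · have := hp.isBigO_sub_partialSum_pow r
    refine (this.congr_left fun ζ => ?_).trans (IsBigO.of_bound 1 (by simp))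
    rw [eval_trunc, FormalMultilinearSeries.partialSum]
    congr 1
    refine Finset.sum_congr rfl fun i _ => ?_
    rw [FormalMultilinearSeries.apply_eq_pow_smul_coeff, smul_eq_mul, mul_comm]
  · have := hp.coeff_zero (fun _ => 0)
    simp only [PowerSeries.constantCoeff_mk]
    rw [← this, FormalMultilinearSeries.coeff]
    congr 1
    ext i; exact i.elim0

lemma isBigO_one_of_continuousAt {f : ℂ → ℂ} {x : ℂ} (h : ContinuousAt f x) :
    f =O[𝓝 x] fun _ => (1 : ℂ) :=
  h.isBigO_one ℂ

open PowerSeries in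
/-- Comparison of the lowest coefficients in a relation `P = T * h` up to `O(ζ^r)`. -/
lemma X_pow_dvd_of_isTaylor {r n n' : ℕ} (hn : r ≤ n) (hn' : r ≤ n') {P T H : PowerSeries ℂ}
    {h : ℂ → ℂ} (hH : IsTaylor h H)
    (hO : (fun ζ => (trunc n P).eval ζ - (trunc n' T).eval ζ * h ζ) =O[𝓝[≠] 0]
      fun ζ => ζ ^ r) : X ^ r ∣ P - T * H := by
  have h1 : (fun ζ => (trunc n' T).eval ζ * (h ζ - (trunc r H).eval ζ)) =O[𝓝[≠] 0]
      fun ζ => ζ ^ r := by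
    have := (isBigO_one_of_continuousAt (trunc n' T).continuous.continuousAt).mul (hH r)
    simpa using this.mono nhdsWithin_le_nhds
  have h2 : Polynomial.X ^ r ∣ trunc n P - trunc n' T * trunc r H := by
    refine X_pow_dvd_of_isBigO ((hO.add h1).congr_left fun ζ => ?_)
    simp only [Polynomial.eval_sub, Polynomial.eval_mul]; ring
  have h3 : (X : PowerSeries ℂ) ^ r ∣ (trunc n P : PowerSeries ℂ) - trunc n' T * trunc r H := by
    have := map_dvd (Polynomial.coeToPowerSeries.ringHom (R := ℂ)) h2
    simpa using this
  have h4 := (((h3.add (X_pow_dvd_sub_trunc hn P)).sub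
    ((X_pow_dvd_sub_trunc hn' T).mul_right (trunc r H : PowerSeries ℂ))).sub
    ((X_pow_dvd_sub_trunc le_rfl H).mul_left T))
  convert h4 using 1
  ring

lemma isTaylor_zero : IsTaylor (fun _ => 0) 0 := fun r => by simpa using isBigO_zero _ _

lemma tendsto_add_punctured (x : ℂ) : Tendsto (fun ζ => x + ζ) (𝓝[≠] 0) (𝓝[≠] x) := by
  refine tendsto_nhdsWithin_iff.2 ⟨?_, ?_⟩
  · have : Continuous fun ζ : ℂ => x + ζ := by fun_prop
    simpa using (this.tendsto 0).mono_left nhdsWithin_le_nhds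
  · filter_upwards [self_mem_nhdsWithin] with ζ hζ
    simpa using hζ

lemma pow_mul_polar (r : ℕ) (c : ℕ → ℂ) {ζ : ℂ} (hζ : ζ ≠ 0) :
    ζ ^ r * ∑ k ∈ Finset.range r, c k * (ζ ^ (k + 1))⁻¹ =
      ∑ i ∈ Finset.range r, c (r - 1 - i) * ζ ^ i := by
  rw [← Finset.sum_range_reflect (fun i => c (r - 1 - i) * ζ ^ i), Finset.mul_sum]
  refine Finset.sum_congr rfl fun k hk => ?_
  rw [Finset.mem_range] at hk
  rw [show r - 1 - (r - 1 - k) = k by omega, show r = r - 1 - k + (k + 1) by omega, pow_add]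
  rw [show r - 1 - k + (k + 1) - 1 - k = r - 1 - k by omega]
  field_simp

open PowerSeries in
/-- Singular parts at a finite pole. -/
lemma polar_of_isBigO {r : ℕ} {c y : ℕ → ℂ} {h : ℂ → ℂ} {x : ℂ} {H : PowerSeries ℂ}
    (hH : IsTaylor (fun ζ => h (x + ζ)) H)
    (hO : (fun z => ∑ k ∈ Finset.range r, c k * ((z - x) ^ (k + 1))⁻¹ -
      (∑ k ∈ Finset.range r, y k * ((z - x) ^ (k + 1))⁻¹) * h z) =O[𝓝[≠] x] fun _ => (1 : ℂ)) :
    X ^ r ∣ PowerSeries.mk (fun i => c (r - 1 - i)) -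
      PowerSeries.mk (fun i => y (r - 1 - i)) * H := by
  refine X_pow_dvd_of_isTaylor (n := r) (n' := r) le_rfl le_rfl hH ?_
  have h1 := (isBigO_refl (fun ζ : ℂ => ζ ^ r) (𝓝[≠] 0)).mul
    (hO.comp_tendsto (tendsto_add_punctured x))
  refine h1.congr' ?_ (by simp)
  filter_upwards [self_mem_nhdsWithin] with ζ hζ
  simp only [Function.comp, add_sub_cancel_left]
  rw [mul_sub, ← mul_assoc, pow_mul_polar r c hζ, pow_mul_polar r y hζ, eval_trunc, eval_trunc]

lemma isBigO_inv_of_cobounded {f g : ℂ → ℂ} (h : f =O[cobounded ℂ] g) :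
    (fun w => f w⁻¹) =O[𝓝[≠] 0] fun w => g w⁻¹ :=
  h.comp_tendsto tendsto_inv₀_nhdsNE_zero

/-! ### Partial fractions. -/

/-- The rational function with poles of order at most `r s` at `X s` and polynomial part of degree
less than `N`. -/
def ratFun {n : ℕ} (N : ℕ) (r : Fin n → ℕ) (X : Fin n → ℂ) (d : ℕ → ℂ) (c : Fin n → ℕ → ℂ)
    (z : ℂ) : ℂ :=
  ∑ k ∈ Finset.range N, d k * z ^ k +
    ∑ s, ∑ k ∈ Finset.range (r s), c s k * ((z - X s) ^ (k + 1))⁻¹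

section
variable {n : ℕ} {N : ℕ} {r : Fin n → ℕ} {X : Fin n → ℂ} {d : ℕ → ℂ} {c : Fin n → ℕ → ℂ}

lemma ratFun_sub_polar (hX : Function.Injective X) (s : Fin n) :
    (fun z => ratFun N r X d c z -
      ∑ k ∈ Finset.range (r s), c s k * ((z - X s) ^ (k + 1))⁻¹) =O[𝓝[≠] (X s)]
      fun _ => (1 : ℂ) := by
  have hc : ContinuousAt (fun z => ∑ k ∈ Finset.range N, d k * z ^ k +
      ∑ s' ∈ Finset.univ.erase s, ∑ k ∈ Finset.range (r s'),
        c s' k * ((z - X s') ^ (k + 1))⁻¹) (X s) := by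
    refine ContinuousAt.add (by fun_prop) (tendsto_finsetSum _ fun s' hs' =>
      tendsto_finsetSum _ fun k _ => ?_)
    refine ContinuousAt.mul continuousAt_const (ContinuousAt.inv₀ (by fun_prop) ?_)
    exact pow_ne_zero _ (sub_ne_zero.2 (hX.ne (Finset.ne_of_mem_erase hs').symm))
  refine ((isBigO_one_of_continuousAt hc).mono nhdsWithin_le_nhds).congr_left fun z => ?_
  rw [ratFun, ← Finset.add_sum_erase _ _ (Finset.mem_univ s)]
  ring

lemma isBigO_polar_cobounded (x a : ℂ) (k : ℕ) :
    (fun z => a * ((z - x) ^ (k + 1))⁻¹) =O[cobounded ℂ] fun z => z⁻¹ := by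
  refine IsBigO.const_mul_left ?_ a
  have h1 : (fun z : ℂ => (z - x)⁻¹) =O[cobounded ℂ] fun z => z⁻¹ := by
    refine IsBigO.inv_rev ?_ ?_
    · have : (fun _ : ℂ => x) =o[cobounded ℂ] fun z => z :=
        isLittleO_const_left.2 (Or.inr tendsto_norm_cobounded_atTop)
      exact (this.right_isBigO_sub).trans (isBigO_refl _ _)
    · filter_upwards [eventually_ne_cobounded x, eventually_ne_cobounded (0 : ℂ)] with z _ h h'
      exact absurd h' h
  have h2 : Tendsto (fun z : ℂ => (z - x)⁻¹) (cobounded ℂ) (𝓝 0) :=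
    h1.trans_tendsto tendsto_inv₀_cobounded
  have h3 : (fun z : ℂ => ((z - x)⁻¹) ^ k) =O[cobounded ℂ] fun _ => (1 : ℂ) :=
    (h2.pow k).isBigO_one ℂ
  refine (h3.mul h1).congr (fun z => ?_) fun z => one_mul _
  rw [← pow_succ, inv_pow]

lemma ratFun_sub_poly :
    (fun z => ratFun N r X d c z - ∑ k ∈ Finset.range N, d k * z ^ k) =O[cobounded ℂ]
      fun z => z⁻¹ := by
  have : (fun z => ∑ s, ∑ k ∈ Finset.range (r s), c s k * ((z - X s) ^ (k + 1))⁻¹)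
      =O[cobounded ℂ] fun z => z⁻¹ :=
    IsBigO.fun_sum fun s _ => IsBigO.fun_sum fun k _ => isBigO_polar_cobounded _ _ _
  exact this.congr_left fun z => by rw [ratFun, add_sub_cancel_left]

lemma pow_mul_poly (N : ℕ) (d : ℕ → ℂ) {w : ℂ} (hw : w ≠ 0) :
    w ^ N * ∑ k ∈ Finset.range N, d k * w⁻¹ ^ k =
      w * ∑ i ∈ Finset.range N, d (N - 1 - i) * w ^ i := by
  rw [← Finset.sum_range_reflect (fun i => d (N - 1 - i) * w ^ i), Finset.mul_sum, Finset.mul_sum]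
  refine Finset.sum_congr rfl fun k hk => ?_
  rw [Finset.mem_range] at hk
  rw [show N - 1 - (N - 1 - k) = k by omega]
  have : w ^ N = w ^ (N - 1 - k) * w * w ^ k := by
    rw [← pow_succ, ← pow_add]; congr 1; omega
  rw [this, inv_pow]
  field_simp

open PowerSeries in
/-- Uniqueness of the partial fraction decomposition. -/
lemma ratFun_eq_zero (hX : Function.Injective X)
    (h : ∀ z, (∀ s, z ≠ X s) → ratFun N r X d c z = 0) :
    (∀ k < N, d k = 0) ∧ ∀ s, ∀ k < r s, c s k = 0 := by
  have hc : ∀ s, ∀ k < r s, c s k = 0 := by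
    intro s k hk
    have ev : ∀ᶠ z in 𝓝[≠] (X s), ratFun N r X d c z = 0 := by
      have : ∀ᶠ z in 𝓝[≠] (X s), ∀ s', z ≠ X s' := by
        rw [eventually_all]
        intro s'
        by_cases hs : s' = s
        · subst hs; exact self_mem_nhdsWithin
        · exact nhdsWithin_le_nhds (continuousAt_id.eventually_ne (hX.ne (Ne.symm hs)))
      exact this.mono h
    have h1 := polar_of_isBigO (r := r s) (c := c s) (y := 0) (h := fun _ => 0) (x := X s)
      isTaylor_zero
      (((ratFun_sub_polar (N := N) (r := r) (d := d) (c := c) hX s).neg_left).congr'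
        (ev.mono fun z hz => by simp [hz]) EventuallyEq.rfl)
    have h2 := X_pow_dvd_iff.1 h1 (r s - 1 - k) (by omega)
    simpa [show r s - 1 - (r s - 1 - k) = k by omega] using h2
  refine ⟨fun k hk => ?_, hc⟩
  have ev : ∀ᶠ z in cobounded ℂ, ratFun N r X d c z = 0 := by
    have : ∀ᶠ z in cobounded ℂ, ∀ s', z ≠ X s' := by
      rw [eventually_all]; exact fun s' => eventually_ne_cobounded _
    exact this.mono h
  have h1 := ratFun_sub_poly (N := N) (r := r) (X := X) (d := d) (c := c)
  have h2 : (fun z => ∑ k ∈ Finset.range N, d k * z ^ k) =O[cobounded ℂ] fun z : ℂ => z⁻¹ :=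
    h1.neg_left.congr' (ev.mono fun z hz => by simp [hz]) EventuallyEq.rfl
  -- In the coordinate w = 1/z, multiplication by w^(N-1) makes the polynomial part a polynomial in
  -- w with reversed coefficients, of size O(w^N). The factor is written w^N·w⁻¹ so that N = 0 needs
  -- no separate treatment.
  have h3 := (isBigO_refl (fun w : ℂ => w ^ N * w⁻¹) (𝓝[≠] 0)).mul (isBigO_inv_of_cobounded h2)
  have h4 : (fun w : ℂ => (trunc N (PowerSeries.mk fun i => d (N - 1 - i))).eval w -
      (trunc N (0 : PowerSeries ℂ)).eval w * (fun _ => (0 : ℂ)) w) =O[𝓝[≠] 0]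
        fun w => w ^ N := by
    refine h3.congr' ?_ ?_ <;> filter_upwards [self_mem_nhdsWithin] with w hw
    · have hw' : w ≠ 0 := hw
      rw [eval_trunc, mul_zero, sub_zero, mul_comm (w ^ N), mul_assoc, pow_mul_poly N d hw,
        inv_mul_cancel_left₀ hw']
    · have hw' : w ≠ 0 := hw
      field_simp
  have h5 := X_pow_dvd_iff.1 (X_pow_dvd_of_isTaylor le_rfl le_rfl isTaylor_zero h4)
    (N - 1 - k) (by omega)
  simpa [show N - 1 - (N - 1 - k) = k by omega] using h5

end

/-! ### Gauges and the singular parts they impose. -/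

lemma isBigO_conj {l : Filter ℂ} {G M : ℂ → Matrix (Fin 2) (Fin 2) ℂ} {g : ℂ → ℂ}
    (hG : ∀ i j, (fun z => G z i j) =O[l] fun _ => (1 : ℂ))
    (hGi : ∀ i j, (fun z => (G z)⁻¹ i j) =O[l] fun _ => (1 : ℂ))
    (hM : ∀ i j, (fun z => M z i j) =O[l] g) (i j : Fin 2) :
    (fun z => ((G z)⁻¹ * M z * G z) i j) =O[l] g := by
  simp only [Matrix.mul_apply]
  refine IsBigO.fun_sum fun b _ => ?_
  have h1 : (fun z => ∑ a, (G z)⁻¹ i a * M z a b) =O[l] g :=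
    IsBigO.fun_sum fun a _ => by simpa using (hGi i a).mul (hM a b)
  simpa using h1.mul (hG b j)

lemma analyticAt_inv_entry {G : ℂ → Matrix (Fin 2) (Fin 2) ℂ} {x : ℂ}
    (hG : ∀ i j, AnalyticAt ℂ (fun z => G z i j) x) (hdet : (G x).det ≠ 0) (i j : Fin 2) :
    AnalyticAt ℂ (fun z => (G z)⁻¹ i j) x := by
  have hd : AnalyticAt ℂ (fun z => ((G z).det)⁻¹) x := by
    refine AnalyticAt.fun_inv ?_ hdet
    simp only [Matrix.det_fin_two]
    exact ((hG 0 0).mul (hG 1 1)).sub ((hG 0 1).mul (hG 1 0))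
  have ha : AnalyticAt ℂ (fun z => (G z).adjugate i j) x := by
    simp only [Matrix.adjugate_fin_two]
    fin_cases i <;> fin_cases j
    · exact hG 1 1
    · exact (hG 0 1).neg
    · exact (hG 1 0).neg
    · exact hG 0 0
  simp only [Matrix.inv_def, Ring.inverse_eq_inv', Matrix.smul_apply, smul_eq_mul]
  exact hd.mul ha

/-- The entry `(1,2)` of `G⁻¹ σ₃ G`. -/
def gaugeEntry (G : ℂ → Matrix (Fin 2) (Fin 2) ℂ) (z : ℂ) : ℂ := ((G z)⁻¹ * sigma3 * G z) 0 1

lemma analyticAt_gaugeEntry {G : ℂ → Matrix (Fin 2) (Fin 2) ℂ} {x : ℂ}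
    (hG : ∀ i j, AnalyticAt ℂ (fun z => G z i j) x) (hdet : (G x).det ≠ 0) :
    AnalyticAt ℂ (gaugeEntry G) x := by
  have hi := analyticAt_inv_entry hG hdet
  have : gaugeEntry G = fun z => (G z)⁻¹ 0 0 * G z 0 1 - (G z)⁻¹ 0 1 * G z 1 1 := by
    ext z
    simp [gaugeEntry, Matrix.mul_apply, Fin.sum_univ_two, sigma3, Matrix.diagonal]
    ring
  rw [this]
  exact ((hi 0 0).mul (hG 0 1)).sub ((hi 0 1).mul (hG 1 1))

lemma isBigO_one_entry {f : ℂ → ℂ} {x : ℂ} (hf : AnalyticAt ℂ f x) :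
    f =O[𝓝[≠] x] fun _ => (1 : ℂ) :=
  (isBigO_one_of_continuousAt hf.continuousAt).mono nhdsWithin_le_nhds

lemma sub_gaugeEntry {G L : Matrix (Fin 2) (Fin 2) ℂ} (y : ℂ) (hG : G.det ≠ 0) :
    G⁻¹ * (G * L * G⁻¹ - y • sigma3) * G = L - y • (G⁻¹ * sigma3 * G) := by
  have h : IsUnit G.det := hG.isUnit
  rw [Matrix.mul_sub, Matrix.sub_mul]
  congr 1
  · rw [Matrix.mul_assoc G L, Matrix.nonsing_inv_mul_cancel_left _ _ h, Matrix.mul_assoc,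
      Matrix.nonsing_inv_mul _ h, Matrix.mul_one]
  · simp

section
variable {S : PoleType} {P : Deformation S}

/-- G and its inverse are bounded near the pole, so conjugating back preserves the order of the
remainder. Only the entry (1,2) of the normal form is kept: the gauge enters the proof through the
single function `gaugeEntry`. -/
lemma IsGauge.isBigO {x : P.Space} {C : Coeffs S.n} {s : Fin S.n}
    {G : ℂ → Matrix (Fin 2) (Fin 2) ℂ} (hG : IsGauge P x C s G) :
    (fun z => lax P x C z 0 1 - Y P x s z * gaugeEntry G z) =O[𝓝[≠] (P.X x s)]
      fun _ => (1 : ℂ) := by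
  obtain ⟨han, hdet, hO⟩ := hG
  have hcont : ContinuousAt (fun z => (G z).det) (P.X x s) := by
    simp only [Matrix.det_fin_two]
    exact (((han 0 0).mul (han 1 1)).sub ((han 0 1).mul (han 1 0))).continuousAt
  refine (isBigO_conj (fun i j => isBigO_one_entry (han i j))
    (fun i j => isBigO_one_entry (analyticAt_inv_entry han hdet i j)) hO 0 1).congr' ?_
    EventuallyEq.rfl
  filter_upwards [nhdsWithin_le_nhds (hcont.eventually_ne hdet)] with z hz
  rw [sub_gaugeEntry _ hz]; rfl

lemma IsGaugeInf.isBigO {x : P.Space} {C : Coeffs S.n}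
    {G : ℂ → Matrix (Fin 2) (Fin 2) ℂ} (hG : IsGaugeInf P x C G) :
    (fun z => lax P x C z 0 1 - YInf P x z * gaugeEntry G z⁻¹) =O[cobounded ℂ]
      fun z => (z ^ 2)⁻¹ := by
  obtain ⟨han, h1, hO⟩ := hG
  have hdet : (G 0).det ≠ 0 := by rw [h1]; simp
  have hcont : ContinuousAt (fun z => (G z).det) 0 := by
    simp only [Matrix.det_fin_two]
    exact (((han 0 0).mul (han 1 1)).sub ((han 0 1).mul (han 1 0))).continuousAt
  refine (isBigO_conj (G := fun z => G z⁻¹)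
    (fun i j => (isBigO_one_entry (han i j)).comp_tendsto tendsto_inv₀_cobounded')
    (fun i j => (isBigO_one_entry (analyticAt_inv_entry han hdet i j)).comp_tendsto
      tendsto_inv₀_cobounded') hO 0 1).congr' ?_ EventuallyEq.rfl
  filter_upwards [tendsto_inv₀_cobounded.eventually (hcont.eventually_ne hdet)] with z hz
  rw [sub_gaugeEntry _ hz]; rfl

lemma sum_Icc_one (N : ℕ) (f : ℕ → ℂ) :
    ∑ k ∈ Finset.Icc 1 N, f k = ∑ k ∈ Finset.range N, f (k + 1) := by
  rw [Finset.range_eq_Ico, Finset.sum_Ico_add' f 0 N 1]; rfl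

lemma eval_entry {n : ℕ} (C : Coeffs n) (r : Fin n → ℕ) (N : ℕ) (X : Fin n → ℂ) (z : ℂ) :
    C.eval r N X z 0 1 =
      ratFun N r X (fun k => C.inf (k + 1) 0 1) (fun s k => C.fin s k 0 1) z := by
  simp only [Coeffs.eval, ratFun, Matrix.add_apply, Matrix.sum_apply, Matrix.smul_apply,
    smul_eq_mul]
  rw [sum_Icc_one N fun k => z ^ (k - 1) * C.inf k 0 1]
  simp only [Nat.add_sub_cancel, mul_comm]

lemma a_eq (x α : P.Space) (s : Fin S.n) (z : ℂ) :
    a P x α s z = ∑ k ∈ Finset.range (S.r s),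
      (-(P.dir α (Param.time s (k + 1)) / ((k + 1 : ℕ) : ℂ)) -
        P.dir α (Param.pos s) * P.t x s k) * ((z - P.X x s) ^ (k + 1))⁻¹ := by
  -- The shift k ↦ k + 1 reaches the index r_s, which is never the index of a varying time.
  have hlast : P.dir α (Param.time s (S.r s)) = 0 := by
    rw [Deformation.dir, dif_neg]
    intro h
    have := P.time_mem s _ h
    omega
  obtain ⟨m, hm⟩ : ∃ m, S.r s = m + 1 := ⟨S.r s - 1, by have := S.r_pos s; omega⟩
  rw [a, sum_Icc_one _ fun k => P.dir α (Param.time s k) / (k : ℂ) * ((z - P.X x s) ^ k)⁻¹]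
  simp only [sub_mul, Finset.sum_sub_distrib, Y, Finset.mul_sum, mul_assoc, neg_mul,
    Finset.sum_neg_distrib]
  congr 2
  rw [hm, Finset.sum_range_succ, ← hm, hlast]
  simp [hm]

open PowerSeries in
/-- Relations between the singular parts at `X_s` of the Lax matrix, of the auxiliary matrix and
of their common gauge. -/
lemma polar_relations {x α : P.Space} (hX : Function.Injective (P.X x)) {C A : Coeffs S.n}
    (h : IsAux P x α C A) (s : Fin S.n) : ∃ H : PowerSeries ℂ,
    X ^ (S.r s) ∣ PowerSeries.mk (fun i => C.fin s (S.r s - 1 - i) 0 1) -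
      PowerSeries.mk (fun i => P.t x s (S.r s - 1 - i)) * H ∧
    X ^ (S.r s) ∣ PowerSeries.mk (fun i => A.fin s (S.r s - 1 - i) 0 1) -
      PowerSeries.mk (fun i => -(P.dir α (Param.time s (S.r s - 1 - i + 1)) /
        ((S.r s - 1 - i + 1 : ℕ) : ℂ)) -
        P.dir α (Param.pos s) * P.t x s (S.r s - 1 - i)) * H := by
  obtain ⟨G, hG, hA⟩ := h.1 s
  obtain ⟨H, hH, -⟩ := exists_isTaylor (analyticAt_gaugeEntry hG.1 hG.2.1)
  refine ⟨H, ?_, ?_⟩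
  · refine polar_of_isBigO (c := fun k => C.fin s k 0 1) (y := P.t x s) hH ?_
    refine (hG.isBigO.sub (ratFun_sub_polar (N := S.rInf - 1) (r := S.r)
      (d := fun k => C.inf (k + 1) 0 1) (c := fun s k => C.fin s k 0 1) hX s)).congr_left
      fun z => ?_
    rw [lax, eval_entry, Y]; ring
  · refine polar_of_isBigO (c := fun k => A.fin s k 0 1)
      (y := fun k => (-(P.dir α (Param.time s (k + 1)) / ((k + 1 : ℕ) : ℂ)) -
        P.dir α (Param.pos s) * P.t x s k)) hH ?_
    refine ((hA 0 1).sub (ratFun_sub_polar (N := S.rInf) (r := S.r)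
      (d := fun k => A.inf (k + 1) 0 1) (c := fun s k => A.fin s k 0 1) hX s)).congr_left
      fun z => ?_
    rw [← a_eq, Matrix.sub_apply, Matrix.smul_apply, smul_eq_mul, aux, eval_entry, gaugeEntry]
    ring

lemma dir_timeInf_eq_zero (α : P.Space) {k : ℕ} (hk : ¬ (1 ≤ k ∧ k ≤ S.rInf - 3)) :
    P.dir α (Param.timeInf k) = 0 := by
  rw [Deformation.dir, dif_neg fun h => hk (P.timeInf_mem k h)]

lemma pow_mul_aInf (α : P.Space) {w : ℂ} (hw : w ≠ 0) :
    w ^ (S.rInf - 1) * aInf P α w⁻¹ = -∑ i ∈ Finset.range S.rInf,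
      P.dir α (Param.timeInf (S.rInf - 1 - i)) / ((S.rInf - 1 - i : ℕ) : ℂ) * w ^ i := by
  have h1 : ∑ k ∈ Finset.Icc 1 (S.rInf - 3),
      P.dir α (Param.timeInf k) / (k : ℂ) * w⁻¹ ^ k =
      ∑ k ∈ Finset.range S.rInf, P.dir α (Param.timeInf k) / (k : ℂ) * w⁻¹ ^ k := by
    refine Finset.sum_subset (fun k hk => ?_) fun k _ hk' => ?_
    · rw [Finset.mem_Icc] at hk; rw [Finset.mem_range]; omega
    · rw [dir_timeInf_eq_zero α (by rwa [Finset.mem_Icc] at hk')]; simp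
  have h2 := pow_mul_poly S.rInf (fun k => P.dir α (Param.timeInf k) / (k : ℂ)) hw
  have h3 : w ^ S.rInf = w * w ^ (S.rInf - 1) := by
    rw [← pow_succ']; congr 1; have := S.rInf_pos; omega
  rw [h3, mul_assoc] at h2
  rw [aInf, h1, mul_neg, mul_left_cancel₀ hw h2]

-- The free constant term at infinity is diagonal and so does not affect the entry (1,2).
-- Multiplying by w^(r_∞-1), w = 1/z, turns the remainder O(z⁻¹) into O(w^(r_∞)).
open PowerSeries in
lemma aux_relation_inf {x α : P.Space} {A : Coeffs S.n}
    {G : ℂ → Matrix (Fin 2) (Fin 2) ℂ} {c : Fin 2 → ℂ} {H : PowerSeries ℂ}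
    (hH : IsTaylor (gaugeEntry G) H)
    (hA : ∀ i j, (fun z => (aux P x A z - aInf P α z • ((G z⁻¹)⁻¹ * sigma3 * G z⁻¹)
        - Matrix.diagonal c) i j) =O[cobounded ℂ] (fun z => z⁻¹)) :
    X ^ S.rInf ∣ PowerSeries.mk (fun i => A.inf (S.rInf - 1 - i + 1) 0 1) +
      PowerSeries.mk (fun i => P.dir α (Param.timeInf (S.rInf - 1 - i)) /
        ((S.rInf - 1 - i : ℕ) : ℂ)) * H := by
  have h1 := isBigO_inv_of_cobounded ((hA 0 1).sub (ratFun_sub_poly (N := S.rInf) (r := S.r)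
    (X := P.X x) (d := fun k => A.inf (k + 1) 0 1) (c := fun s k => A.fin s k 0 1)))
  have h2 := (isBigO_refl (fun w : ℂ => w ^ (S.rInf - 1)) (𝓝[≠] 0)).mul h1
  rw [← sub_neg_eq_add, ← neg_mul]
  refine X_pow_dvd_of_isTaylor (n := S.rInf) (n' := S.rInf)
    (T := -PowerSeries.mk (fun i => P.dir α (Param.timeInf (S.rInf - 1 - i)) /
        ((S.rInf - 1 - i : ℕ) : ℂ))) le_rfl le_rfl hH (h2.congr' ?_ ?_)
  · filter_upwards [self_mem_nhdsWithin] with w hw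
    have hw' : w ≠ 0 := hw
    have e1 := pow_mul_aInf (P := P) α hw'
    have e2 := pow_mul_poly S.rInf (fun k => A.inf (k + 1) 0 1) hw'
    have h3 : w ^ S.rInf = w * w ^ (S.rInf - 1) := by
      rw [← pow_succ']; congr 1; have := S.rInf_pos; omega
    rw [h3, mul_assoc] at e2
    have e3 := mul_left_cancel₀ hw' e2
    rw [map_neg, Polynomial.eval_neg, eval_trunc, eval_trunc, ← e1, ← e3, Matrix.sub_apply,
      Matrix.sub_apply, Matrix.smul_apply, smul_eq_mul, aux, eval_entry, gaugeEntry,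
      Matrix.diagonal_apply_ne _ (by decide), inv_inv]
    ring
  · filter_upwards [self_mem_nhdsWithin] with w hw
    rw [inv_inv, ← pow_succ]; congr 1; have := S.rInf_pos; omega

lemma pow_mul_YInf (hR : 2 ≤ S.rInf) (x : P.Space) {w : ℂ} (hw : w ≠ 0) :
    w ^ (S.rInf - 2) * YInf P x w⁻¹ =
      -∑ i ∈ Finset.range S.rInf, P.tInf x (S.rInf - 1 - i) * w ^ i := by
  have h2 := pow_mul_poly S.rInf (fun k => P.tInf x k) hw
  have h3 : w ^ S.rInf = w * (w ^ (S.rInf - 2) * w) := by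
    rw [← pow_succ, ← pow_succ']; congr 1; omega
  rw [h3, mul_assoc] at h2
  rw [← mul_left_cancel₀ hw h2, YInf, mul_neg, mul_assoc, Finset.mul_sum (a := w)]
  congr 2
  refine Finset.sum_congr rfl fun k _ => ?_
  rw [zpow_sub₀ (inv_ne_zero hw), zpow_one, zpow_natCast]
  field_simp

-- The precision O(z⁻²) of the normal form is weakened to O(z⁻¹), since the finite poles contribute
-- at that order. This leaves the r_∞ - 1 coefficients of the polynomial part.
open PowerSeries in
lemma lax_relation_inf (hR : 2 ≤ S.rInf) {x : P.Space} {C : Coeffs S.n}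
    {G : ℂ → Matrix (Fin 2) (Fin 2) ℂ} {H : PowerSeries ℂ}
    (hH : IsTaylor (gaugeEntry G) H) (hG : IsGaugeInf P x C G) :
    X ^ (S.rInf - 1) ∣ PowerSeries.mk (fun i => C.inf (S.rInf - 1 - 1 - i + 1) 0 1) +
      PowerSeries.mk (fun i => P.tInf x (S.rInf - 1 - i)) * H := by
  have h0 : (fun z : ℂ => (z ^ 2)⁻¹) =O[cobounded ℂ] fun z => z⁻¹ := by
    have := (tendsto_inv₀_cobounded (α := ℂ)).isBigO_one ℂ
    refine (this.mul (isBigO_refl (fun z : ℂ => z⁻¹) _)).congr (fun z => ?_) fun z => one_mul _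
    rw [← inv_pow, sq]
  have h1 := isBigO_inv_of_cobounded ((hG.isBigO.trans h0).sub (ratFun_sub_poly
    (N := S.rInf - 1) (r := S.r)
    (X := P.X x) (d := fun k => C.inf (k + 1) 0 1) (c := fun s k => C.fin s k 0 1)))
  have h2 := (isBigO_refl (fun w : ℂ => w ^ (S.rInf - 2)) (𝓝[≠] 0)).mul h1
  rw [← sub_neg_eq_add, ← neg_mul]
  refine X_pow_dvd_of_isTaylor (n := S.rInf - 1) (n' := S.rInf)
    (T := -PowerSeries.mk (fun i => P.tInf x (S.rInf - 1 - i))) le_rfl (Nat.sub_le _ _) hH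
    (h2.congr' ?_ ?_)
  · filter_upwards [self_mem_nhdsWithin] with w hw
    have hw' : w ≠ 0 := hw
    have e1 := pow_mul_YInf (P := P) hR x hw'
    have e2 := pow_mul_poly (S.rInf - 1) (fun k => C.inf (k + 1) 0 1) hw'
    have h3 : w ^ (S.rInf - 1) = w * w ^ (S.rInf - 2) := by
      rw [← pow_succ']; congr 1; omega
    rw [h3, mul_assoc] at e2
    have e3 := mul_left_cancel₀ hw' e2
    rw [map_neg, Polynomial.eval_neg, eval_trunc, eval_trunc, ← e1, ← e3, lax, eval_entry,
      inv_inv]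
    ring
  · filter_upwards [self_mem_nhdsWithin] with w hw
    rw [inv_inv, ← pow_succ]; congr 1; omega

end

/-! ### Elimination of the gauge from the local relations. -/

/-- The coefficients `e / (e - i) * t_{e-i}` of `e ζ^e` times the primitive of
`-∑ t_k ζ^(-k-1)`. -/
def tauSeq (e : ℕ) (t : ℕ → ℂ) (i : ℕ) : ℂ := (e : ℂ) / ((e - i : ℕ) : ℂ) * t (e - i)

/-- Differentiating the primitive gives back the singular part: the factor 1 - i/e cancels e/(e -
i). Thus `theta` of `tauSeq` is, below degree e, the series of the times themselves. -/
lemma theta_tauSeq {e i : ℕ} (t : ℕ → ℂ) (hi : i < e) :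
    (1 - (i : ℂ) / e) * tauSeq e t i = t (e - i) := by
  have h1 : (e : ℂ) ≠ 0 := by exact_mod_cast (by omega : e ≠ 0)
  have h2 := sub_natCast_ne_zero hi
  rw [tauSeq, Nat.cast_sub hi.le]
  field_simp

-- Here T, D and H stand for the times, their variations and the gauge entry. Since q ≡ T·H and
-- `theta` ≡ T, the system reads T·(B - D·H) ≡ 0 with B the series of dq_i / (N - i), and the unit T
-- can be cancelled.
open PowerSeries in
lemma varSystem_iff {N e : ℕ} {τ dτ q dq : ℕ → ℂ} {T D H : PowerSeries ℂ}
    (hT : X ^ N ∣ theta e τ - T) (hD : X ^ N ∣ C ((e : ℂ)⁻¹) * PowerSeries.mk dτ - D)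
    (hq : X ^ N ∣ PowerSeries.mk q - T * H) (h0 : 0 < N → constantCoeff T ≠ 0) :
    VarSystem N N e τ dτ q dq ↔ ∀ i < N, dq i = ((N : ℂ) - i) * coeff i (D * H) := by
  rcases Nat.eq_zero_or_pos N with rfl | hN
  · simp [VarSystem]
  set B := PowerSeries.mk (fun i => dq i / ((N : ℂ) - i)) with hB
  have e1 : VarSystem N N e τ dτ q dq ↔ X ^ N ∣ T * (B - D * H) := by
    have h1 := ((hT.mul_right B).sub (hD.mul_right (PowerSeries.mk q))).sub (hq.mul_left D)
    refine dvd_iff_dvd_of_dvd_sub ?_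
    convert h1 using 1
    ring
  rw [e1]
  have e2 : X ^ N ∣ T * (B - D * H) ↔ X ^ N ∣ B - D * H :=
    ⟨X_pow_dvd_of_mul (h0 hN), fun h => h.mul_left _⟩
  rw [e2, X_pow_dvd_iff]
  refine forall₂_congr fun i hi => ?_
  rw [map_sub, hB, coeff_mk, sub_eq_zero, div_eq_iff (sub_natCast_ne_zero hi), mul_comm]

section
variable {S : PoleType} {P : Deformation S}

lemma differentiable_value (p : Param S.n) : Differentiable ℂ fun y : P.Space => P.value y p := by
  unfold Deformation.value
  split_ifs <;> fun_prop

lemma fderiv_value (p : Param S.n) (x α : P.Space) :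
    fderiv ℂ (fun y : P.Space => P.value y p) x α = P.dir α p := by
  unfold Deformation.value Deformation.dir
  split_ifs with h
  · exact DFunLike.congr_fun
      (ContinuousLinearMap.proj (R := ℂ) (φ := fun _ : P.vary => ℂ) ⟨p, h⟩).fderiv α
  · simp

end

/-! ### Comparison of partial fractions in the isospectral condition. -/

/-- Differentiating a pole, in z or in its position, raises its order by one. This collects the
result by order, hence the range r + 1. -/
lemma sum_shift (r : ℕ) (u v g : ℕ → ℂ) :
    ∑ k ∈ Finset.range r, (u k * g k + ((k : ℂ) + 1) * v k * g (k + 1)) =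
      ∑ k ∈ Finset.range (r + 1), ((if k < r then u k else 0) + k * v (k - 1)) * g k := by
  simp only [add_mul _ _ (g _), Finset.sum_add_distrib]
  congr 1
  · rw [Finset.sum_range_succ, if_neg (lt_irrefl r), zero_mul, add_zero]
    exact Finset.sum_congr rfl fun k hk => by rw [if_pos (Finset.mem_range.1 hk)]
  · rw [Finset.sum_range_succ']
    simp

lemma ratFun_sub {n : ℕ} (N : ℕ) (r : Fin n → ℕ) (X : Fin n → ℂ) (d d' : ℕ → ℂ)
    (c c' : Fin n → ℕ → ℂ) (z : ℂ) : ratFun N r X d c z - ratFun N r X d' c' z =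
      ratFun N r X (fun k => d k - d' k) (fun s k => c s k - c' s k) z := by
  simp only [ratFun, sub_mul, Finset.sum_sub_distrib]
  ring

lemma hasDerivAt_ratFun {n : ℕ} {N : ℕ} {r : Fin n → ℕ} {X : Fin n → ℂ} (d : ℕ → ℂ)
    (c : Fin n → ℕ → ℂ) {z : ℂ} (hz : ∀ s, z ≠ X s) :
    HasDerivAt (ratFun N r X d c) (ratFun (N - 1) (fun s => r s + 1) X
      (fun k => ((k : ℂ) + 1) * d (k + 1)) (fun s k => -((k : ℂ) * c s (k - 1))) z) z := by
  have h1 : HasDerivAt (ratFun N r X d c) (∑ k ∈ Finset.range N, d k * ((k : ℂ) * z ^ (k - 1)) +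
      ∑ s, ∑ k ∈ Finset.range (r s), c s k *
        (-(((k + 1 : ℕ) : ℂ) * (z - X s) ^ k * 1) / ((z - X s) ^ (k + 1)) ^ 2)) z := by
    refine HasDerivAt.add (HasDerivAt.fun_sum fun k _ => (hasDerivAt_pow k z).const_mul _)
      (HasDerivAt.fun_sum fun s _ => HasDerivAt.fun_sum fun k _ => ?_)
    exact ((((hasDerivAt_id z).sub_const (X s)).fun_pow (k + 1)).fun_inv
      (pow_ne_zero _ (sub_ne_zero.2 (hz s)))).const_mul (c s k)
  convert h1 using 1
  rw [ratFun]
  congr 1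
  · cases N with
    | zero => simp
    | succ N =>
      rw [Finset.sum_range_succ' _ N]
      simp only [Nat.add_sub_cancel, Nat.cast_zero, zero_mul, mul_zero, add_zero]
      exact Finset.sum_congr rfl fun k _ => by push_cast; ring
  · refine Finset.sum_congr rfl fun s _ => ?_
    have := sum_shift (r s) 0 (fun k => -c s k) (fun k => ((z - X s) ^ (k + 1))⁻¹)
    simp only [Pi.zero_apply, zero_mul, zero_add, ite_self, mul_neg] at this
    rw [← this]
    refine Finset.sum_congr rfl fun k _ => ?_
    have hne := sub_ne_zero.2 (hz s)
    push_cast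
    field_simp
    ring

lemma hasDerivAt_ratFun_param {n : ℕ} {N : ℕ} {r : Fin n → ℕ} {X : Fin n → ℂ → ℂ}
    {d : ℕ → ℂ → ℂ} {c : Fin n → ℕ → ℂ → ℂ} {X' : Fin n → ℂ} {d' : ℕ → ℂ} {c' : Fin n → ℕ → ℂ}
    {z t : ℂ} (hz : ∀ s, z ≠ X s t) (hX : ∀ s, HasDerivAt (X s) (X' s) t)
    (hd : ∀ k < N, HasDerivAt (d k) (d' k) t)
    (hc : ∀ s, ∀ k < r s, HasDerivAt (c s k) (c' s k) t) :
    HasDerivAt (fun y => ratFun N r (fun s => X s y) (fun k => d k y) (fun s k => c s k y) z)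
      (ratFun N (fun s => r s + 1) (fun s => X s t) d' (fun s k =>
        (if k < r s then c' s k else 0) + k * (X' s * c s (k - 1) t)) z) t := by
  have h1 : HasDerivAt
      (fun y => ratFun N r (fun s => X s y) (fun k => d k y) (fun s k => c s k y) z)
      (∑ k ∈ Finset.range N, d' k * z ^ k +
      ∑ s, ∑ k ∈ Finset.range (r s), (c' s k * ((z - X s t) ^ (k + 1))⁻¹ + c s k t *
        (-(((k + 1 : ℕ) : ℂ) * (z - X s t) ^ k * (-X' s)) / ((z - X s t) ^ (k + 1)) ^ 2))) t := by
    refine HasDerivAt.add (HasDerivAt.fun_sum fun k hk =>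
      (hd k (Finset.mem_range.1 hk)).mul_const _)
      (HasDerivAt.fun_sum fun s _ => HasDerivAt.fun_sum fun k hk => ?_)
    exact (hc s k (Finset.mem_range.1 hk)).fun_mul ((((hX s).const_sub z).fun_pow (k + 1)).fun_inv
      (pow_ne_zero _ (sub_ne_zero.2 (hz s))))
  convert h1 using 1
  rw [ratFun]
  congr 1
  refine Finset.sum_congr rfl fun s _ => ?_
  rw [← sum_shift (r s) (c' s) (fun k => X' s * c s k t) (fun k => ((z - X s t) ^ (k + 1))⁻¹)]
  refine Finset.sum_congr rfl fun k _ => ?_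
  have hne := sub_ne_zero.2 (hz s)
  push_cast
  field_simp
  ring

section
variable {S : PoleType} {P : Deformation S} {D : Set P.Space} {L : P.Space → Coeffs S.n}

lemma IsLaxFamily.differentiableOn_inf (hL : IsLaxFamily P D L) {k : ℕ} (hk : k < S.rInf - 1) :
    DifferentiableOn ℂ (fun y => (L y).inf (k + 1) 0 1) D :=
  hL.holo_inf _ (Finset.mem_Icc.2 ⟨by omega, by omega⟩) 0 1

lemma IsLaxFamily.differentiableOn_fin (hL : IsLaxFamily P D L) {s : Fin S.n} {k : ℕ}
    (hk : k < S.r s) : DifferentiableOn ℂ (fun y => (L y).fin s k 0 1) D :=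
  hL.holo_fin s k hk 0 1

/-- The entry `(1,2)` of the isospectral condition in terms of partial fractions. -/
lemma isospectral12_iff_coeff (hD : IsOpen D) (hadm : ∀ x ∈ D, P.Admissible x)
    (hL : IsLaxFamily P D L) (A : P.Space → P.Space → Coeffs S.n) :
    Isospectral12 P D L A ↔ ∀ x ∈ D, ∀ α : P.Space,
      (∀ k < S.rInf - 1, fderiv ℂ (fun y => (L y).inf (k + 1) 0 1) x α =
        ((k : ℂ) + 1) * (A α x).inf (k + 1 + 1) 0 1) ∧
      ∀ s, ∀ k < S.r s + 1,
        (if k < S.r s then fderiv ℂ (fun y => (L y).fin s k 0 1) x α else 0) +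
          k * (P.dir α (Param.pos s) * (L x).fin s (k - 1) 0 1) =
        -(k * (A α x).fin s (k - 1) 0 1) := by
  refine forall₂_congr fun x hx => forall_congr' fun α => ?_
  have dat : ∀ {f : P.Space → ℂ}, DifferentiableOn ℂ f D → DifferentiableAt ℂ f x :=
    fun h => h.differentiableAt (hD.mem_nhds hx)
  set d : ℕ → ℂ := fun k => fderiv ℂ (fun y => (L y).inf (k + 1) 0 1) x α
  set c : Fin S.n → ℕ → ℂ := fun s k =>
    (if k < S.r s then fderiv ℂ (fun y => (L y).fin s k 0 1) x α else 0) +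
      k * (P.dir α (Param.pos s) * (L x).fin s (k - 1) 0 1)
  set d₂ : ℕ → ℂ := fun k => ((k : ℂ) + 1) * (A α x).inf (k + 1 + 1) 0 1
  set c₂ : Fin S.n → ℕ → ℂ := fun s k => -((k : ℂ) * (A α x).fin s (k - 1) 0 1)
  have hl : ∀ z, (∀ s, z ≠ P.X x s) → fderiv ℂ (fun y => lax P y (L y) z 0 1) x α =
      ratFun (S.rInf - 1) (fun s => S.r s + 1) (P.X x) d c z := by
    intro z hz
    simp only [lax, eval_entry]
    have hdiff : DifferentiableAt ℂ (fun y => ratFun (S.rInf - 1) S.r (P.X y)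
        (fun k => (L y).inf (k + 1) 0 1) (fun s k => (L y).fin s k 0 1) z) x := by
      refine DifferentiableAt.add (DifferentiableAt.fun_sum fun k hk =>
        (dat (hL.differentiableOn_inf (Finset.mem_range.1 hk))).mul_const _)
        (DifferentiableAt.fun_sum fun s _ => DifferentiableAt.fun_sum fun k hk => ?_)
      refine (dat (hL.differentiableOn_fin (Finset.mem_range.1 hk))).fun_mul
        (DifferentiableAt.fun_inv (DifferentiableAt.fun_pow
          ((differentiable_value (Param.pos s) x).const_sub z) _)
          (pow_ne_zero _ (sub_ne_zero.2 (hz s))))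
    refine (hasDerivAt_line hdiff α).unique ?_
    have := hasDerivAt_ratFun_param (N := S.rInf - 1) (r := S.r) (z := z) (t := 0)
      (X := fun s t => P.X (x + t • α) s) (d := fun k t => (L (x + t • α)).inf (k + 1) 0 1)
      (c := fun s k t => (L (x + t • α)).fin s k 0 1) (X' := fun s => P.dir α (Param.pos s))
      (d' := d) (c' := fun s k => fderiv ℂ (fun y => (L y).fin s k 0 1) x α)
      (by simpa using hz)
      (fun s => by
        rw [← fderiv_value (Param.pos s) x α]
        exact hasDerivAt_line (differentiable_value (Param.pos s) x) α)
      (fun k hk => hasDerivAt_line (dat (hL.differentiableOn_inf hk)) α)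
      (fun s k hk => hasDerivAt_line (dat (hL.differentiableOn_fin hk)) α)
    simp only [zero_smul, add_zero] at this
    exact this
  have ha : ∀ z, (∀ s, z ≠ P.X x s) → deriv (fun w => aux P x (A α x) w 0 1) z =
      ratFun (S.rInf - 1) (fun s => S.r s + 1) (P.X x) d₂ c₂ z := by
    intro z hz
    simp only [aux, eval_entry]
    exact (hasDerivAt_ratFun _ _ hz).deriv
  constructor
  · intro h
    have := ratFun_eq_zero (hadm x hx).1 (N := S.rInf - 1) (r := fun s => S.r s + 1)
      (d := fun k => d k - d₂ k) (c := fun s k => c s k - c₂ s k) fun z hz => by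
        rw [← ratFun_sub, ← hl z hz, ← ha z hz, sub_eq_zero]; exact h z hz
    exact ⟨fun k hk => sub_eq_zero.1 (this.1 k hk),
      fun s k hk => sub_eq_zero.1 (this.2 s k hk)⟩
  · rintro ⟨h1, h2⟩ z hz
    rw [hl z hz, ha z hz, ratFun, ratFun]
    congr 1
    · exact Finset.sum_congr rfl fun k hk => by
        rw [show d k = d₂ k from h1 k (Finset.mem_range.1 hk)]
    · exact Finset.sum_congr rfl fun s _ => Finset.sum_congr rfl fun k hk => by
        rw [show c s k = c₂ s k from h2 s k (Finset.mem_range.1 hk)]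

end

/-! ### The isospectral condition at a single pole. -/

section
variable {S : PoleType} {P : Deformation S}

open PowerSeries in
/-- The isospectral condition at `X_s` is a linear system for the derivatives of the `Q_{X_s,k}`. -/
lemma finite_pole_iff {x α : P.Space} (hadm : P.Admissible x) {C A : Coeffs S.n}
    (h : IsAux P x α C A) (s : Fin S.n) (δ : ℕ → ℂ) :
    (∀ k < S.r s + 1, (if k < S.r s then δ k else 0) +
        k * (P.dir α (Param.pos s) * C.fin s (k - 1) 0 1) = -(k * A.fin s (k - 1) 0 1)) ↔
      δ 0 = 0 ∧ VarSystem (S.r s - 1) (S.r s - 1) (S.r s - 1) (tauSeq (S.r s - 1) (P.t x s))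
        (tauSeq (S.r s - 1) fun k => P.dir α (Param.time s k))
        (fun i => Q C s (S.r s - i)) (fun i => δ (S.r s - 1 - i)) := by
  obtain ⟨H, h1, h2⟩ := polar_relations hadm.1 h s
  obtain ⟨m, hm⟩ : ∃ m, S.r s = m + 1 := ⟨S.r s - 1, by have := S.r_pos s; omega⟩
  have hlead : 0 < m → P.t x s m ≠ 0 := fun hpos => by
    have := hadm.2 s (by omega)
    rwa [hm, Nat.add_sub_cancel] at this
  have hlast : P.dir α (Param.time s (m + 1)) = 0 := by
    rw [Deformation.dir, dif_neg]
    intro hv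
    have := P.time_mem s _ hv
    omega
  simp only [hm, Nat.add_sub_cancel] at h1 h2 ⊢
  set T : PowerSeries ℂ := PowerSeries.mk fun i => P.t x s (m - i) with hT
  set D : PowerSeries ℂ :=
    PowerSeries.mk fun i => P.dir α (Param.time s (m - i)) / ((m - i : ℕ) : ℂ) with hD
  set β := P.dir α (Param.pos s)
  -- The auxiliary singular part splits into the variation of the times, one order lower (the factor
  -- X), and -β times that of the Lax matrix. The second piece cancels the displacement of the pole
  -- in the derivative of the Lax matrix.
  have hA : ∀ j < m + 1, A.fin s (m - j) 0 1 =
      -coeff j (X * (D * H)) - β * C.fin s (m - j) 0 1 := by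
    have h3 : X ^ (m + 1) ∣ PowerSeries.mk (fun i => -(P.dir α (Param.time s (m - i + 1)) /
        ((m - i + 1 : ℕ) : ℂ)) - β * P.t x s (m - i)) + X * D + PowerSeries.C β * T := by
      refine X_pow_dvd_iff.2 fun j hj => ?_
      cases j with
      | zero => simp [hT, hlast]
      | succ j =>
        rw [map_add, map_add, coeff_succ_X_mul, coeff_C_mul, hT, hD, coeff_mk, coeff_mk, coeff_mk,
          show m - (j + 1) + 1 = m - j by omega]
        ring
    intro j hj
    have h4 := X_pow_dvd_iff.1 ((h2.add (h3.mul_right H)).add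
      (h1.mul_left (PowerSeries.C β))) j hj
    have h5 : PowerSeries.mk (fun i => A.fin s (m - i) 0 1) + X * (D * H) +
        PowerSeries.C β * PowerSeries.mk (fun i => C.fin s (m - i) 0 1) =
        PowerSeries.mk (fun i => A.fin s (m - i) 0 1) -
        PowerSeries.mk (fun i => -(P.dir α (Param.time s (m - i + 1)) /
        ((m - i + 1 : ℕ) : ℂ)) - β * P.t x s (m - i)) * H +
        (PowerSeries.mk (fun i => -(P.dir α (Param.time s (m - i + 1)) /
        ((m - i + 1 : ℕ) : ℂ)) - β * P.t x s (m - i)) + X * D + PowerSeries.C β * T) * H +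
        PowerSeries.C β * (PowerSeries.mk (fun i => C.fin s (m - i) 0 1) - T * H) := by ring
    rw [← h5, map_add, map_add, coeff_C_mul, coeff_mk, coeff_mk] at h4
    linear_combination h4
  have hsys := varSystem_iff (N := m) (e := m) (τ := tauSeq m (P.t x s))
    (dτ := tauSeq m fun k => P.dir α (Param.time s k)) (q := fun i => Q C s (m + 1 - i))
    (dq := fun i => δ (m - i)) (T := T) (D := D) (H := H) ?_ ?_ ?_ ?_
  · rw [hsys]
    constructor
    · intro hk
      refine ⟨by simpa using hk 0 (by omega), fun i hi => ?_⟩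
      have h6 := hk (m - i) (by omega)
      rw [if_pos (by omega), show m - i - 1 = m - (i + 1) by omega, hA (i + 1) (by omega),
        coeff_succ_X_mul, Nat.cast_sub hi.le] at h6
      linear_combination h6
    · rintro ⟨h0, hk⟩ k hkm
      rcases Nat.eq_zero_or_pos k with rfl | hk0
      · simp [h0]
      obtain ⟨j, hj, hkj⟩ : ∃ j < m + 1, k - 1 = m - j := ⟨m - (k - 1), by omega, by omega⟩
      rw [hkj, hA j hj]
      cases j with
      -- At the top order r_s + 1 only the displacement of the pole remains, because X·(D·H) has no
      -- constant term; the equation holds identically.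
      | zero =>
        rw [if_neg (by omega), coeff_zero_eq_constantCoeff_apply, map_mul, constantCoeff_X]
        ring
      | succ j =>
        have h6 := hk j (by omega)
        rw [if_pos (by omega), coeff_succ_X_mul]
        rw [show m - j = k by omega] at h6
        rw [h6, show k = m - j by omega, Nat.cast_sub (by omega)]
        ring
  · refine X_pow_dvd_iff.2 fun i hi => ?_
    rw [map_sub, theta, coeff_mk, hT, coeff_mk, theta_tauSeq _ hi, sub_self]
  · refine X_pow_dvd_iff.2 fun i hi => ?_
    have : (m : ℂ) ≠ 0 := by exact_mod_cast (by omega : m ≠ 0)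
    rw [map_sub, coeff_C_mul, hD, coeff_mk, coeff_mk, tauSeq]
    field_simp
    ring
  · refine X_pow_dvd_iff.2 fun i hi => ?_
    have := X_pow_dvd_iff.1 h1 i (by omega)
    rw [map_sub, coeff_mk] at this ⊢
    rw [Q, show m + 1 - i - 1 = m - i by omega]
    exact this
  · simpa [hT] using hlead

open PowerSeries in
/-- The isospectral condition at infinity is a linear system for the derivatives of `ω` and of
the `Q_{∞,k}`. -/
lemma infinite_pole_iff (hR : 3 ≤ S.rInf) {x α : P.Space} {C A : Coeffs S.n}
    (h : IsAux P x α C A) (δ : ℕ → ℂ) (hδ : δ (S.rInf - 2) = 0) :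
    (∀ k < S.rInf - 1, δ k = ((k : ℂ) + 1) * A.inf (k + 1 + 1) 0 1) ↔
      VarSystem (S.rInf - 2) (S.rInf - 2) (S.rInf - 1) (tauSeq (S.rInf - 1) (P.tInf x))
        (tauSeq (S.rInf - 1) fun k => P.dir α (Param.timeInf k))
        (fun i => QInf C (S.rInf - 3 - i)) (fun i => δ (S.rInf - 3 - i)) := by
  obtain ⟨G, hG, c, hA⟩ := h.2
  have hG1 : (G 0).det ≠ 0 := by rw [hG.2.1]; simp
  obtain ⟨H, hH, hH0⟩ := exists_isTaylor (analyticAt_gaugeEntry hG.1 hG1)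
  simp only [zero_add] at hH
  have hH0' : constantCoeff H = 0 := by
    rw [hH0, gaugeEntry, hG.2.1]; simp [sigma3]
  -- The normalization G(∞) = I makes the gauge entry vanish at infinity. Removing this factor X
  -- lowers N to r_∞ - 2 while the exponent e stays r_∞ - 1.
  obtain ⟨g, rfl⟩ := X_dvd_iff.2 hH0'
  have h1 := lax_relation_inf (by omega) hH hG
  have h2 := aux_relation_inf hH hA
  obtain ⟨e, he⟩ : ∃ e, S.rInf = e + 3 := ⟨S.rInf - 3, by omega⟩
  have hlead : P.tInf x (e + 2) = 1 := by
    have h3 := P.base_lead (by omega)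
    rw [show S.rInf - 1 = e + 2 by omega] at h3
    rw [Deformation.tInf, Deformation.value, dif_neg, h3]
    intro hv
    have := P.timeInf_mem _ hv
    omega
  simp only [he, show e + 3 - 1 = e + 2 by omega, show e + 2 - 1 = e + 1 by omega,
    show e + 3 - 2 = e + 1 by omega, Nat.add_sub_cancel] at h1 h2 hδ ⊢
  set T : PowerSeries ℂ := PowerSeries.mk fun i => P.tInf x (e + 2 - i) with hT
  set D : PowerSeries ℂ :=
    PowerSeries.mk fun i => P.dir α (Param.timeInf (e + 2 - i)) / ((e + 2 - i : ℕ) : ℂ) with hD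
  -- Together with `hδ`, this makes the equation for the top power of z trivial.
  have hA0 : A.inf (e + 2 + 1) 0 1 = 0 := by
    have := X_pow_dvd_iff.1 h2 0 (by omega)
    simpa using this
  have hAi : ∀ i < e + 2, A.inf (e + 2 - i) 0 1 = coeff i (D * -g) := by
    intro i hi
    have := X_pow_dvd_iff.1 h2 (i + 1) (by omega)
    rw [map_add, coeff_mk, mul_left_comm, coeff_succ_X_mul,
      show e + 2 - (i + 1) + 1 = e + 2 - i by omega] at this
    rw [mul_neg, map_neg]
    linear_combination this
  have hsys := varSystem_iff (N := e + 1) (e := e + 2) (τ := tauSeq (e + 2) (P.tInf x))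
    (dτ := tauSeq (e + 2) fun k => P.dir α (Param.timeInf k)) (q := fun i => QInf C (e - i))
    (dq := fun i => δ (e - i)) (T := T) (D := D) (H := -g) ?_ ?_ ?_ ?_
  · rw [hsys]
    constructor
    · intro hk i hi
      rw [hk (e - i) (by omega), ← hAi i (by omega), show e - i + 1 + 1 = e + 2 - i by omega,
        Nat.cast_sub (by omega)]
      push_cast; ring
    · intro hk k hk'
      rcases Nat.lt_succ_iff_lt_or_eq.1 hk' with hlt | rfl
      · have := hk (e - k) (by omega)
        rw [← hAi (e - k) (by omega), show e - (e - k) = k by omega,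
          show e + 2 - (e - k) = k + 1 + 1 by omega, Nat.cast_sub (by omega)] at this
        rw [this]; push_cast; ring
      · rw [hδ, show e + 1 + 1 + 1 = e + 2 + 1 by omega, hA0, mul_zero]
  · refine X_pow_dvd_iff.2 fun i hi => ?_
    rw [map_sub, theta, coeff_mk, hT, coeff_mk, theta_tauSeq _ (by omega), sub_self]
  · refine X_pow_dvd_iff.2 fun i hi => ?_
    have : ((e + 2 : ℕ) : ℂ) ≠ 0 := by exact_mod_cast (by omega : e + 2 ≠ 0)
    rw [map_sub, coeff_C_mul, hD, coeff_mk, coeff_mk, tauSeq]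
    field_simp
    ring
  · refine X_pow_dvd_iff.2 fun i hi => ?_
    have := X_pow_dvd_iff.1 h1 (i + 1) (by omega)
    rw [map_add, coeff_mk, mul_left_comm, coeff_succ_X_mul] at this
    rw [map_sub, coeff_mk, QInf, mul_neg, map_neg, sub_neg_eq_add]
    rwa [show e + 1 - (i + 1) + 1 = e - i + 1 by omega] at this
  · simp [hT, hlead]

end

/-! ### Toeplitz form of the systems along coordinate directions. -/

open PowerSeries in
lemma varSystem_iff_sum {N e : ℕ} {τ dτ q dq : ℕ → ℂ} : VarSystem N N e τ dτ q dq ↔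
    ∀ i < N, ∑ k ∈ Finset.range (i + 1), (1 - ((i - k : ℕ) : ℂ) / e) * τ (i - k) *
      (dq k / ((N : ℂ) - k)) = ∑ k ∈ Finset.range (i + 1), (e : ℂ)⁻¹ * dτ k * q (i - k) := by
  rw [VarSystem, X_pow_dvd_iff]
  refine forall₂_congr fun i _ => ?_
  rw [map_sub, sub_eq_zero, mul_comm (theta e τ), mul_assoc, coeff_C_mul, coeff_mul, coeff_mul,
    Finset.Nat.sum_antidiagonal_eq_sum_range_succ_mk,
    Finset.Nat.sum_antidiagonal_eq_sum_range_succ_mk, Finset.mul_sum]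
  simp only [theta, coeff_mk, Nat.succ_eq_add_one, mul_assoc, mul_comm (dq _ / _)]

lemma varSystem_zero (K N e : ℕ) (τ q : ℕ → ℂ) : VarSystem K N e τ 0 q 0 := by
  rw [VarSystem]
  have h : (PowerSeries.mk (0 : ℕ → ℂ)) = 0 := by ext; simp
  have h' : (PowerSeries.mk fun i => (0 : ℕ → ℂ) i / ((N : ℂ) - i)) = 0 := by ext; simp
  rw [h, h']; simp

lemma varSystem_congr_left {N e : ℕ} {τ dτ dτ' q dq : ℕ → ℂ} (h : ∀ i < N, dτ i = dτ' i) :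
    VarSystem N N e τ dτ q dq ↔ VarSystem N N e τ dτ' q dq := by
  rw [varSystem_iff_sum, varSystem_iff_sum]
  refine forall₂_congr fun i hi => ?_
  have : ∑ k ∈ Finset.range (i + 1), (e : ℂ)⁻¹ * dτ k * q (i - k) =
      ∑ k ∈ Finset.range (i + 1), (e : ℂ)⁻¹ * dτ' k * q (i - k) :=
    Finset.sum_congr rfl fun k hk => by rw [h k (by have := Finset.mem_range.1 hk; omega)]
  rw [this]

/-- The system for a variation that does not change `τ`. -/
lemma varSystem_iff_eq_zero {N e : ℕ} {τ dτ q dq : ℕ → ℂ} (h0 : 0 < N → τ 0 ≠ 0)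
    (h : ∀ i < N, dτ i = 0) : VarSystem N N e τ dτ q dq ↔ ∀ i < N, dq i = 0 := by
  rw [varSystem_congr_left (dτ' := 0) h]
  exact ⟨fun hs i hi => hs.unique (h0 (by omega)) le_rfl (varSystem_zero _ _ _ _ _) hi,
    fun hs => (varSystem_zero N N e τ q).congr (fun _ _ => rfl) fun i hi => (hs i hi).symm⟩

/-- The system for a variation of one coefficient of `τ`. -/
lemma varSystem_single {N e J : ℕ} (t : ℕ → ℂ) {q dq dτ : ℕ → ℂ} (hNe : N ≤ e) (hJ : J < e)
    (h : ∀ i, i ≠ J → dτ i = 0) (hJ' : dτ J = (e : ℂ) / ((e - J : ℕ) : ℂ)) :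
    VarSystem N N e (tauSeq e t) dτ q dq ↔ ∀ i < N, ∑ k ∈ Finset.range (i + 1),
      t (e - (i - k)) * (1 / ((N - k : ℕ) : ℂ)) * dq k =
      if J ≤ i then q (i - J) * (1 / ((e - J : ℕ) : ℂ)) else 0 := by
  rw [varSystem_iff_sum]
  refine forall₂_congr fun i hi => ?_
  have e1 : ∑ k ∈ Finset.range (i + 1), (e : ℂ)⁻¹ * dτ k * q (i - k) =
      if J ≤ i then q (i - J) * (1 / ((e - J : ℕ) : ℂ)) else 0 := by
    have : (e : ℂ) ≠ 0 := by exact_mod_cast (by omega : e ≠ 0)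
    split_ifs with hJi
    · rw [Finset.sum_eq_single J (fun k _ hk => by rw [h k hk]; simp)
        fun hk => absurd (Finset.mem_range.2 (by omega)) hk, hJ']
      field_simp
    · refine Finset.sum_eq_zero fun k hk => ?_
      rw [Finset.mem_range] at hk
      rw [h k (by omega)]; simp
  rw [e1, Finset.sum_congr rfl fun k hk => ?_]
  rw [Finset.mem_range] at hk
  rw [theta_tauSeq t (by omega), Nat.cast_sub (by omega)]
  ring

lemma toeplitz_mulVec (m N : ℕ) (c v : ℕ → ℂ) (i : Fin m) :
    ((toeplitz m c * invDiagonal m N) *ᵥ fun k => v k) i =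
      ∑ k ∈ Finset.range ((i : ℕ) + 1), c (i - k) * (1 / ((N - k : ℕ) : ℂ)) * v k := by
  have e1 : ((toeplitz m c * invDiagonal m N) *ᵥ fun k => v k) i =
      ∑ k : Fin m, (if (k : ℕ) ≤ i then c (i - k) * (1 / ((N - k : ℕ) : ℂ)) * v k else 0) := by
    simp only [Matrix.mulVec, dotProduct, invDiagonal, Matrix.mul_diagonal, toeplitz,
      Matrix.of_apply]
    refine Finset.sum_congr rfl fun k _ => ?_
    simp only [Fin.le_def]
    split_ifs <;> simp
  rw [e1, Fin.sum_univ_eq_sum_range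
    (fun k => if k ≤ (i : ℕ) then c (i - k) * (1 / ((N - k : ℕ) : ℂ)) * v k else 0)]
  symm
  rw [Finset.sum_congr rfl fun k hk => (if_pos (Nat.lt_succ_iff.1 (Finset.mem_range.1 hk))).symm]
  refine Finset.sum_subset (fun k hk => ?_) fun k _ hk => if_neg ?_
  · rw [Finset.mem_range] at hk ⊢; have := i.isLt; omega
  · rw [Finset.mem_range] at hk; omega

lemma toeplitz_mul_apply (m N : ℕ) (c : ℕ → ℂ) (i j : Fin m) :
    (toeplitz m c * invDiagonal m N) i j =
      if (j : ℕ) ≤ i then c (i - j) * (1 / ((N - j : ℕ) : ℂ)) else 0 := by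
  simp only [invDiagonal, Matrix.mul_diagonal, toeplitz, Matrix.of_apply, Fin.le_def]
  split_ifs <;> simp

section
variable {S : PoleType} {P : Deformation S} {D : Set P.Space} {L : P.Space → Coeffs S.n}

lemma dir_single (p : P.vary) (p' : Param S.n) :
    P.dir (Pi.single p 1) p' = if p' = p.1 then 1 else 0 := by
  unfold Deformation.dir
  split_ifs with h h' h'
  · subst h'; simp
  · rw [Pi.single_apply, if_neg]; rintro rfl; exact h' rfl
  · exact absurd (h' ▸ p.2) h
  · rfl

/-- A linear system in all directions reduces to the coordinate directions. -/
lemma varSystem_forall_iff {N e : ℕ} {τ q : ℕ → ℂ} (par : ℕ → Param S.n)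
    (δ : ℕ → P.Space →L[ℂ] ℂ) :
    (∀ α : P.Space, VarSystem N N e τ (tauSeq e fun k => P.dir α (par k)) q fun i => δ i α) ↔
      ∀ p : P.vary, VarSystem N N e τ (tauSeq e fun k => P.dir (Pi.single p 1) (par k)) q
        fun i => δ i (Pi.single p 1) := by
  have hdir_add : ∀ α β p, P.dir (α + β) p = P.dir α p + P.dir β p := fun α β p => by
    unfold Deformation.dir; split_ifs <;> simp
  have hdir_smul : ∀ (c : ℂ) α p, P.dir (c • α) p = c * P.dir α p := fun c α p => by
    unfold Deformation.dir; split_ifs <;> simp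
  simp only [varSystem_iff_sum, dir_single]
  constructor
  · intro h p i hi
    simpa only [dir_single] using h (Pi.single p 1) i hi
  · intro h α i hi
    -- The defect of row i is linear in the direction, so it vanishes once it vanishes on the
    -- coordinate vectors.
    let φ : P.Space →ₗ[ℂ] ℂ :=
      { toFun := fun α => ∑ k ∈ Finset.range (i + 1), (1 - ((i - k : ℕ) : ℂ) / e) * τ (i - k) *
          (δ k α / ((N : ℂ) - k)) - ∑ k ∈ Finset.range (i + 1),
            (e : ℂ)⁻¹ * tauSeq e (fun k => P.dir α (par k)) k * q (i - k)
        map_add' := fun α β => by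
          simp only [← Finset.sum_sub_distrib, ← Finset.sum_add_distrib, tauSeq, map_add, hdir_add]
          exact Finset.sum_congr rfl fun k _ => by ring
        map_smul' := fun c α => by
          simp only [← Finset.sum_sub_distrib, Finset.mul_sum, tauSeq, map_smul, hdir_smul,
            smul_eq_mul, RingHom.id_apply]
          exact Finset.sum_congr rfl fun k _ => by ring }
    have hφ : φ = 0 := by
      refine LinearMap.pi_ext' fun p => LinearMap.ext_ring ?_
      have := h p i hi
      simpa [φ, sub_eq_zero, dir_single] using this
    have := LinearMap.congr_fun hφ α
    simpa [φ, sub_eq_zero] using this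

end

section
variable {S : PoleType} {P : Deformation S} {D : Set P.Space} {L : P.Space → Coeffs S.n}

lemma tauSeq_single {par : ℕ → Param S.n} (hpar : Function.Injective par) {p : P.vary} {e k : ℕ}
    (hp : p.1 = par k) (hk : 1 ≤ k) (hke : k ≤ e) :
    (∀ i, i ≠ e - k → tauSeq e (fun k => P.dir (Pi.single p 1) (par k)) i = 0) ∧
      tauSeq e (fun k => P.dir (Pi.single p 1) (par k)) (e - k) =
        (e : ℂ) / ((e - (e - k) : ℕ) : ℂ) := by
  refine ⟨fun i hi => ?_, ?_⟩
  · rw [tauSeq, dir_single, hp]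
    split_ifs with h
    · have := hpar h; omega
    · simp
  · rw [tauSeq, dir_single, hp, show e - (e - k) = k by omega]; simp

lemma tauSeq_single_of_ne {par : ℕ → Param S.n} {p : P.vary} (e : ℕ) {i : ℕ}
    (hp : p.1 ≠ par (e - i)) : tauSeq e (fun k => P.dir (Pi.single p 1) (par k)) i = 0 := by
  rw [tauSeq, dir_single, if_neg hp.symm, mul_zero]

lemma tauSeq_zero_of_lead {e : ℕ} (he : e ≠ 0) (t : ℕ → ℂ) : tauSeq e t 0 = t e := by
  have : (e : ℂ) ≠ 0 := by exact_mod_cast he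
  rw [tauSeq, Nat.sub_zero, div_self this, one_mul]

/-- The time of index r_s - 1 - j is carried by coefficient j of τ alone, which gives column j.
Every other parameter leaves τ unchanged, and the invertible triangular system then makes the
derivatives vanish. -/
lemma finiteSystem_iff (hadm : ∀ x ∈ D, P.Admissible x) (s : Fin S.n) :
    FiniteSystem P D L s ↔ ∀ x ∈ D, ∀ α, VarSystem (S.r s - 1) (S.r s - 1) (S.r s - 1)
      (tauSeq (S.r s - 1) (P.t x s)) (tauSeq (S.r s - 1) fun k => P.dir α (Param.time s k))
      (fun i => Q (L x) s (S.r s - i))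
      (fun i => fderiv ℂ (fun y => Q (L y) s (S.r s - i)) x α) := by
  refine forall₂_congr fun x hx => ?_
  rw [varSystem_forall_iff (P := P) (fun k => Param.time s k)
    fun i => fderiv ℂ (fun y => Q (L y) s (S.r s - i)) x]
  have hinj : Function.Injective (fun k => Param.time (n := S.n) s k) := fun a b h => by
    injection h
  have hsingle : ∀ (p : P.vary) (j : ℕ), p.1 = Param.time s (S.r s - 1 - j) → j < S.r s - 1 →
      (VarSystem (S.r s - 1) (S.r s - 1) (S.r s - 1) (tauSeq (S.r s - 1) (P.t x s))
        (tauSeq (S.r s - 1) fun k => P.dir (Pi.single p 1) (Param.time s k))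
        (fun i => Q (L x) s (S.r s - i))
        (fun i => fderiv ℂ (fun y => Q (L y) s (S.r s - i)) x (Pi.single p 1)) ↔
      ∀ i < S.r s - 1, ∑ k ∈ Finset.range (i + 1), P.t x s (S.r s - 1 - (i - k)) *
        (1 / ((S.r s - 1 - k : ℕ) : ℂ)) * P.pd (fun y => Q (L y) s (S.r s - k)) x p =
        if j ≤ i then Q (L x) s (S.r s - (i - j)) * (1 / ((S.r s - 1 - j : ℕ) : ℂ)) else 0) := by
    intro p j hp hj
    obtain ⟨h1, h2⟩ := tauSeq_single hinj (e := S.r s - 1) hp (by omega) (by omega)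
    rw [show S.r s - 1 - (S.r s - 1 - j) = j by omega] at h1 h2
    exact varSystem_single (P.t x s) le_rfl hj h1 h2
  have hother : ∀ p : P.vary, (∀ k, p.1 ≠ Param.time s k) →
      (VarSystem (S.r s - 1) (S.r s - 1) (S.r s - 1) (tauSeq (S.r s - 1) (P.t x s))
        (tauSeq (S.r s - 1) fun k => P.dir (Pi.single p 1) (Param.time s k))
        (fun i => Q (L x) s (S.r s - i))
        (fun i => fderiv ℂ (fun y => Q (L y) s (S.r s - i)) x (Pi.single p 1)) ↔
      ∀ i < S.r s - 1, P.pd (fun y => Q (L y) s (S.r s - i)) x p = 0) := fun p hp =>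
    varSystem_iff_eq_zero (fun hpos => by
      rw [tauSeq_zero_of_lead hpos.ne']; exact (hadm x hx).2 s (by omega))
      fun i _ => tauSeq_single_of_ne _ (hp _)
  have hvec : ∀ (j : Fin (S.r s - 1)) (p : P.vary),
      ((toeplitz (S.r s - 1) (fun d => P.t x s (S.r s - 1 - d)) *
          invDiagonal (S.r s - 1) (S.r s - 1)) *ᵥ
        (fun i => P.pd (fun y => Q (L y) s (S.r s - i)) x p) =
      fun i => (toeplitz (S.r s - 1) (fun d => Q (L x) s (S.r s - d)) *
          invDiagonal (S.r s - 1) (S.r s - 1)) i j) ↔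
      ∀ i < S.r s - 1, ∑ k ∈ Finset.range (i + 1), P.t x s (S.r s - 1 - (i - k)) *
        (1 / ((S.r s - 1 - k : ℕ) : ℂ)) * P.pd (fun y => Q (L y) s (S.r s - k)) x p =
        if (j : ℕ) ≤ i then Q (L x) s (S.r s - (i - j)) *
          (1 / ((S.r s - 1 - j : ℕ) : ℂ)) else 0 := by
    intro j p
    rw [funext_iff, Fin.forall_iff]
    refine forall₂_congr fun i hi => ?_
    rw [toeplitz_mul_apply, toeplitz_mulVec (S.r s - 1) (S.r s - 1)
      (fun d => P.t x s (S.r s - 1 - d)) (fun i => P.pd (fun y => Q (L y) s (S.r s - i)) x p)]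
  constructor
  · rintro ⟨h1, h2⟩ p
    by_cases hp : ∃ k, p.1 = Param.time s k
    · obtain ⟨k, hk⟩ := hp
      have hk' := P.time_mem s k (hk ▸ p.2)
      have hkj : S.r s - 1 - (S.r s - 1 - k) = k := by omega
      have hpj : p.1 = Param.time s (S.r s - 1 - (S.r s - 1 - k)) := by rw [hkj, hk]
      have := h1 ⟨S.r s - 1 - k, by omega⟩ (hpj ▸ p.2)
      rw [hsingle p _ hpj (by omega)]
      rw [hvec] at this
      have hpe : (⟨Param.time s (S.r s - 1 - (S.r s - 1 - k)), hpj ▸ p.2⟩ : P.vary) = p :=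
        Subtype.ext hpj.symm
      simp only [hpe] at this
      exact this
    · push Not at hp
      exact (hother p hp).2 fun i hi => h2 p hp ⟨i, hi⟩
  · intro h
    refine ⟨fun j hj => (hvec j _).2 ((hsingle ⟨_, hj⟩ j rfl j.isLt).1 (h ⟨_, hj⟩)),
      fun p hp i => (hother p hp).1 (h p) i i.isLt⟩

lemma tInf_lead (hR : 2 ≤ S.rInf) (x : P.Space) : P.tInf x (S.rInf - 1) = 1 := by
  rw [Deformation.tInf, Deformation.value, dif_neg, P.base_lead hR]
  intro hv
  have := P.timeInf_mem _ hv
  omega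

lemma tInf_sublead (hR : 3 ≤ S.rInf) (x : P.Space) : P.tInf x (S.rInf - 2) = 0 := by
  rw [Deformation.tInf, Deformation.value, dif_neg, P.base_sublead hR]
  intro hv
  have := P.timeInf_mem _ hv
  omega

/-- The linear system at infinity in the direction `α`. -/
def InfiniteVarSystem (P : Deformation S) (L : P.Space → Coeffs S.n) (x α : P.Space) : Prop :=
  VarSystem (S.rInf - 2) (S.rInf - 2) (S.rInf - 1) (tauSeq (S.rInf - 1) (P.tInf x))
    (tauSeq (S.rInf - 1) fun k => P.dir α (Param.timeInf k))
    (fun i => QInf (L x) (S.rInf - 3 - i))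
    (fun i => fderiv ℂ (fun y => QInf (L y) (S.rInf - 3 - i)) x α)

/-- The two leading times at infinity are fixed, so dτ₀ = dτ₁ = 0, and the first two rows of the
triangular system force the derivatives of ω and of the next coefficient to vanish. -/
lemma InfiniteVarSystem.fderiv_eq_zero (hR : 3 ≤ S.rInf) {x α : P.Space}
    (h : InfiniteVarSystem P L x α) {i : ℕ} (hi : i < 2) (hi' : i < S.rInf - 2) :
    fderiv ℂ (fun y => QInf (L y) (S.rInf - 3 - i)) x α = 0 := by
  have h0 : ∀ i < 2, tauSeq (S.rInf - 1) (fun k => P.dir α (Param.timeInf k)) i = 0 := by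
    intro i hi
    rw [tauSeq, dir_timeInf_eq_zero α (by omega), mul_zero]
  have h1 := varSystem_iff_sum.1 h
  have hne : ∀ i < S.rInf - 2, ((S.rInf - 2 : ℕ) : ℂ) - i ≠ 0 := fun i hi =>
    sub_natCast_ne_zero hi
  have hlead : tauSeq (S.rInf - 1) (P.tInf x) 0 = 1 := by
    rw [tauSeq_zero_of_lead (by omega), tInf_lead (by omega)]
  have h2 : fderiv ℂ (fun y => QInf (L y) (S.rInf - 3 - 0)) x α = 0 := by
    have := h1 0 (by omega)
    simpa [h0, hlead, hne 0 (by omega), show S.rInf - 2 ≠ 0 by omega] using this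
  interval_cases i
  · exact h2
  · have h3 : fderiv ℂ (fun y => QInf (L y) (S.rInf - 3)) x α = 0 := h2
    have := h1 1 hi'
    simpa [Finset.sum_range_succ, h0, hlead, h3, div_eq_zero_iff,
      show ¬ ((S.rInf - 2 : ℕ) : ℂ) - 1 = 0 by simpa using hne 1 hi'] using this

/-- Once the first two unknowns are constant, their rows are trivial and their terms drop out of the
others, leaving size r_∞ - 4. -/
lemma infiniteSystem_iff (hR : 5 ≤ S.rInf)
    (h0 : ∀ x ∈ D, ∀ α, fderiv ℂ (fun y => QInf (L y) (S.rInf - 3)) x α = 0)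
    (h1 : ∀ x ∈ D, ∀ α, fderiv ℂ (fun y => QInf (L y) (S.rInf - 4)) x α = 0) :
    InfiniteSystem P D L ↔ ∀ x ∈ D, ∀ α, InfiniteVarSystem P L x α := by
  refine forall₂_congr fun x hx => ?_
  unfold InfiniteVarSystem
  rw [varSystem_forall_iff (P := P) (fun k => Param.timeInf k)
    fun i => fderiv ℂ (fun y => QInf (L y) (S.rInf - 3 - i)) x]
  have hinj : Function.Injective (fun k => Param.timeInf (n := S.n) k) := fun a b h => by
    injection h
  have hsingle : ∀ (p : P.vary) (j : ℕ), p.1 = Param.timeInf (S.rInf - 3 - j) →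
      j < S.rInf - 4 →
      (VarSystem (S.rInf - 2) (S.rInf - 2) (S.rInf - 1) (tauSeq (S.rInf - 1) (P.tInf x))
        (tauSeq (S.rInf - 1) fun k => P.dir (Pi.single p 1) (Param.timeInf k))
        (fun i => QInf (L x) (S.rInf - 3 - i))
        (fun i => fderiv ℂ (fun y => QInf (L y) (S.rInf - 3 - i)) x (Pi.single p 1)) ↔
      ∀ i < S.rInf - 4, ∑ k ∈ Finset.range (i + 1), P.tInf x (S.rInf - 1 - (i - k)) *
        (1 / ((S.rInf - 4 - k : ℕ) : ℂ)) * P.pd (fun y => QInf (L y) (S.rInf - 5 - k)) x p =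
        if j ≤ i then QInf (L x) (S.rInf - 3 - (i - j)) *
          (1 / ((S.rInf - 3 - j : ℕ) : ℂ)) else 0) := by
    intro p j hp hj
    obtain ⟨e1, e2⟩ := tauSeq_single hinj (e := S.rInf - 1) hp (by omega) (by omega)
    -- The leading varying time sits in coefficient 2 of τ, so rows and columns are both shifted by
    -- two.
    rw [show S.rInf - 1 - (S.rInf - 3 - j) = j + 2 by omega] at e1 e2
    rw [varSystem_single (P.tInf x) (by omega) (by omega) e1 e2]
    have hsum : ∀ i, ∑ k ∈ Finset.range (i + 2 + 1), P.tInf x (S.rInf - 1 - (i + 2 - k)) *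
        (1 / ((S.rInf - 2 - k : ℕ) : ℂ)) *
          fderiv ℂ (fun y => QInf (L y) (S.rInf - 3 - k)) x (Pi.single p 1) =
        ∑ k ∈ Finset.range (i + 1), P.tInf x (S.rInf - 1 - (i - k)) *
        (1 / ((S.rInf - 4 - k : ℕ) : ℂ)) * P.pd (fun y => QInf (L y) (S.rInf - 5 - k)) x p := by
      intro i
      rw [show i + 2 + 1 = i + 1 + 1 + 1 by omega, Finset.sum_range_succ' _ (i + 1 + 1),
        Finset.sum_range_succ' _ (i + 1)]
      have z0 := h0 x hx (Pi.single p 1)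
      have z1 := h1 x hx (Pi.single p 1)
      simp only [Nat.sub_zero, zero_add, show S.rInf - 3 - 1 = S.rInf - 4 by omega, z0, z1,
        mul_zero, add_zero]
      refine Finset.sum_congr rfl fun k _ => ?_
      rw [show i + 2 - (k + 1 + 1) = i - k by omega,
        show S.rInf - 2 - (k + 1 + 1) = S.rInf - 4 - k by omega,
        show S.rInf - 3 - (k + 1 + 1) = S.rInf - 5 - k by omega]
      rfl
    constructor
    · intro h i hi
      have := h (i + 2) (by omega)
      rw [hsum] at this
      rw [this, show i + 2 - (j + 2) = i - j by omega,
        show S.rInf - 1 - (j + 2) = S.rInf - 3 - j by omega]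
      simp only [add_le_add_iff_right]
    · intro h i hi
      match i with
      | 0 => simp [h0 x hx]
      | 1 =>
        rw [if_neg (by omega)]
        simp [Finset.sum_range_succ, h0 x hx, h1 x hx, show S.rInf - 3 - 1 = S.rInf - 4 by omega]
      | i + 2 =>
        rw [hsum, h i (by omega), show i + 2 - (j + 2) = i - j by omega,
          show S.rInf - 1 - (j + 2) = S.rInf - 3 - j by omega]
        simp only [add_le_add_iff_right]
  -- The time t_{∞,1} belongs here: it is coefficient r_∞ - 2 of τ, just beyond the truncation.
  have hother : ∀ p : P.vary, (∀ k, 2 ≤ k → p.1 ≠ Param.timeInf k) →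
      (VarSystem (S.rInf - 2) (S.rInf - 2) (S.rInf - 1) (tauSeq (S.rInf - 1) (P.tInf x))
        (tauSeq (S.rInf - 1) fun k => P.dir (Pi.single p 1) (Param.timeInf k))
        (fun i => QInf (L x) (S.rInf - 3 - i))
        (fun i => fderiv ℂ (fun y => QInf (L y) (S.rInf - 3 - i)) x (Pi.single p 1)) ↔
      ∀ i < S.rInf - 4, P.pd (fun y => QInf (L y) (S.rInf - 5 - i)) x p = 0) := by
    intro p hp
    rw [varSystem_iff_eq_zero (fun _ => by
      rw [tauSeq_zero_of_lead (by omega), tInf_lead (by omega)]; exact one_ne_zero)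
      fun i hi => tauSeq_single_of_ne _ (hp _ (by omega))]
    constructor
    · intro h i hi
      have := h (i + 2) (by omega)
      rwa [show S.rInf - 3 - (i + 2) = S.rInf - 5 - i by omega] at this
    · intro h i hi
      match i with
      | 0 => exact h0 x hx _
      | 1 => exact h1 x hx _
      | i + 2 =>
        have := h i (by omega)
        rwa [show S.rInf - 3 - (i + 2) = S.rInf - 5 - i by omega]
  have hvec : ∀ (j : Fin (S.rInf - 4)) (p : P.vary),
      ((toeplitz (S.rInf - 4) (fun d => P.tInf x (S.rInf - 1 - d)) *
          invDiagonal (S.rInf - 4) (S.rInf - 4)) *ᵥ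
        (fun i => P.pd (fun y => QInf (L y) (S.rInf - 5 - i)) x p) =
      fun i => (toeplitz (S.rInf - 4) (fun d => QInf (L x) (S.rInf - 3 - d)) *
          invDiagonal (S.rInf - 4) (S.rInf - 3)) i j) ↔
      ∀ i < S.rInf - 4, ∑ k ∈ Finset.range (i + 1), P.tInf x (S.rInf - 1 - (i - k)) *
        (1 / ((S.rInf - 4 - k : ℕ) : ℂ)) * P.pd (fun y => QInf (L y) (S.rInf - 5 - k)) x p =
        if (j : ℕ) ≤ i then QInf (L x) (S.rInf - 3 - (i - j)) *
          (1 / ((S.rInf - 3 - j : ℕ) : ℂ)) else 0 := by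
    intro j p
    rw [funext_iff, Fin.forall_iff]
    refine forall₂_congr fun i hi => ?_
    rw [toeplitz_mul_apply, toeplitz_mulVec (S.rInf - 4) (S.rInf - 4)
      (fun d => P.tInf x (S.rInf - 1 - d))
      (fun i => P.pd (fun y => QInf (L y) (S.rInf - 5 - i)) x p)]
  constructor
  · rintro ⟨g1, g2⟩ p
    by_cases hp : ∃ k, 2 ≤ k ∧ p.1 = Param.timeInf k
    · obtain ⟨k, hk2, hk⟩ := hp
      have hk' := P.timeInf_mem k (hk ▸ p.2)
      have hpj : p.1 = Param.timeInf (S.rInf - 3 - (S.rInf - 3 - k)) := by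
        rw [show S.rInf - 3 - (S.rInf - 3 - k) = k by omega, hk]
      have := g1 ⟨S.rInf - 3 - k, by omega⟩ (hpj ▸ p.2)
      rw [hsingle p _ hpj (by omega)]
      rw [hvec] at this
      have hpe : (⟨Param.timeInf (S.rInf - 3 - (S.rInf - 3 - k)), hpj ▸ p.2⟩ : P.vary) = p :=
        Subtype.ext hpj.symm
      simp only [hpe] at this
      exact this
    · push Not at hp
      exact (hother p hp).2 fun i hi => g2 p hp ⟨i, hi⟩
  · intro h
    refine ⟨fun j hj => (hvec j _).2 ((hsingle ⟨_, hj⟩ j rfl j.isLt).1 (h ⟨_, hj⟩)),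
      fun p hp i => (hother p hp).1 (h p) i i.isLt⟩

end

/-! ### Explicit entries of the matrices F. -/

-- Both series solve the equation of exponent 1 with the same constant term, so `eq_zero_of_ode`
-- identifies them. This is why the first column of the finite matrix consists of the times.
open PowerSeries in
lemma powCoeff_one {w : ℂ} {τ : ℕ → ℂ} (hw : w = τ 0) (h : τ 0 ≠ 0) (n : ℕ) :
    powCoeff 1 w τ n = τ n := by
  have hode := powCoeff_ode 1 w h
  have hE : PowerSeries.mk (powCoeff 1 w τ) - PowerSeries.mk τ = 0 := by
    refine eq_zero_of_ode (τ := PowerSeries.mk τ) 1 (by simpa using h)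
      (by simp [powCoeff_zero, hw]) ?_
    rw [map_sub]
    rw [map_one] at hode ⊢
    linear_combination hode
  have := congrArg (coeff n) hE
  rw [map_sub, coeff_mk, coeff_mk, map_zero, sub_eq_zero] at this
  exact this

lemma powCoeff_at_one (a w : ℂ) (τ : ℕ → ℂ) : powCoeff a w τ 1 = a * τ 1 * w / τ 0 := by
  rw [show 1 = 0 + 1 from rfl, powCoeff_succ]
  simp [powCoeff_zero]

lemma powCoeff_at_two (a : ℂ) {τ : ℕ → ℂ} (h0 : τ 0 = 1) (h1 : τ 1 = 0) :
    powCoeff a 1 τ 2 = a * τ 2 := by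
  rw [show 2 = 1 + 1 from rfl, powCoeff_succ, Finset.sum_range_succ, Finset.sum_range_succ,
    Finset.sum_range_zero, Nat.sub_self, powCoeff_zero]
  simp [h0, h1]
  field_simp

lemma powCoeff_at_three (a : ℂ) {τ : ℕ → ℂ} (h0 : τ 0 = 1) (h1 : τ 1 = 0) :
    powCoeff a 1 τ 3 = a * τ 3 := by
  rw [show 3 = 2 + 1 from rfl, powCoeff_succ, Finset.sum_range_succ, Finset.sum_range_succ,
    Finset.sum_range_succ, Finset.sum_range_zero, Nat.sub_self, powCoeff_zero,
    show 2 - 1 = 1 from rfl, powCoeff_at_one]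
  simp [h0, h1]
  field_simp

lemma powEntry_self {N e i : ℕ} (hi : i < N) (ρ : ℂ) (τ : ℕ → ℂ) :
    powEntry N e ρ τ i i = ρ ^ (N - i) := by
  rw [powEntry, if_pos le_rfl, Nat.sub_self, powCoeff_zero, div_self (sub_natCast_ne_zero hi),
    one_mul]

/-- The matrix `F^{(X)}` of size `m`. -/
def finiteCoeff (m : ℕ) (ρ : ℂ) (t : ℕ → ℂ) : Matrix (Fin m) (Fin m) ℂ :=
  Matrix.of fun i j => powEntry m m ρ (tauSeq m t) i j

/-- The power series of the primitive of the singular part at infinity, normalized by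
`t_{∞,r_∞-1} = 1` and `t_{∞,r_∞-2} = 0`. -/
def tauInf (R : ℕ) (t : ℕ → ℂ) (i : ℕ) : ℂ :=
  if i = 0 then 1 else if i = 1 then 0 else tauSeq (R - 1) t i

/-- The matrix `F^{(∞)}` of size `R - 2`. -/
def infiniteCoeff (R : ℕ) (t : ℕ → ℂ) : Matrix (Fin (R - 2)) (Fin (R - 2)) ℂ :=
  Matrix.of fun i j => powEntry (R - 2) (R - 1) 1 (tauInf R t) i j

lemma powEntry_congr {N e : ℕ} (ρ : ℂ) {τ τ' : ℕ → ℂ} {i j : ℕ} (h : ∀ k ≤ i - j, τ k = τ' k) :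
    powEntry N e ρ τ i j = powEntry N e ρ τ' i j := by
  rw [powEntry, powEntry, powCoeff_congr _ _ _ h]

lemma isFiniteCoeff_finiteCoeff : IsFiniteCoeff finiteCoeff where
  lower m ρ t i j hij := if_neg (by simpa using hij)
  depends m ρ t t' i j hij h := by
    refine powEntry_congr ρ fun k hk => ?_
    rw [tauSeq, tauSeq, h (m - k) (by omega) (by omega)]
  diag m ρ t j _ _ := powEntry_self j.isLt ρ _
  subdiag m ρ t i j hρ hρt hij := by
    have hi := i.isLt
    have h1 : (m : ℂ) ≠ 0 := by exact_mod_cast (by omega : m ≠ 0)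
    have h2 : (m : ℂ) - (j : ℕ) ≠ 0 := sub_natCast_ne_zero j.isLt
    have h3 : (m : ℂ) - 1 ≠ 0 := by exact_mod_cast sub_natCast_ne_zero (i := 1) (N := m) (by omega)
    -- The factor ρ^m = t_m cancels the division by τ₀ in the first coefficient of the power.
    have hp : ρ ^ (m - (j : ℕ)) = ρ ^ m * ρ ^ (-((j : ℕ) : ℤ)) := by
      rw [_root_.zpow_neg, zpow_natCast, eq_mul_inv_iff_mul_eq₀ (pow_ne_zero _ hρ), ← pow_add]
      congr 1; omega
    have ht : t m ≠ 0 := hρt ▸ pow_ne_zero _ hρ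
    rw [finiteCoeff, Matrix.of_apply, powEntry, if_pos (by omega), show (i : ℕ) - j = 1 by omega,
      powCoeff_at_one, hp, hρt, tauSeq_zero_of_lead (by omega), tauSeq, hij,
      Nat.cast_sub (by omega)]
    push_cast
    field_simp
    ring
  first m ρ t i j hρ hρt hj := by
    have hi := i.isLt
    have h1 : (m : ℂ) ≠ 0 := by exact_mod_cast (by omega : m ≠ 0)
    have h2 : (m : ℂ) - (i : ℕ) ≠ 0 := sub_natCast_ne_zero hi
    have ht : t m ≠ 0 := hρt ▸ pow_ne_zero _ hρ
    have h0 : tauSeq m t 0 = t m := tauSeq_zero_of_lead (by omega) t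
    rw [finiteCoeff, Matrix.of_apply, powEntry, hj, if_pos (Nat.zero_le _), Nat.cast_zero, sub_zero,
      div_self h1, Nat.sub_zero, Nat.sub_zero, hρt, powCoeff_one h0.symm (by rwa [h0]), tauSeq,
      Nat.cast_sub hi.le]
    field_simp

lemma isInfiniteCoeff_infiniteCoeff : IsInfiniteCoeff infiniteCoeff where
  lower R t i j hij := if_neg (by simpa using hij)
  depends R t t' i j hij h := by
    refine powEntry_congr _ fun k hk => ?_
    have hi := i.isLt
    -- The values 1 and 0 in degrees 0 and 1 are built in, so the entries never read the two leading
    -- times, even for an arbitrary sequence t.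
    unfold tauInf
    split_ifs
    · rfl
    · rfl
    · rw [tauSeq, tauSeq, h (R - 1 - k) (by omega) (by omega)]
  diag R t j := by
    rw [infiniteCoeff, Matrix.of_apply, powEntry_self j.isLt, one_pow]
  subdiag R t i j hij := by
    rw [infiniteCoeff, Matrix.of_apply, powEntry, if_pos (by omega),
      show (i : ℕ) - j = 1 by omega, powCoeff_at_one]
    simp [tauInf]
  subdiag2 R t i j hij := by
    have hi := i.isLt
    have h1 : (R : ℂ) - 2 - (j : ℕ) ≠ 0 := by
      have := sub_natCast_ne_zero j.isLt
      rwa [Nat.cast_sub (by omega)] at this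
    have h2 : (R : ℂ) - 1 ≠ 0 := by exact_mod_cast sub_natCast_ne_zero (i := 1) (N := R) (by omega)
    have h3 : (R : ℂ) - 3 ≠ 0 := by exact_mod_cast sub_natCast_ne_zero (i := 3) (N := R) (by omega)
    rw [infiniteCoeff, Matrix.of_apply, powEntry, if_pos (by omega),
      show (i : ℕ) - j = 2 by omega, one_pow, powCoeff_at_two _ rfl rfl,
      show tauInf R t 2 = tauSeq (R - 1) t 2 from rfl, tauSeq, hij,
      show R - 1 - 2 = R - 3 by omega, Nat.cast_sub (by omega), Nat.cast_sub (by omega),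
      Nat.cast_sub (by omega)]
    push_cast
    field_simp
    ring
  subdiag3 R t i j hij := by
    have hi := i.isLt
    have h1 : (R : ℂ) - 2 - (j : ℕ) ≠ 0 := by
      have := sub_natCast_ne_zero j.isLt
      rwa [Nat.cast_sub (by omega)] at this
    have h2 : (R : ℂ) - 1 ≠ 0 := by exact_mod_cast sub_natCast_ne_zero (i := 1) (N := R) (by omega)
    have h3 : (R : ℂ) - 4 ≠ 0 := by exact_mod_cast sub_natCast_ne_zero (i := 4) (N := R) (by omega)
    rw [infiniteCoeff, Matrix.of_apply, powEntry, if_pos (by omega),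
      show (i : ℕ) - j = 3 by omega, one_pow, powCoeff_at_three _ rfl rfl,
      show tauInf R t 3 = tauSeq (R - 1) t 3 from rfl, tauSeq, hij,
      show R - 1 - 3 = R - 4 by omega, Nat.cast_sub (by omega), Nat.cast_sub (by omega),
      Nat.cast_sub (by omega)]
    push_cast
    field_simp
    ring

/-! ### Assembly of the local systems and their solutions. -/

lemma exists_const_iff {E : Type*} [NormedAddCommGroup E] [NormedSpace ℂ E] {D : Set E}
    (hD : IsOpen D) (hc : IsConnected D) {f : E → ℂ} (hf : DifferentiableOn ℂ f D) :
    (∃ u : ℂ, ∀ x ∈ D, f x = u) ↔ ∀ x ∈ D, ∀ α, fderiv ℂ f x α = 0 := by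
  constructor
  · rintro ⟨u, hu⟩ x hx α
    have : f =ᶠ[𝓝 x] fun _ => u := by
      filter_upwards [hD.mem_nhds hx] with y hy using hu y hy
    rw [this.fderiv_eq]; simp
  · intro h
    obtain ⟨x₀, hx₀⟩ := hc.nonempty
    refine ⟨f x₀, fun x hx => hD.is_const_of_fderiv_eq_zero hc.isPreconnected hf ?_ hx hx₀⟩
    intro y hy
    ext α
    exact h y hy α

section
variable {S : PoleType} {P : Deformation S} {D : Set P.Space} {L : P.Space → Coeffs S.n}

lemma IsLax.lead_entry {x : P.Space} {C : Coeffs S.n} (h : IsLax P x C) (hR : 2 ≤ S.rInf) :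
    C.inf (S.rInf - 1) 0 1 = 0 := by
  rw [h.lead hR]; simp [sigma3]

lemma IsAux.inf_lead {x α : P.Space} {C A : Coeffs S.n} (h : IsAux P x α C A) :
    A.inf S.rInf 0 1 = 0 := by
  obtain ⟨G, hG, c, hA⟩ := h.2
  have hG1 : (G 0).det ≠ 0 := by rw [hG.2.1]; simp
  obtain ⟨H, hH, hH0⟩ := exists_isTaylor (analyticAt_gaugeEntry hG.1 hG1)
  simp only [zero_add] at hH
  have hH0' : PowerSeries.constantCoeff H = 0 := by
    rw [hH0, gaugeEntry, hG.2.1]; simp [sigma3]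
  have := PowerSeries.X_pow_dvd_iff.1 (aux_relation_inf hH hA) 0 S.rInf_pos
  simpa [hH0', Nat.sub_add_cancel S.rInf_pos] using this

/-- The linear system at `X_s` in the direction `α`. -/
def FiniteVarSystem (P : Deformation S) (L : P.Space → Coeffs S.n) (s : Fin S.n)
    (x α : P.Space) : Prop :=
  VarSystem (S.r s - 1) (S.r s - 1) (S.r s - 1)
    (tauSeq (S.r s - 1) (P.t x s)) (tauSeq (S.r s - 1) fun k => P.dir α (Param.time s k))
    (fun i => Q (L x) s (S.r s - i))
    (fun i => fderiv ℂ (fun y => Q (L y) s (S.r s - i)) x α)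

/-- The isospectral condition is the conjunction of the linear systems at the poles. -/
lemma isospectral12_iff_systems (hD : IsOpen D) (hadm : ∀ x ∈ D, P.Admissible x)
    (hL : IsLaxFamily P D L) {A : P.Space → P.Space → Coeffs S.n}
    (hA : ∀ x ∈ D, ∀ α, IsAux P x α (L x) (A α x)) :
    Isospectral12 P D L A ↔
      (∀ s, (∀ x ∈ D, ∀ α, fderiv ℂ (fun y => Q (L y) s 1) x α = 0) ∧
        ∀ x ∈ D, ∀ α, FiniteVarSystem P L s x α) ∧
      (3 ≤ S.rInf → ∀ x ∈ D, ∀ α, InfiniteVarSystem P L x α) := by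
  have hlead : ∀ x ∈ D, ∀ α, 2 ≤ S.rInf →
      fderiv ℂ (fun y => (L y).inf (S.rInf - 2 + 1) 0 1) x α = 0 := by
    intro x hx α hR
    have : (fun y => (L y).inf (S.rInf - 2 + 1) 0 1) =ᶠ[𝓝 x] fun _ => 0 := by
      filter_upwards [hD.mem_nhds hx] with y hy
      rw [show S.rInf - 2 + 1 = S.rInf - 1 by omega, (hL.lax y hy).lead_entry hR]
    rw [this.fderiv_eq]; simp
  have hinf : ∀ x ∈ D, ∀ α, (∀ k < S.rInf - 1, fderiv ℂ (fun y => (L y).inf (k + 1) 0 1) x α =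
      ((k : ℂ) + 1) * (A α x).inf (k + 1 + 1) 0 1) ↔
      (3 ≤ S.rInf → InfiniteVarSystem P L x α) := by
    intro x hx α
    by_cases hR : 3 ≤ S.rInf
    · simp only [hR, forall_true_left]
      exact infinite_pole_iff hR (hA x hx α)
        (fun k => fderiv ℂ (fun y => (L y).inf (k + 1) 0 1) x α) (hlead x hx α (by omega))
    -- For r_∞ ≤ 2 the only possible equation has r_∞ = 2, k = 0. Both sides vanish: the leading Lax
    -- coefficient is diagonal, and so is that of the auxiliary matrix in the entry (1,2).
    · refine iff_of_true (fun k hk => ?_) fun h => absurd h hR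
      have h1 := hlead x hx α (by omega)
      have h2 := (hA x hx α).inf_lead
      obtain rfl : k = 0 := by omega
      rw [show S.rInf - 2 = 0 by omega] at h1
      rw [show S.rInf = 0 + 1 + 1 by omega] at h2
      rw [h1, h2, mul_zero]
  have hfin : ∀ x ∈ D, ∀ α s, (∀ k < S.r s + 1,
      (if k < S.r s then fderiv ℂ (fun y => (L y).fin s k 0 1) x α else 0) +
          k * (P.dir α (Param.pos s) * (L x).fin s (k - 1) 0 1) =
        -(k * (A α x).fin s (k - 1) 0 1)) ↔
      fderiv ℂ (fun y => Q (L y) s 1) x α = 0 ∧ FiniteVarSystem P L s x α := by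
    intro x hx α s
    rw [finite_pole_iff (hadm x hx) (hA x hx α) s
      (fun k => fderiv ℂ (fun y => (L y).fin s k 0 1) x α)]
    unfold FiniteVarSystem Q
    simp only [Nat.sub_right_comm _ 1]
  rw [isospectral12_iff_coeff hD hadm hL A]
  constructor
  · intro h
    exact ⟨fun s => ⟨fun x hx α => ((hfin x hx α s).1 ((h x hx α).2 s)).1,
      fun x hx α => ((hfin x hx α s).1 ((h x hx α).2 s)).2⟩,
      fun hR x hx α => (hinf x hx α).1 (h x hx α).1 hR⟩
  · rintro ⟨h1, h2⟩ x hx α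
    exact ⟨(hinf x hx α).2 fun hR => h2 hR x hx α,
      fun s => (hfin x hx α s).2 ⟨(h1 s).1 x hx α, (h1 s).2 x hx α⟩⟩

lemma omega_eq_QInf (hR : 3 ≤ S.rInf) (x : P.Space) (C : Coeffs S.n) :
    omega P x C = QInf C (S.rInf - 3) := by
  rw [omega, if_neg (by omega), if_neg (by omega)]

lemma IsLaxFamily.differentiableOn_QInf (hL : IsLaxFamily P D L) {k : ℕ} (hk : k + 3 ≤ S.rInf) :
    DifferentiableOn ℂ (fun y => QInf (L y) k) D :=
  hL.differentiableOn_inf (by omega)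

lemma IsLaxFamily.differentiableOn_Q (hL : IsLaxFamily P D L) {s : Fin S.n} {k : ℕ}
    (hk : k ≤ S.r s) : DifferentiableOn ℂ (fun y => Q (L y) s k) D :=
  hL.differentiableOn_fin (by have := S.r_pos s; omega)

/-- For r_∞ = 2, ω is the sum of the residues, so it is constant by `hres`. For r_∞ ≥ 3, the first
two rows give the constancy of ω and of Q_{∞,r_∞-4}; as ω ≠ 0, the latter is ω times a constant. -/
lemma infinite_systems_iff (hD : IsOpen D) (hc : IsConnected D) (hL : IsLaxFamily P D L)
    (hres : ∀ s, ∃ u : ℂ, ∀ x ∈ D, Q (L x) s 1 = u) :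
    (3 ≤ S.rInf → ∀ x ∈ D, ∀ α, InfiniteVarSystem P L x α) ↔
      (2 ≤ S.rInf → ∃ w : ℂ, ∀ x ∈ D, omega P x (L x) = w) ∧
      (4 ≤ S.rInf → ∃ u : ℂ, ∀ x ∈ D, QInf (L x) (S.rInf - 4) = omega P x (L x) * u) ∧
      (5 ≤ S.rInf → InfiniteSystem P D L) := by
  by_cases hR3 : 3 ≤ S.rInf
  swap
  · refine iff_of_true (fun h => absurd h hR3) ⟨fun h2 => ?_, fun h => by omega, fun h => by omega⟩
    choose u hu using hres
    refine ⟨∑ s, u s, fun x hx => ?_⟩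
    rw [omega, if_neg (by omega), if_pos (by omega)]
    exact Finset.sum_congr rfl fun s _ => hu s x hx
  have hω : (∃ w : ℂ, ∀ x ∈ D, omega P x (L x) = w) ↔
      ∀ x ∈ D, ∀ α, fderiv ℂ (fun y => QInf (L y) (S.rInf - 3)) x α = 0 := by
    rw [← exists_const_iff hD hc (hL.differentiableOn_QInf (by omega))]
    simp only [omega_eq_QInf hR3]
  have hω0 : ∀ x ∈ D, omega P x (L x) ≠ 0 := fun x hx => (hL.lax x hx).omega_ne
  have hsub : 4 ≤ S.rInf → (∃ w : ℂ, ∀ x ∈ D, omega P x (L x) = w) →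
      ((∃ u : ℂ, ∀ x ∈ D, QInf (L x) (S.rInf - 4) = omega P x (L x) * u) ↔
      ∀ x ∈ D, ∀ α, fderiv ℂ (fun y => QInf (L y) (S.rInf - 4)) x α = 0) := by
    rintro h4 ⟨w, hw⟩
    rw [← exists_const_iff hD hc (hL.differentiableOn_QInf (by omega))]
    constructor
    · rintro ⟨u, hu⟩
      exact ⟨w * u, fun x hx => by rw [hu x hx, hw x hx]⟩
    · rintro ⟨u, hu⟩
      exact ⟨u / w, fun x hx => by
        rw [hu x hx, hw x hx, mul_div_cancel₀]
        rw [← hw x hx]; exact hω0 x hx⟩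
  simp only [hR3, forall_true_left, show 2 ≤ S.rInf by omega]
  constructor
  · intro h
    have h0 : ∀ x ∈ D, ∀ α, fderiv ℂ (fun y => QInf (L y) (S.rInf - 3)) x α = 0 :=
      fun x hx α => (h x hx α).fderiv_eq_zero hR3 (i := 0) (by omega) (by omega)
    have h1 : 4 ≤ S.rInf → ∀ x ∈ D, ∀ α, fderiv ℂ (fun y => QInf (L y) (S.rInf - 4)) x α = 0 :=
      fun h4 x hx α => (h x hx α).fderiv_eq_zero hR3 (i := 1) (by omega) (by omega)
    exact ⟨hω.2 h0, fun h4 => (hsub h4 (hω.2 h0)).2 (h1 h4),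
      fun h5 => (infiniteSystem_iff h5 h0 (h1 (by omega))).2 h⟩
  · rintro ⟨h0, h1, h2⟩
    by_cases h5 : 5 ≤ S.rInf
    · exact (infiniteSystem_iff h5 (hω.1 h0) ((hsub (by omega) h0).1 (h1 (by omega)))).1 (h2 h5)
    -- For r_∞ = 3 or 4 no varying time occurs in τ below degree r_∞ - 2, so the system only says
    -- that the one or two unknowns are constant.
    · intro x hx α
      refine (varSystem_iff_eq_zero (fun _ => ?_) fun i hi => ?_).2 fun i hi => ?_
      · rw [tauSeq_zero_of_lead (by omega), tInf_lead (by omega)]; exact one_ne_zero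
      · rw [tauSeq, dir_timeInf_eq_zero α (by omega), mul_zero]
      · match i with
        | 0 => exact hω.1 h0 x hx α
        | 1 => exact (hsub (by omega) h0).1 (h1 (by omega)) x hx α
        | i + 2 => omega

lemma differentiable_tauSeq (e : ℕ) (par : ℕ → Param S.n) (n : ℕ) :
    Differentiable ℂ fun x : P.Space => tauSeq e (fun k => P.value x (par k)) n :=
  (differentiable_value _).const_mul _

lemma fderiv_tauSeq (e : ℕ) (par : ℕ → Param S.n) (x α : P.Space) :
    (fun n => fderiv ℂ (fun x : P.Space => tauSeq e (fun k => P.value x (par k)) n) x α) =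
      tauSeq e fun k => P.dir α (par k) := by
  ext n
  simp only [tauSeq]
  rw [fderiv_const_mul (differentiable_value _ x), _root_.smul_apply, fderiv_value,
    smul_eq_mul]

lemma finite_solution_iff (hD : IsOpen D) (hc : IsConnected D)
    (hadm : ∀ x ∈ D, P.Admissible x) (hL : IsLaxFamily P D L) {ρ : Fin S.n → P.Space → ℂ}
    (hρ : IsRootBranch P D ρ) (s : Fin S.n) :
    (∀ x ∈ D, ∀ α, FiniteVarSystem P L s x α) ↔
      ∃ v : ℕ → ℂ, ∀ x ∈ D, ∀ i : Fin (S.r s - 1), Q (L x) s (S.r s - i) =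
        ∑ j : Fin (S.r s - 1), finiteCoeff (S.r s - 1) (ρ s x) (P.t x s) i j * v j := by
  rcases Nat.lt_or_ge (S.r s) 2 with hr | hr
  · refine iff_of_true (fun x hx α => ?_) ⟨0, fun x hx i => absurd i.isLt (by omega)⟩
    rw [FiniteVarSystem, varSystem_iff_sum]
    intro i hi; omega
  obtain ⟨hρd, hρ⟩ := hρ s hr
  have h0 : ∀ x ∈ D, ρ s x ≠ 0 := fun x hx h => by
    have := hρ x hx
    rw [h, zero_pow (by omega)] at this
    exact (hadm x hx).2 s hr this.symm
  have key := varSystem_iff_exists_const (N := S.r s - 1) (e := S.r s - 1) hD hc.isPreconnected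
    (by omega) (τ := fun n x => tauSeq (S.r s - 1) (fun k => P.value x (Param.time s k)) n)
    (q := fun i x => Q (L x) s (S.r s - i)) (ρ := ρ s)
    (fun n => (differentiable_tauSeq _ _ n).differentiableOn) hρd
    (fun i hi => hL.differentiableOn_Q (by omega)) h0
    (fun x hx => by rw [tauSeq_zero_of_lead (by omega), hρ x hx]; rfl)
  simp only [fderiv_tauSeq] at key
  refine key.trans (exists_congr fun v => forall₂_congr fun x hx => ?_)
  rw [Fin.forall_iff]
  refine forall₂_congr fun i hi => ?_
  rw [← Fin.sum_univ_eq_sum_range (fun j => powEntry (S.r s - 1) (S.r s - 1) (ρ s x)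
    (fun n => tauSeq (S.r s - 1) (fun k => P.value x (Param.time s k)) n) i j * v j)]
  rfl

lemma tauInf_eq_tauSeq (hR : 3 ≤ S.rInf) (x : P.Space) :
    tauInf S.rInf (P.tInf x) = tauSeq (S.rInf - 1) (P.tInf x) := by
  ext i
  unfold tauInf
  split_ifs with h0 h1
  · rw [h0, tauSeq_zero_of_lead (by omega), tInf_lead (by omega)]
  · rw [h1, tauSeq, show S.rInf - 1 - 1 = S.rInf - 2 by omega, tInf_sublead hR, mul_zero]
  · rfl

/-- The leading coefficient of τ is 1, so the root ρ = 1 can be used globally. The first row, with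
diagonal entry 1, identifies the leading constant with ω, and the other constants are divided by it.
-/
lemma infinite_solution_iff (hD : IsOpen D) (hc : IsConnected D) (hL : IsLaxFamily P D L)
    (hR : 4 ≤ S.rInf) {w : ℂ} (hw : ∀ x ∈ D, omega P x (L x) = w) :
    (∀ x ∈ D, ∀ α, InfiniteVarSystem P L x α) ↔
      ∃ u : ℕ → ℂ, ∀ x ∈ D, ∀ i : Fin (S.rInf - 2), QInf (L x) (S.rInf - 3 - i) =
        omega P x (L x) * ∑ j : Fin (S.rInf - 2), infiniteCoeff S.rInf (P.tInf x) i j *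
          (if (j : ℕ) = 0 then 1 else u (S.rInf - 3 - j)) := by
  obtain ⟨x₀, hx₀⟩ := hc.nonempty
  have hw0 : w ≠ 0 := hw x₀ hx₀ ▸ (hL.lax x₀ hx₀).omega_ne
  have key := varSystem_iff_exists_const (N := S.rInf - 2) (e := S.rInf - 1) hD hc.isPreconnected
    (by omega) (τ := fun n x => tauSeq (S.rInf - 1) (fun k => P.value x (Param.timeInf k)) n)
    (q := fun i x => QInf (L x) (S.rInf - 3 - i)) (ρ := fun _ => 1)
    (fun n => (differentiable_tauSeq _ _ n).differentiableOn) (differentiableOn_const _)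
    (fun i hi => hL.differentiableOn_QInf (by omega)) (fun _ _ => one_ne_zero)
    (fun x hx => by
      rw [tauSeq_zero_of_lead (by omega), one_pow]; exact tInf_lead (by omega) x)
  simp only [fderiv_tauSeq] at key
  have key' : (∀ x ∈ D, ∀ α, InfiniteVarSystem P L x α) ↔ ∃ v : ℕ → ℂ, ∀ x ∈ D,
      ∀ i : Fin (S.rInf - 2), QInf (L x) (S.rInf - 3 - i) =
        ∑ j : Fin (S.rInf - 2), infiniteCoeff S.rInf (P.tInf x) i j * v j := by
    refine key.trans (exists_congr fun v => forall₂_congr fun x hx => ?_)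
    rw [Fin.forall_iff]
    refine forall₂_congr fun i hi => ?_
    rw [← Fin.sum_univ_eq_sum_range (fun j => powEntry (S.rInf - 2) (S.rInf - 1) 1
      (fun n => tauSeq (S.rInf - 1) (fun k => P.value x (Param.timeInf k)) n) i j * v j)]
    simp only [infiniteCoeff, tauInf_eq_tauSeq (show 3 ≤ S.rInf by omega), Matrix.of_apply]
    rfl
  rw [key']
  constructor
  · rintro ⟨v, hv⟩
    have hv0 : v 0 = w := by
      have := hv x₀ hx₀ ⟨0, by omega⟩
      rw [Finset.sum_eq_single (⟨0, by omega⟩ : Fin (S.rInf - 2)) (fun j _ hj => by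
        rw [isInfiniteCoeff_infiniteCoeff.lower _ _ _ _ (Nat.pos_of_ne_zero fun h =>
          hj (Fin.ext h)), zero_mul]) (by simp), isInfiniteCoeff_infiniteCoeff.diag, one_mul] at this
      rw [← hw x₀ hx₀, omega_eq_QInf (by omega)]
      exact this.symm
    refine ⟨fun k => v (S.rInf - 3 - k) / w, fun x hx i => ?_⟩
    rw [hv x hx i, hw x hx, Finset.mul_sum]
    refine Finset.sum_congr rfl fun j _ => ?_
    split_ifs with hj
    · rw [hj, hv0]; ring
    · have := j.isLt
      simp only [show S.rInf - 3 - (S.rInf - 3 - (j : ℕ)) = j by omega]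
      field_simp
  · rintro ⟨u, hu⟩
    refine ⟨fun j => w * (if j = 0 then 1 else u (S.rInf - 3 - j)), fun x hx i => ?_⟩
    rw [hu x hx i, hw x hx, Finset.mul_sum]
    exact Finset.sum_congr rfl fun j _ => by ring

end

end GeometricLax

end

open GeometricLax
theorem theorem5p3 :
    ∃ (fX : (m : ℕ) → ℂ → (ℕ → ℂ) → Matrix (Fin m) (Fin m) ℂ)
      (fInf : (R : ℕ) → (ℕ → ℂ) → Matrix (Fin (R - 2)) (Fin (R - 2)) ℂ),
      IsFiniteCoeff fX ∧ IsInfiniteCoeff fInf ∧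
      ∀ (S : PoleType) (P : Deformation S) (D : Set P.Space), IsOpen D → IsConnected D →
      (∀ x ∈ D, P.Admissible x) →
      ∀ (L : P.Space → Coeffs S.n) (A : P.Space → P.Space → Coeffs S.n),
      IsLaxFamily P D L → (∀ x ∈ D, ∀ α, IsAux P x α (L x) (A α x)) →
      -- equivalence with the differential systems
      (Isospectral12 P D L A ↔
        (∀ s, (∃ u : ℂ, ∀ x ∈ D, Q (L x) s 1 = u) ∧ FiniteSystem P D L s) ∧
        (2 ≤ S.rInf → ∃ w : ℂ, ∀ x ∈ D, omega P x (L x) = w) ∧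
        (4 ≤ S.rInf → ∃ u : ℂ, ∀ x ∈ D, QInf (L x) (S.rInf - 4) = omega P x (L x) * u) ∧
        (5 ≤ S.rInf → InfiniteSystem P D L)) ∧
      -- equivalence with the explicit form of the solutions
      ∀ ρ : Fin S.n → P.Space → ℂ, IsRootBranch P D ρ →
        (Isospectral12 P D L A ↔
          ∃ (u : Fin S.n → ℕ → ℂ) (uInf : ℕ → ℂ),
            (∀ s, ∀ x ∈ D, Q (L x) s 1 = u s 1) ∧
            (∀ s, ∀ x ∈ D, ∀ i : Fin (S.r s - 1), Q (L x) s (S.r s - i) =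
              ∑ j : Fin (S.r s - 1), fX (S.r s - 1) (ρ s x) (P.t x s) i j * u s (S.r s - j)) ∧
            (2 ≤ S.rInf → ∃ w : ℂ, ∀ x ∈ D, omega P x (L x) = w) ∧
            (4 ≤ S.rInf → ∀ x ∈ D, ∀ i : Fin (S.rInf - 2), QInf (L x) (S.rInf - 3 - i) =
              omega P x (L x) * ∑ j : Fin (S.rInf - 2), fInf S.rInf (P.tInf x) i j *
                (if (j : ℕ) = 0 then 1 else uInf (S.rInf - 3 - j))) ∧
            (S.rInf = 2 → ∀ x ∈ D, omega P x (L x) = ∑ s, u s 1) ∧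
            (S.rInf = 1 → ∑ s, u s 1 = 0 ∧ ∀ x ∈ D, omega P x (L x) =
              ∑ s, P.X x s * u s 1 +
              ∑ s, ∑ j : Fin (S.r s - 1),
                fX (S.r s - 1) (ρ s x) (P.t x s) ⟨S.r s - 2, by have := j.isLt; omega⟩ j *
                  u s (S.r s - j))) := by
  refine ⟨finiteCoeff, infiniteCoeff, isFiniteCoeff_finiteCoeff, isInfiniteCoeff_infiniteCoeff,
    fun S P D hD hc hadm L A hL hA => ?_⟩
  have hiso := isospectral12_iff_systems hD hadm hL hA
  have hconst : ∀ s, (∃ u : ℂ, ∀ x ∈ D, Q (L x) s 1 = u) ↔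
      ∀ x ∈ D, ∀ α, fderiv ℂ (fun y => Q (L y) s 1) x α = 0 := fun s =>
    exists_const_iff hD hc (hL.differentiableOn_Q (S.r_pos s))
  have hinf := infinite_systems_iff hD hc hL
  refine ⟨?_, fun ρ hρ => ?_⟩
  · rw [hiso]
    have hfin : (∀ s, (∃ u : ℂ, ∀ x ∈ D, Q (L x) s 1 = u) ∧ FiniteSystem P D L s) ↔
        ∀ s, (∀ x ∈ D, ∀ α, fderiv ℂ (fun y => Q (L y) s 1) x α = 0) ∧
          ∀ x ∈ D, ∀ α, FiniteVarSystem P L s x α :=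
      forall_congr' fun s => and_congr (hconst s) (finiteSystem_iff hadm s)
    rw [← hfin]
    exact and_congr_right fun h => hinf fun s => (h s).1
  · have hsol := finite_solution_iff hD hc hadm hL hρ
    rw [hiso]
    constructor
    · rintro ⟨h1, h2⟩
      choose q hq using fun s => (hconst s).2 (h1 s).1
      choose v hv using fun s => (hsol s).1 (h1 s).2
      have hω := ((hinf fun s => ⟨q s, hq s⟩).1 h2).1
      obtain ⟨uInf, huInf⟩ : ∃ u : ℕ → ℂ, 4 ≤ S.rInf → ∀ x ∈ D, ∀ i : Fin (S.rInf - 2),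
          QInf (L x) (S.rInf - 3 - i) = omega P x (L x) * ∑ j : Fin (S.rInf - 2),
            infiniteCoeff S.rInf (P.tInf x) i j *
              (if (j : ℕ) = 0 then 1 else u (S.rInf - 3 - j)) := by
        by_cases hR : 4 ≤ S.rInf
        · obtain ⟨w, hw⟩ := hω (by omega)
          obtain ⟨u, hu⟩ := (infinite_solution_iff hD hc hL hR hw).1 (h2 (by omega))
          exact ⟨u, fun _ => hu⟩
        · exact ⟨0, fun h => absurd h hR⟩
      have hQ : ∀ s, ∀ x ∈ D, ∀ i : Fin (S.r s - 1), Q (L x) s (S.r s - i) =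
          ∑ j : Fin (S.r s - 1), finiteCoeff (S.r s - 1) (ρ s x) (P.t x s) i j *
            (if S.r s - (j : ℕ) = 1 then q s else v s (S.r s - (S.r s - j))) := by
        intro s x hx i
        rw [hv s x hx i]
        refine Finset.sum_congr rfl fun j _ => ?_
        have := j.isLt
        rw [if_neg (by omega), show S.r s - (S.r s - (j : ℕ)) = j by omega]
      -- Index 1 is reserved for the residue. The columns j < r_s - 1 use only indices r_s - j ≥ 2,
      -- so there is no clash.
      refine ⟨fun s k => if k = 1 then q s else v s (S.r s - k), uInf, ?_, hQ, hω, huInf, ?_, ?_⟩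
      · intro s x hx
        simpa using hq s x hx
      · intro hR x hx
        rw [omega, if_neg (by omega), if_pos hR]
        exact Finset.sum_congr rfl fun s _ => by simpa using hq s x hx
      · intro hR
        obtain ⟨x₀, hx₀⟩ := hc.nonempty
        refine ⟨?_, fun x hx => ?_⟩
        -- For r_∞ = 1 the residues sum to a diagonal matrix, so their entries (1,2) add up to zero.
        · have := congrArg (fun M => M 0 1) ((hL.lax x₀ hx₀).lead_one hR)
          simp only [Matrix.sum_apply] at this
          have h0 : (-(P.tInf x₀ 0) • sigma3) 0 1 = 0 := by simp [sigma3]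
          rw [h0] at this
          rw [← this]
          exact Finset.sum_congr rfl fun s _ => by simpa [Q] using (hq s x₀ hx₀).symm
        · rw [omega, if_pos hR, ← Finset.sum_add_distrib]
          refine Finset.sum_congr rfl fun s _ => ?_
          beta_reduce
          rw [add_comm, if_pos (rfl : 1 = 1), hq s x hx]
          congr 1
          -- The coefficient Q_{X_s,2} is the last row, i = r_s - 2, of the finite solution; for r_s
          -- = 1 both this term and the sum over columns are absent.
          split_ifs with hr
          · have := hQ s x hx ⟨S.r s - 2, by omega⟩
            rw [← this]
            simp only
            rw [show S.r s - (S.r s - 2) = 2 by omega]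
          · have : IsEmpty (Fin (S.r s - 1)) := by
              rw [show S.r s - 1 = 0 by omega]; infer_instance
            rw [Finset.univ_eq_empty, Finset.sum_empty]
    · rintro ⟨u, uInf, h1, h2, hω, h4, -, -⟩
      have hres : ∀ s, ∃ u : ℂ, ∀ x ∈ D, Q (L x) s 1 = u := fun s => ⟨u s 1, h1 s⟩
      refine ⟨fun s => ⟨(hconst s).1 (hres s), (hsol s).2 ⟨fun j => u s (S.r s - j), h2 s⟩⟩,
        fun hR => ?_⟩
      by_cases hR4 : 4 ≤ S.rInf
      · obtain ⟨w, hw⟩ := hω (by omega)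
        exact (infinite_solution_iff hD hc hL hR4 hw).2 ⟨uInf, h4 hR4⟩
      · exact (hinf hres).2 ⟨hω, fun h => absurd h hR4, fun h => absurd h (by omega)⟩ hR
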